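/- **Theorem (Correctness of reductions).** *Categories.* A *differential $\lambda$-category* is a Cartesian closed category $\mathcal C$ that is a Cartesian differential category (hom-sets are commutative monoids, $(g+h)\circ f=g\circ f+h\circ f$ and $0\circ f=0$; projections and pairings of additive maps are additive; there is an operator $D$ sending $f:A\to B$ to $D[f]:A\times A\to B$, first argument the direction, that satisfies the axioms CD1--CD7), in which currying is additive and D-curry holds: $D[\lambda(f)]=\lambda\big(D[f]\circ\langle \pi_1\times 0,\pi_2\times \mathrm{Id}\rangle\big)$. A morphism $f$ is *linear* if $D[f]=f\circ\pi_1$. Let $\mathcal C$ be such a category in which the language below can be interpreted: (i) $\mathbb R$ is an object of $\mathcal C$: its elements $1\to\mathbb R$ are the real numbers with their addition, morphisms $\mathbb R^n\to\mathbb R$ $(n\ge 1)$ are determined by their values on real vectors, multiplication by a real number is a linear morphism, and each function $f$ of a fixed family $\mathcal F$ of smooth functions $\mathbb R^n\to\mathbb R^m$ $(n,m\ge1)$ is a morphism whose derivative $D[f]$ is given on real vectors by the Jacobian, $D[f]\langle v,x\rangle=\mathcal J(f)(x)(v)$; (ii) for each object $A$ there is an object $L(A,\mathbb R)$ of linear morphisms,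 the subobject of $A\Rightarrow\mathbb R$, with linear inclusion, through which exactly the families of linear morphisms $A\to\mathbb R$ factor. Assume that $\mathcal C$ has the *Hahn--Banach separation property*: for distinct (generalised) elements $x,y:X\to A$ of an object $A$ there is a linear morphism $l:A\to\mathbb R$ with $l\circ x\ne l\circ y$. *Language.* Types: $\sigma::=\mathsf R\mid\sigma_1\times\sigma_2\mid\sigma_1\Rightarrow\sigma_2\mid\sigma^*$; $\mathsf R^{n+1}=\mathsf R^n\times\mathsf R$, $\Omega\sigma=\sigma\Rightarrow\sigma^*$. Simply typed terms $$P::=x\mid 0\mid P_1+P_2\mid\lambda x.P\mid P_1P_2\mid\pi_iP\mid\langle P_1,P_2\rangle\mid \underline r\mid \underline f(P)\mid \mathcal Jf\cdot P\mid(\lambda x.P_1)^*\cdot P_2\mid\Omega(\lambda x.P_1)\cdot P_2\mid \underline{\vec r}^{\,*}$$ with $r\in\mathbb R$, $f\in\mathcal F$, $\vec r\in\mathbb R^n$; here $0$ and $+$ exist at every type; for $f:\mathbb R^n\to\mathbb R^m$, $\mathcal Jf\cdot P:\mathsf R^n\Rightarrow\mathsf R^m$ when $P:\mathsf R^n$;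 $\underline{\vec r}^{\,*}:(\mathsf R^n)^*$; if $x:\sigma\vdash P_1:\tau$, then $(\lambda x.P_1)^*\cdot P_2:\sigma^*$ when $P_2:\tau^*$ and $x\in\mathrm{lin}(P_1)$, and $\Omega(\lambda x.P_1)\cdot P_2:\Omega\sigma$ when $P_2:\Omega\tau$. The set of linear variables is: $\mathrm{lin}(x)=\{x\}$; $\mathrm{lin}(\lambda x.S)=\mathrm{lin}(S)\setminus\{x\}$; $\mathrm{lin}(S\,P)=\mathrm{lin}(S)\setminus\mathrm{fv}(P)$; $\mathrm{lin}(\pi_iS)=\mathrm{lin}(\mathcal Jf\cdot S)=\mathrm{lin}(S)$; $\mathrm{lin}\langle S_1,S_2\rangle=\mathrm{lin}(S_1+S_2)=\mathrm{lin}(S_1)\cap\mathrm{lin}(S_2)$; $\mathrm{lin}((\lambda x.S_1)^*\cdot S_2)=(\mathrm{lin}(S_1)\setminus(\{x\}\cup\mathrm{fv}(S_2)))\cup(\mathrm{lin}(S_2)\setminus\mathrm{fv}(\lambda x.S_1))$; every variable is in $\mathrm{lin}(0)$; otherwise $\mathrm{lin}(S)=\varnothing$. We write $\mathrm{let}\ x=t\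 \mathrm{in}\ s$ for $(\lambda x.s)\,t$, $y_{\pi i}$ for an iterated projection of $y$ (possibly $y$ itself), and $\lambda\langle y,x\rangle.S$ for $\lambda z.S[\pi_1z/y][\pi_2z/x]$. Terms are taken up to $\alpha$-equivalence and up to the congruence $\equiv$ generated by: $+$ is associative and commutative with unit $0$; for well-typed terms, if $y\in\mathrm{lin}(S)$ then $S[A+B/y]\equiv S[A/y]+S[B/y]$ and $S[0/y]\equiv0$; $\lambda x.(s+p)\equiv\lambda x.s+\lambda x.p$, $\lambda x.0\equiv 0$; $(\lambda x.(s+p))^*\cdot t\equiv(\lambda x.s)^*\cdot t+(\lambda x.p)^*\cdot t$ (for $x$ linear in $s$ and $p$), $(\lambda x.0)^*\cdot t\equiv0$ (for well-typed $t$). *Interpretation.* $⟦\mathsf R⟧=\mathbb R$, $⟦\sigma\times\tau⟧=⟦\sigma⟧\times⟦\tau⟧$, $⟦\sigma\Rightarrow\tau⟧=⟦\sigma⟧\Rightarrow⟦\tau⟧$, $⟦\sigma^*⟧=L(⟦\sigma⟧,\mathbb R)$, and $⟦\Gamma\vdash P:\sigma⟧:⟦\Gamma⟧\to⟦\sigma⟧$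 is the standard Cartesian closed interpretation, with $⟦0⟧\gamma=0$, $⟦S+P⟧\gamma=⟦S⟧\gamma+⟦P⟧\gamma$, $⟦\underline f(P)⟧\gamma=f(⟦P⟧\gamma)$, $⟦\mathcal Jf\cdot S⟧\gamma=\lambda x.\,D[f]\langle⟦S⟧\gamma,x\rangle$, $⟦\underline{\vec r}^{\,*}⟧\gamma=(v\mapsto\sum_ir_iv_i)$, $$⟦(\lambda x.S_1)^*\cdot S_2⟧\gamma=\lambda v.\,⟦S_2⟧\gamma\,(⟦S_1⟧\langle\gamma,v\rangle),\qquad ⟦\Omega(\lambda x.P)\cdot S⟧\gamma=\lambda x\,v.\,⟦S⟧\gamma\,(⟦P⟧\langle\gamma,x\rangle)\,(D[⟦P⟧\langle\gamma,-\rangle]\langle v,x\rangle),$$ the first being defined only if $⟦S_1⟧\langle\gamma,-\rangle$ is linear; a term has a denotation if all these conditions hold in its subterms. *Administrative reduction* $\to_A$: the closure under arbitrary contexts and under $\equiv$ of the rules below, each optionally followed by flattening of nested lets ($\mathrm{let}\ y=(\mathrm{let}\ x=E\ \mathrm{in}\ L)\ \mathrm{in}\ M$ becomes $\mathrm{let}\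 x=E\ \mathrm{in}\ \mathrm{let}\ y=L\ \mathrm{in}\ M$, and $\mathrm{let}\ y=(\mathrm{let}\ x=E\ \mathrm{in}\ x)\ \mathrm{in}\ M$ becomes $\mathrm{let}\ y=E\ \mathrm{in}\ M$), with fresh $x_1,x_2,x_3$: - $e\to_A\mathrm{let}\ x_1=e\ \mathrm{in}\ x_1$ for $e$ one of $0$, $x$, $\lambda z.L$, $\underline r$, $\underline{\vec r}^{\,*}$; - $c(L_1,L_2)\to_A\mathrm{let}\ x_1=L_1;\,x_2=L_2;\,x_3=c(x_1,x_2)\ \mathrm{in}\ x_3$ for $c(a,b)$ one of $a+b$, $a\,b$, $\langle a,b\rangle$; - $c(L)\to_A\mathrm{let}\ x_1=L;\,x_2=c(x_1)\ \mathrm{in}\ x_2$ for $c(a)$ one of $\pi_i a$, $\underline f(a)$, $\mathcal Jf\cdot a$, $(\lambda z.L')^*\cdot a$, $\Omega(\lambda z.L')\cdot a$. *Reduction* $\to$: the smallest relation closed under arbitrary contexts, under $\equiv$, under substitution (of well-typed terms into well-typed terms, $P[V/x]\to P'[V/x]$ if $P\to P'$), containing $\to_A$ and the following rules. Here $\to^*$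 is the reflexive transitive closure of $\to$ up to $\equiv$; $\omega'$ is fresh (and not free in $S$); letters range over all terms of fitting type, so that the call-by-value strategy, where some of them are values, elementary terms or let series, is contained in $\to$; $y\notin\mathrm{fv}(z)$. 1. $(\lambda x.S)V\to S[V/x]$. 2. $\pi_i\langle V_1,V_2\rangle\to V_i$. 3. $\underline f(\underline{\vec r})\to\underline{f(\vec r)}$. 4. $(\mathcal Jf\cdot\underline{\vec r})\,\underline{\vec r'}\to\underline{\mathcal J(f)(\vec r')(\vec r)}$. 5. $(\lambda v.(\mathcal Jf\cdot v)\,\underline{\vec r})^*\cdot\underline{\vec r'}^{\,*}\to\big(\underline{\mathcal J(f)(\vec r)^{*}(\vec r')}\big)^*$, with the transposed Jacobian. 6. $(\lambda v_1.V_1)^*\cdot((\lambda v_2.V_2)^*\cdot V_3)\to(\lambda v_1.V_2[V_1/v_2])^*\cdot V_3$. 7. $\Omega(\lambda y.\mathrm{let}\ x=E\ \mathrm{in}\ x)\cdot\omega\to\Omega(\lambda y.E)\cdot\omega$. 8. $\Omega(\lambda y.\mathrm{let}\ x=E\ \mathrm{in}\ L)\cdot\omega\to\Omega(\lambda y.\langle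 y,E\rangle)\cdot(\Omega(\lambda\langle y,x\rangle.L)\cdot\omega)$. 9. $(\Omega(\lambda y.E)\cdot\omega)V\to0$ if $y\notin\mathrm{fv}(E)$. 10. (a) $(\Omega(\lambda y.z+y_{\pi j})\cdot\omega)V\to(\lambda v.v_{\pi j})^*\cdot(\omega(z+V_{\pi j}))$; (b) $(\Omega(\lambda y.y_{\pi i}+y_{\pi j})\cdot\omega)V\to(\lambda v.v_{\pi i}+v_{\pi j})^*\cdot(\omega(V_{\pi i}+V_{\pi j}))$. 11. $(\Omega(\lambda y.y)\cdot\omega)V\to(\lambda v.v)^*\cdot(\omega V)$. 12. $(\Omega(\lambda y.y_{\pi i})\cdot\omega)V\to(\lambda v.v_{\pi i})^*\cdot(\omega V_{\pi i})$. 13. (a) $(\Omega(\lambda y.\langle y_{\pi i},z\rangle)\cdot\omega)V\to(\lambda v.\langle v_{\pi i},0\rangle)^*\cdot(\omega\langle V_{\pi i},z\rangle)$; (b) $(\Omega(\lambda y.\langle z,y_{\pi j}\rangle)\cdot\omega)V\to(\lambda v.\langle 0,v_{\pi j}\rangle)^*\cdot(\omega\langle z,V_{\pi j}\rangle)$; (c)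 $(\Omega(\lambda y.\langle y_{\pi i},y_{\pi j}\rangle)\cdot\omega)V\to(\lambda v.\langle v_{\pi i},v_{\pi j}\rangle)^*\cdot(\omega\langle V_{\pi i},V_{\pi j}\rangle)$. 14. $(\Omega(\lambda y.\mathcal Jf\cdot y_{\pi i})\cdot\omega)V\to(\lambda v.\mathcal Jf\cdot v_{\pi i})^*\cdot(\omega(\mathcal Jf\cdot V_{\pi i}))$. 15. $(\Omega(\lambda y.\underline f(y_{\pi i}))\cdot\omega)V\to(\lambda v.(\mathcal Jf\cdot v_{\pi i})V_{\pi i})^*\cdot(\omega(\underline f(V_{\pi i})))$. 16. (a) $(\Omega(\lambda y.(\lambda x.L)^*\cdot y_{\pi i})\cdot\omega)V\to(\lambda v.(\lambda x.L)^*\cdot v_{\pi i})^*\cdot(\omega((\lambda x.L)^*\cdot V_{\pi i}))$ if $y\notin\mathrm{fv}(\lambda x.L)$. If $(\Omega(\lambda y.L)\cdot\omega')V\to^*(\lambda v.S)^*\cdot(\omega'V')$, then (b) $(\Omega(\lambda y.(\lambda x.L)^*\cdot z)\cdot\omega)V\to(\lambda v.(\lambda x.S)^*\cdot z)^*\cdot(\omega((\lambda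 x.L[V/y])^*\cdot z))$ and (c) $(\Omega(\lambda y.(\lambda x.L)^*\cdot y_{\pi i})\cdot\omega)V\to(\lambda v.(\lambda x.L[V/y])^*\cdot v_{\pi i}+(\lambda x.S)^*\cdot V_{\pi i})^*\cdot(\omega((\lambda x.L[V/y])^*\cdot V_{\pi i}))$. 17. If $(\Omega(\lambda x.L)\cdot z)a\to^*(\lambda v.S)^*\cdot(z\,L[a/x])$ for a variable $a$, then $(\Omega(\lambda y.\Omega(\lambda x.L)\cdot z)\cdot\omega)V\to(\Omega(\lambda y.\lambda a.(\lambda v.S)^*\cdot(z\,L[a/x]))\cdot\omega)V$ (here $y$ may occur in $z$). 18. If $(\Omega(\lambda y.L)\cdot\omega')V\to^*(\lambda v.S)^*\cdot(\omega'L[V/y])$ and $x\notin\mathrm{fv}(V)$, then $(\Omega(\lambda y.\lambda x.L)\cdot\omega)V\to(\lambda v.\lambda x.S)^*\cdot(\omega(\lambda x.L[V/y]))$. 19. (a) $(\Omega(\lambda y.y_{\pi i}\,z)\cdot\omega)V\to(\lambda v.v_{\pi i}\,z)^*\cdot(\omega(V_{\pi i}\,z))$. If the component $V_{\pi i}$ of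 the tuple $V$ is $\lambda z.P'$, then (b) if $(\Omega(\lambda z.P')\cdot\omega')V_{\pi j}\to^*(\lambda v'.S')^*\cdot(\omega'(P'[V_{\pi j}/z]))$, then $(\Omega(\lambda y.y_{\pi i}\,y_{\pi j})\cdot\omega)V\to(\lambda v.v_{\pi i}V_{\pi j}+S'[v_{\pi j}/v'])^*\cdot(\omega(V_{\pi i}V_{\pi j}))$; (c) if $(\Omega(\lambda z.P')\cdot\omega')V_{\pi j}\to^*0$, then $(\Omega(\lambda y.y_{\pi i}\,y_{\pi j})\cdot\omega)V\to(\lambda v.v_{\pi i}V_{\pi j})^*\cdot(\omega(V_{\pi i}V_{\pi j}))$. 20. (a) If $y\in\mathrm{fv}(E)$ and $(\Omega(\lambda y.E)\cdot\omega')V\to^*(\lambda v.S)^*\cdot(\omega'(E[V/y]))$, then $(\Omega(\lambda y.\langle y,E\rangle)\cdot\omega)V\to(\lambda v.\langle v,S\rangle)^*\cdot(\omega\langle V,E[V/y]\rangle)$; (b) if $y\notin\mathrm{fv}(E)$, then $(\Omega(\lambda y.\langle y,E\rangle)\cdot\omega)V\to(\lambda v.\langle v,0\rangle)^*\cdot(\omega\langle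 V,E\rangle)$. *Conclusion.* Every well-typed $\Gamma\vdash P:\sigma$ has a denotation $⟦P⟧$, and a term has at most one. Moreover 1. $P\to_AP'$ implies $⟦P⟧=⟦P'⟧$; 2. $P\to P'$ implies $⟦P⟧=⟦P'⟧$; in the sense that whenever $⟦P⟧$ is defined (in particular, whenever $P$ is well-typed), so is $⟦P'⟧$, and the two are equal. -/

import Mathlib

open CategoryTheory MonoidalCategory CartesianMonoidalCategory
open scoped ContDiff

universe v u

/-! ## Differential lambda-categories -/

/-- A Cartesian differential category: every hom-set is a commutative monoid, precomposition
preserves it, products are compatible with it, and there is a differential operator `D` subject to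
CD1 to CD7.  Composition is written in diagrammatic order, `f ≫ g` being `g ∘ f`; in `D f` the
first component is the direction and the second one the base point. -/
class CartesianDifferentialCategory (C : Type u) [Category.{v} C] [CartesianMonoidalCategory C] where
  homAdd : ∀ A B : C, AddCommMonoid (A ⟶ B)
  comp_add : ∀ {X A B : C} (f : X ⟶ A) (g h : A ⟶ B), f ≫ (g + h) = f ≫ g + f ≫ h
  comp_zero : ∀ {X A B : C} (f : X ⟶ A), f ≫ (0 : A ⟶ B) = 0
  fst_additive : ∀ {X A B : C},
    (∀ g h : X ⟶ A ⊗ B, (g + h) ≫ fst A B = g ≫ fst A B + h ≫ fst A B) ∧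
      (0 : X ⟶ A ⊗ B) ≫ fst A B = 0
  snd_additive : ∀ {X A B : C},
    (∀ g h : X ⟶ A ⊗ B, (g + h) ≫ snd A B = g ≫ snd A B + h ≫ snd A B) ∧
      (0 : X ⟶ A ⊗ B) ≫ snd A B = 0
  lift_additive : ∀ {A B₁ B₂ : C} (f₁ : A ⟶ B₁) (f₂ : A ⟶ B₂),
    (∀ X : C, (∀ g h : X ⟶ A, (g + h) ≫ f₁ = g ≫ f₁ + h ≫ f₁) ∧ (0 : X ⟶ A) ≫ f₁ = 0) →
    (∀ X : C, (∀ g h : X ⟶ A, (g + h) ≫ f₂ = g ≫ f₂ + h ≫ f₂) ∧ (0 : X ⟶ A) ≫ f₂ = 0) →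
    ∀ X : C, (∀ g h : X ⟶ A, (g + h) ≫ lift f₁ f₂ = g ≫ lift f₁ f₂ + h ≫ lift f₁ f₂) ∧
      (0 : X ⟶ A) ≫ lift f₁ f₂ = 0
  D : ∀ {A B : C}, (A ⟶ B) → (A ⊗ A ⟶ B)
  cd1_add : ∀ {A B : C} (f g : A ⟶ B), D (f + g) = D f + D g
  cd1_zero : ∀ {A B : C}, D (0 : A ⟶ B) = 0
  cd2_add : ∀ {X A B : C} (f : A ⟶ B) (h k w : X ⟶ A),
    lift (h + k) w ≫ D f = lift h w ≫ D f + lift k w ≫ D f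
  cd2_zero : ∀ {X A B : C} (f : A ⟶ B) (w : X ⟶ A), lift 0 w ≫ D f = 0
  cd3_id : ∀ A : C, D (𝟙 A) = fst A A
  cd3_fst : ∀ A B : C, D (fst A B) = fst (A ⊗ B) (A ⊗ B) ≫ fst A B
  cd3_snd : ∀ A B : C, D (snd A B) = fst (A ⊗ B) (A ⊗ B) ≫ snd A B
  cd4 : ∀ {A B₁ B₂ : C} (f : A ⟶ B₁) (g : A ⟶ B₂), D (lift f g) = lift (D f) (D g)
  cd5 : ∀ {A B E : C} (f : A ⟶ B) (g : B ⟶ E), D (f ≫ g) = lift (D f) (snd A A ≫ f) ≫ D g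
  cd6 : ∀ {X A B : C} (f : A ⟶ B) (g h k : X ⟶ A),
    lift (lift g 0) (lift h k) ≫ D (D f) = lift g k ≫ D f
  cd7 : ∀ {X A B : C} (f : A ⟶ B) (g h k : X ⟶ A),
    lift (lift 0 h) (lift g k) ≫ D (D f) = lift (lift 0 g) (lift h k) ≫ D (D f)

attribute [reducible, instance] CartesianDifferentialCategory.homAdd

namespace CartesianDifferentialCategory

variable {C : Type u} [Category.{v} C] [CartesianMonoidalCategory C]

section Closed

variable [MonoidalClosed C]

/-- The exponential transpose `λ(f) : X ⟶ (A ⇒ B)` of `f : X × A ⟶ B`. -/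
noncomputable def lam {X A B : C} (f : X ⊗ A ⟶ B) : X ⟶ (ihom A).obj B :=
  MonoidalClosed.curry (lift (snd A X) (fst A X) ≫ f)

/-- The evaluation morphism `(A ⇒ B) × A ⟶ B`. -/
noncomputable def ev (A B : C) : (ihom A).obj B ⊗ A ⟶ B :=
  lift (snd _ _) (fst _ _) ≫ (ihom.ev A).app B

end Closed

variable [CartesianDifferentialCategory C]

/-- A morphism is linear if its derivative is `D[f] = f ∘ π₁`. -/
def IsLinear {A B : C} (f : A ⟶ B) : Prop := D f = fst A A ≫ f

/-- The partial derivative in the second variable, `((x, a), w) ↦ D[f(x, -)](w, a)`. -/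
def D₂ {X A B : C} (f : X ⊗ A ⟶ B) : (X ⊗ A) ⊗ A ⟶ B :=
  lift (lift 0 (snd (X ⊗ A) A)) (fst (X ⊗ A) A) ≫ D f

/-- `f(x, -)` is linear for every `x`: the partial derivative is `((x, a), w) ↦ f(x, w)`. -/
def IsLinear₂ {X A B : C} (f : X ⊗ A ⟶ B) : Prop :=
  D₂ f = lift (fst (X ⊗ A) A ≫ fst X A) (snd (X ⊗ A) A) ≫ f

end CartesianDifferentialCategory

open CartesianDifferentialCategory

/-- A differential lambda-category: a Cartesian closed Cartesian differential category in which
`λ(-)` is additive and the rule D-curry holds. -/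
class DifferentialLambdaCategory (C : Type u) [Category.{v} C] [CartesianMonoidalCategory C]
    [MonoidalClosed C] extends CartesianDifferentialCategory C where
  lam_add : ∀ {X A B : C} (f g : X ⊗ A ⟶ B), lam (f + g) = lam f + lam g
  lam_zero : ∀ {X A B : C}, lam (0 : X ⊗ A ⟶ B) = 0
  d_curry : ∀ {A₁ A₂ B : C} (f : A₁ ⊗ A₂ ⟶ B),
    D (lam f) = lam (lift (fst A₁ A₁ ⊗ₘ (0 : A₂ ⟶ A₂)) (snd A₁ A₁ ⊗ₘ 𝟙 A₂) ≫ D f)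

/-! ## Types and terms -/

/-- Types: `R`, products, function types and dual types. -/
inductive Ty : Type
  | real : Ty
  | prod : Ty → Ty → Ty
  | arrow : Ty → Ty → Ty
  | dual : Ty → Ty

/-- `Ty.pow n` is the type `R^(n+1)`, where `R^(n+2) = R^(n+1) × R`. -/
def Ty.pow : ℕ → Ty
  | 0 => Ty.real
  | n + 1 => Ty.prod (Ty.pow n) Ty.real

/-- The type `Ω σ = σ ⇒ σ*` of differential 1-forms. -/
abbrev Ty.form (σ : Ty) : Ty := Ty.arrow σ (Ty.dual σ)

/-- A collection of easily differentiable functions: `Sym n m` indexes its members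
`ℝ^(n+1) → ℝ^(m+1)`, which are smooth. -/
structure FunSig where
  Sym : ℕ → ℕ → Type
  fn : ∀ {n m : ℕ}, Sym n m → (Fin (n + 1) → ℝ) → (Fin (m + 1) → ℝ)
  smooth : ∀ {n m : ℕ} (f : Sym n m), ContDiff ℝ ∞ (fn f)

/-- Typed de Bruijn variables. -/
inductive Var : List Ty → Ty → Type
  | vz {Γ : List Ty} {σ : Ty} : Var (σ :: Γ) σ
  | vs {Γ : List Ty} {σ τ : Ty} : Var Γ σ → Var (τ :: Γ) σ

/-- The de Bruijn index of a variable. -/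
def Var.idx : ∀ {Γ : List Ty} {σ : Ty}, Var Γ σ → ℕ
  | _, _, Var.vz => 0
  | _, _, Var.vs x => x.idx + 1

/-- Terms in context, up to renaming of bound variables.  `0` and `+` are allowed in every position,
since the reduction rules produce them below pairs, abstractions and dual maps.  The linearity side
condition on dual maps is the predicate `Tm.WellTyped` below. -/
inductive Tm (𝓕 : FunSig) : List Ty → Ty → Type
  | var {Γ : List Ty} {σ : Ty} : Var Γ σ → Tm 𝓕 Γ σ
  | zero {Γ : List Ty} {σ : Ty} : Tm 𝓕 Γ σ
  | add {Γ : List Ty} {σ : Ty} : Tm 𝓕 Γ σ → Tm 𝓕 Γ σ → Tm 𝓕 Γ σ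
  | lam {Γ : List Ty} {σ τ : Ty} : Tm 𝓕 (σ :: Γ) τ → Tm 𝓕 Γ (Ty.arrow σ τ)
  | app {Γ : List Ty} {σ τ : Ty} : Tm 𝓕 Γ (Ty.arrow σ τ) → Tm 𝓕 Γ σ → Tm 𝓕 Γ τ
  | fst {Γ : List Ty} {σ τ : Ty} : Tm 𝓕 Γ (Ty.prod σ τ) → Tm 𝓕 Γ σ
  | snd {Γ : List Ty} {σ τ : Ty} : Tm 𝓕 Γ (Ty.prod σ τ) → Tm 𝓕 Γ τ
  | pair {Γ : List Ty} {σ τ : Ty} : Tm 𝓕 Γ σ → Tm 𝓕 Γ τ → Tm 𝓕 Γ (Ty.prod σ τ)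
  | const {Γ : List Ty} : ℝ → Tm 𝓕 Γ Ty.real
  | fn {Γ : List Ty} {n m : ℕ} : 𝓕.Sym n m → Tm 𝓕 Γ (Ty.pow n) → Tm 𝓕 Γ (Ty.pow m)
  /-- The Jacobian `J f · S`, that is `λx. J(f)(x)(S)`. -/
  | jac {Γ : List Ty} {n m : ℕ} : 𝓕.Sym n m → Tm 𝓕 Γ (Ty.pow n) →
      Tm 𝓕 Γ (Ty.arrow (Ty.pow n) (Ty.pow m))
  /-- The dual map `(λx.S₁)* · S₂`. -/
  | dualMap {Γ : List Ty} {σ τ : Ty} : Tm 𝓕 (σ :: Γ) τ → Tm 𝓕 Γ (Ty.dual τ) → Tm 𝓕 Γ (Ty.dual σ)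
  /-- The pullback `Ω(λx.P) · S`. -/
  | pb {Γ : List Ty} {σ τ : Ty} : Tm 𝓕 (σ :: Γ) τ → Tm 𝓕 Γ (Ty.form τ) → Tm 𝓕 Γ (Ty.form σ)
  /-- The dual `r*` of a constant vector `r`. -/
  | dconst {Γ : List Ty} {n : ℕ} : (Fin (n + 1) → ℝ) → Tm 𝓕 Γ (Ty.dual (Ty.pow n))

namespace Tm

variable {𝓕 : FunSig}

/-- The variable with de Bruijn index `k` occurs free. -/
def Free : ∀ {Γ : List Ty} {σ : Ty}, ℕ → Tm 𝓕 Γ σ → Prop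
  | _, _, k, var x => x.idx = k
  | _, _, _, zero => False
  | _, _, k, add s p => Free k s ∨ Free k p
  | _, _, k, lam s => Free (k + 1) s
  | _, _, k, app s p => Free k s ∨ Free k p
  | _, _, k, fst s => Free k s
  | _, _, k, snd s => Free k s
  | _, _, k, pair s t => Free k s ∨ Free k t
  | _, _, _, const _ => False
  | _, _, k, fn _ p => Free k p
  | _, _, k, jac _ s => Free k s
  | _, _, k, dualMap s t => Free (k + 1) s ∨ Free k t
  | _, _, k, pb p s => Free (k + 1) p ∨ Free k s
  | _, _, _, dconst _ => False

/-- `Lin k S`: the variable with de Bruijn index `k` is a linear variable of `S`.  Every variable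
is linear in `0`, and a sum is linear in a variable if both summands are. -/
def Lin : ∀ {Γ : List Ty} {σ : Ty}, ℕ → Tm 𝓕 Γ σ → Prop
  | _, _, k, var x => x.idx = k
  | _, _, _, zero => True
  | _, _, k, add s p => Lin k s ∧ Lin k p
  | _, _, k, lam s => Lin (k + 1) s
  | _, _, k, app s p => Lin k s ∧ ¬ Free k p
  | _, _, k, fst s => Lin k s
  | _, _, k, snd s => Lin k s
  | _, _, k, pair s t => Lin k s ∧ Lin k t
  | _, _, _, const _ => False
  | _, _, _, fn _ _ => False
  | _, _, k, jac _ s => Lin k s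
  | _, _, k, dualMap s t => (Lin (k + 1) s ∧ ¬ Free k t) ∨ (Lin k t ∧ ¬ Free (k + 1) s)
  | _, _, _, pb _ _ => False
  | _, _, _, dconst _ => False

/-- The typing side condition: in every dual map `(λx.S₁)* · S₂` the variable `x` is linear
in `S₁`. -/
def WellTyped : ∀ {Γ : List Ty} {σ : Ty}, Tm 𝓕 Γ σ → Prop
  | _, _, var _ => True
  | _, _, zero => True
  | _, _, add s p => WellTyped s ∧ WellTyped p
  | _, _, lam s => WellTyped s
  | _, _, app s p => WellTyped s ∧ WellTyped p
  | _, _, fst s => WellTyped s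
  | _, _, snd s => WellTyped s
  | _, _, pair s t => WellTyped s ∧ WellTyped t
  | _, _, const _ => True
  | _, _, fn _ p => WellTyped p
  | _, _, jac _ s => WellTyped s
  | _, _, dualMap s t => WellTyped s ∧ WellTyped t ∧ Lin 0 s
  | _, _, pb p s => WellTyped p ∧ WellTyped s
  | _, _, dconst _ => True

/-! ### Renaming and capture-free substitution -/

/-- Renamings. -/
def Ren (Γ Δ : List Ty) : Type := ∀ σ : Ty, Var Γ σ → Var Δ σ

/-- The extension of a renaming below a binder. -/
def Ren.up {Γ Δ : List Ty} (ρ : Ren Γ Δ) (τ : Ty) : Ren (τ :: Γ) (τ :: Δ)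
  | _, Var.vz => Var.vz
  | _, Var.vs x => Var.vs (ρ _ x)

def rename : ∀ {Γ Δ : List Ty} {σ : Ty}, Ren Γ Δ → Tm 𝓕 Γ σ → Tm 𝓕 Δ σ
  | _, _, _, ρ, var x => var (ρ _ x)
  | _, _, _, _, zero => zero
  | _, _, _, ρ, add s p => add (rename ρ s) (rename ρ p)
  | _, _, _, ρ, lam s => lam (rename (ρ.up _) s)
  | _, _, _, ρ, app s p => app (rename ρ s) (rename ρ p)
  | _, _, _, ρ, fst s => fst (rename ρ s)
  | _, _, _, ρ, snd s => snd (rename ρ s)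
  | _, _, _, ρ, pair s t => pair (rename ρ s) (rename ρ t)
  | _, _, _, _, const r => const r
  | _, _, _, ρ, fn f p => fn f (rename ρ p)
  | _, _, _, ρ, jac f s => jac f (rename ρ s)
  | _, _, _, ρ, dualMap s t => dualMap (rename (ρ.up _) s) (rename ρ t)
  | _, _, _, ρ, pb p s => pb (rename (ρ.up _) p) (rename ρ s)
  | _, _, _, _, dconst r => dconst r

/-- Weakening by a fresh variable with index `0`. -/
def wk {Γ : List Ty} {σ : Ty} (τ : Ty) (s : Tm 𝓕 Γ σ) : Tm 𝓕 (τ :: Γ) σ :=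
  rename (fun _ x => Var.vs x) s

/-- Weakening by a fresh variable with index `1`, below one binder. -/
def wk₁ {Γ : List Ty} {σ ρ : Ty} (τ : Ty) (s : Tm 𝓕 (ρ :: Γ) σ) : Tm 𝓕 (ρ :: τ :: Γ) σ :=
  rename (Ren.up (fun _ x => Var.vs x) ρ) s

/-- Exchange of the two most recent variables, as a renaming. -/
def swapRen {Γ : List Ty} {α β : Ty} : Ren (α :: β :: Γ) (β :: α :: Γ)
  | _, Var.vz => Var.vs Var.vz
  | _, Var.vs Var.vz => Var.vz
  | _, Var.vs (Var.vs x) => Var.vs (Var.vs x)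

/-- Exchange of the two most recent variables. -/
def swap {Γ : List Ty} {α β σ : Ty} (s : Tm 𝓕 (α :: β :: Γ) σ) : Tm 𝓕 (β :: α :: Γ) σ :=
  rename swapRen s

/-- Substitutions. -/
def Sub (𝓕 : FunSig) (Γ Δ : List Ty) : Type := ∀ σ : Ty, Var Γ σ → Tm 𝓕 Δ σ

/-- The extension of a substitution below a binder. -/
def Sub.up {Γ Δ : List Ty} (θ : Sub 𝓕 Γ Δ) (τ : Ty) : Sub 𝓕 (τ :: Γ) (τ :: Δ)
  | _, Var.vz => var Var.vz
  | _, Var.vs x => wk τ (θ _ x)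

def subst : ∀ {Γ Δ : List Ty} {σ : Ty}, Sub 𝓕 Γ Δ → Tm 𝓕 Γ σ → Tm 𝓕 Δ σ
  | _, _, _, θ, var x => θ _ x
  | _, _, _, _, zero => zero
  | _, _, _, θ, add s p => add (subst θ s) (subst θ p)
  | _, _, _, θ, lam s => lam (subst (θ.up _) s)
  | _, _, _, θ, app s p => app (subst θ s) (subst θ p)
  | _, _, _, θ, fst s => fst (subst θ s)
  | _, _, _, θ, snd s => snd (subst θ s)
  | _, _, _, θ, pair s t => pair (subst θ s) (subst θ t)
  | _, _, _, _, const r => const r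
  | _, _, _, θ, fn f p => fn f (subst θ p)
  | _, _, _, θ, jac f s => jac f (subst θ s)
  | _, _, _, θ, dualMap s t => dualMap (subst (θ.up _) s) (subst θ t)
  | _, _, _, θ, pb p s => pb (subst (θ.up _) p) (subst θ s)
  | _, _, _, _, dconst r => dconst r

/-- The substitution `[a/x]` for the most recent variable. -/
def single {Γ : List Ty} {τ : Ty} (a : Tm 𝓕 Γ τ) : Sub 𝓕 (τ :: Γ) Γ
  | _, Var.vz => a
  | _, Var.vs x => var x

/-- `s[a/x]` for the most recent variable `x`. -/
def inst {Γ : List Ty} {σ τ : Ty} (s : Tm 𝓕 (τ :: Γ) σ) (a : Tm 𝓕 Γ τ) : Tm 𝓕 Γ σ :=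
  subst (single a) s

/-- `s[a/y]` for the variable `y` with index `1`, below one binder. -/
def inst₁ {Γ : List Ty} {σ τ ρ : Ty} (s : Tm 𝓕 (ρ :: τ :: Γ) σ) (a : Tm 𝓕 Γ τ) : Tm 𝓕 (ρ :: Γ) σ :=
  subst (Sub.up (single a) ρ) s

/-- The substitution `[π₁ z/y][π₂ z/x]` for the variables `x` (index `0`) and `y` (index `1`). -/
def unpairSub {Γ : List Ty} {α β : Ty} : Sub 𝓕 (α :: β :: Γ) (Ty.prod β α :: Γ)
  | _, Var.vz => snd (var Var.vz)
  | _, Var.vs Var.vz => fst (var Var.vz)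
  | _, Var.vs (Var.vs x) => var (Var.vs x)

/-- For `L` in the variables `x` (index `0`) and `y` (index `1`), the body
`L[π₁ z/y][π₂ z/x]` of `λ⟨y,x⟩.L`. -/
def unpair {Γ : List Ty} {α β σ : Ty} (s : Tm 𝓕 (α :: β :: Γ) σ) : Tm 𝓕 (Ty.prod β α :: Γ) σ :=
  subst unpairSub s

/-- The most recent variable. -/
abbrev v0 {Γ : List Ty} {σ : Ty} : Tm 𝓕 (σ :: Γ) σ := var Var.vz

/-- The second most recent variable. -/
abbrev v1 {Γ : List Ty} {σ τ : Ty} : Tm 𝓕 (τ :: σ :: Γ) σ := var (Var.vs Var.vz)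

/-- `let x = e in s`, that is `(λx.s) e`. -/
def letIn {Γ : List Ty} {σ τ : Ty} (e : Tm 𝓕 Γ σ) (s : Tm 𝓕 (σ :: Γ) τ) : Tm 𝓕 Γ τ := app (lam s) e

/-- The tuple of constants given by a real vector. -/
def constVec {Γ : List Ty} : ∀ {n : ℕ}, (Fin (n + 1) → ℝ) → Tm 𝓕 Γ (Ty.pow n)
  | 0, r => const (r 0)
  | n + 1, r => pair (constVec (n := n) (Fin.init r)) (const (r (Fin.last (n + 1))))

/-! ### One-hole frames -/

/-- `Frame Δ τ Γ σ`: a term former with a hole for a term `Δ ⊢ τ` and result `Γ ⊢ σ`. -/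
inductive Frame (𝓕 : FunSig) : List Ty → Ty → List Ty → Ty → Type
  | addL {Γ : List Ty} {σ : Ty} : Tm 𝓕 Γ σ → Frame 𝓕 Γ σ Γ σ
  | addR {Γ : List Ty} {σ : Ty} : Tm 𝓕 Γ σ → Frame 𝓕 Γ σ Γ σ
  | lam {Γ : List Ty} {σ τ : Ty} : Frame 𝓕 (σ :: Γ) τ Γ (Ty.arrow σ τ)
  | appL {Γ : List Ty} {σ τ : Ty} : Tm 𝓕 Γ σ → Frame 𝓕 Γ (Ty.arrow σ τ) Γ τ
  | appR {Γ : List Ty} {σ τ : Ty} : Tm 𝓕 Γ (Ty.arrow σ τ) → Frame 𝓕 Γ σ Γ τ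
  | fst {Γ : List Ty} {σ τ : Ty} : Frame 𝓕 Γ (Ty.prod σ τ) Γ σ
  | snd {Γ : List Ty} {σ τ : Ty} : Frame 𝓕 Γ (Ty.prod σ τ) Γ τ
  | pairL {Γ : List Ty} {σ τ : Ty} : Tm 𝓕 Γ τ → Frame 𝓕 Γ σ Γ (Ty.prod σ τ)
  | pairR {Γ : List Ty} {σ τ : Ty} : Tm 𝓕 Γ σ → Frame 𝓕 Γ τ Γ (Ty.prod σ τ)
  | fn {Γ : List Ty} {n m : ℕ} : 𝓕.Sym n m → Frame 𝓕 Γ (Ty.pow n) Γ (Ty.pow m)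
  | jac {Γ : List Ty} {n m : ℕ} : 𝓕.Sym n m →
      Frame 𝓕 Γ (Ty.pow n) Γ (Ty.arrow (Ty.pow n) (Ty.pow m))
  | dualMapL {Γ : List Ty} {σ τ : Ty} : Tm 𝓕 Γ (Ty.dual τ) → Frame 𝓕 (σ :: Γ) τ Γ (Ty.dual σ)
  | dualMapR {Γ : List Ty} {σ τ : Ty} : Tm 𝓕 (σ :: Γ) τ → Frame 𝓕 Γ (Ty.dual τ) Γ (Ty.dual σ)
  | pbL {Γ : List Ty} {σ τ : Ty} : Tm 𝓕 Γ (Ty.form τ) → Frame 𝓕 (σ :: Γ) τ Γ (Ty.form σ)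
  | pbR {Γ : List Ty} {σ τ : Ty} : Tm 𝓕 (σ :: Γ) τ → Frame 𝓕 Γ (Ty.form τ) Γ (Ty.form σ)

/-- Filling the hole of a frame. -/
def Frame.plug : ∀ {Δ : List Ty} {τ : Ty} {Γ : List Ty} {σ : Ty},
    Frame 𝓕 Δ τ Γ σ → Tm 𝓕 Δ τ → Tm 𝓕 Γ σ
  | _, _, _, _, .addL p, s => .add s p
  | _, _, _, _, .addR s, p => .add s p
  | _, _, _, _, .lam, s => .lam s
  | _, _, _, _, .appL p, s => .app s p
  | _, _, _, _, .appR s, p => .app s p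
  | _, _, _, _, .fst, s => .fst s
  | _, _, _, _, .snd, s => .snd s
  | _, _, _, _, .pairL t, s => .pair s t
  | _, _, _, _, .pairR s, t => .pair s t
  | _, _, _, _, .fn f, p => .fn f p
  | _, _, _, _, .jac f, s => .jac f s
  | _, _, _, _, .dualMapL t, s => .dualMap s t
  | _, _, _, _, .dualMapR s, t => .dualMap s t
  | _, _, _, _, .pbL s, p => .pb p s
  | _, _, _, _, .pbR p, s => .pb p s

/-! ### Identification of terms -/

/-- The identification `≡` of terms: `+` is associative and commutative with unit `0`, and sums in
linear positions distribute, `S[A + B/y] ≡ S[A/y] + S[B/y]` and `S[0/y] ≡ 0` for a linear variable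
`y` of `S`; likewise for sums that form the body of an abstraction or of a dual map. -/
inductive Eqv : ∀ {Γ : List Ty} {σ : Ty}, Tm 𝓕 Γ σ → Tm 𝓕 Γ σ → Prop
  | refl {Γ : List Ty} {σ : Ty} (p : Tm 𝓕 Γ σ) : Eqv p p
  | symm {Γ : List Ty} {σ : Ty} {p q : Tm 𝓕 Γ σ} : Eqv p q → Eqv q p
  | trans {Γ : List Ty} {σ : Ty} {p q r : Tm 𝓕 Γ σ} : Eqv p q → Eqv q r → Eqv p r
  | frame {Δ Γ : List Ty} {τ σ : Ty} (K : Frame 𝓕 Δ τ Γ σ) {p q : Tm 𝓕 Δ τ} :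
      Eqv p q → Eqv (K.plug p) (K.plug q)
  | add_zero {Γ : List Ty} {σ : Ty} (p : Tm 𝓕 Γ σ) : Eqv (add p zero) p
  | add_comm {Γ : List Ty} {σ : Ty} (p q : Tm 𝓕 Γ σ) : Eqv (add p q) (add q p)
  | add_assoc {Γ : List Ty} {σ : Ty} (p q r : Tm 𝓕 Γ σ) : Eqv (add (add p q) r) (add p (add q r))
  | lin_add {Γ : List Ty} {σ τ : Ty} (S : Tm 𝓕 (σ :: Γ) τ) (A B : Tm 𝓕 Γ σ) :
      S.WellTyped → A.WellTyped → B.WellTyped → Lin 0 S →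
      Eqv (inst S (add A B)) (add (inst S A) (inst S B))
  | lin_zero {Γ : List Ty} {σ τ : Ty} (S : Tm 𝓕 (σ :: Γ) τ) :
      S.WellTyped → Lin 0 S → Eqv (inst S zero) zero
  | lam_add {Γ : List Ty} {σ τ : Ty} (s p : Tm 𝓕 (σ :: Γ) τ) :
      Eqv (lam (add s p)) (add (lam s) (lam p))
  | lam_zero {Γ : List Ty} {σ τ : Ty} : Eqv (lam (zero : Tm 𝓕 (σ :: Γ) τ)) zero
  | dualMap_add {Γ : List Ty} {σ τ : Ty} (s p : Tm 𝓕 (σ :: Γ) τ) (t : Tm 𝓕 Γ (Ty.dual τ)) :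
      Lin 0 s → Lin 0 p → Eqv (dualMap (add s p) t) (add (dualMap s t) (dualMap p t))
  | dualMap_zero {Γ : List Ty} {σ τ : Ty} (t : Tm 𝓕 Γ (Ty.dual τ)) :
      t.WellTyped → Eqv (dualMap (zero : Tm 𝓕 (σ :: Γ) τ) t) zero

/-! ### Administrative reduction -/

/-- Flattening of nested lets, by which `let x = L in M` with a let series `L` is again a let
series. -/
inductive LetFlat : ∀ {Γ : List Ty} {σ : Ty}, Tm 𝓕 Γ σ → Tm 𝓕 Γ σ → Prop
  | refl {Γ : List Ty} {σ : Ty} (p : Tm 𝓕 Γ σ) : LetFlat p p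
  | trans {Γ : List Ty} {σ : Ty} {p q r : Tm 𝓕 Γ σ} : LetFlat p q → LetFlat q r → LetFlat p r
  | frame {Δ Γ : List Ty} {τ σ : Ty} (K : Frame 𝓕 Δ τ Γ σ) {p q : Tm 𝓕 Δ τ} :
      LetFlat p q → LetFlat (K.plug p) (K.plug q)
  | assoc {Γ : List Ty} {α β σ : Ty} (E : Tm 𝓕 Γ α) (L : Tm 𝓕 (α :: Γ) β) (M : Tm 𝓕 (β :: Γ) σ) :
      LetFlat (letIn (letIn E L) M) (letIn E (letIn L (wk₁ α M)))
  | last {Γ : List Ty} {α σ : Ty} (E : Tm 𝓕 Γ α) (M : Tm 𝓕 (α :: Γ) σ) :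
      LetFlat (letIn (letIn E v0) M) (letIn E M)

/-- The administrative reductions of the A-redexes, before flattening.  `L`, `L₁`, `L₂` range over
all terms, in particular over let series. -/
inductive ARule : ∀ {Γ : List Ty} {σ : Ty}, Tm 𝓕 Γ σ → Tm 𝓕 Γ σ → Prop
  | zero {Γ : List Ty} {σ : Ty} : ARule (zero : Tm 𝓕 Γ σ) (letIn zero v0)
  | add {Γ : List Ty} {σ : Ty} (L₁ L₂ : Tm 𝓕 Γ σ) :
      ARule (add L₁ L₂) (letIn L₁ (letIn (wk σ L₂) (letIn (add v1 v0) v0)))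
  | var {Γ : List Ty} {σ : Ty} (x : Var Γ σ) : ARule (var x : Tm 𝓕 Γ σ) (letIn (var x) v0)
  | lam {Γ : List Ty} {σ τ : Ty} (L : Tm 𝓕 (σ :: Γ) τ) : ARule (lam L) (letIn (lam L) v0)
  | app {Γ : List Ty} {σ τ : Ty} (L₁ : Tm 𝓕 Γ (Ty.arrow σ τ)) (L₂ : Tm 𝓕 Γ σ) :
      ARule (app L₁ L₂) (letIn L₁ (letIn (wk _ L₂) (letIn (app v1 v0) v0)))
  | fst {Γ : List Ty} {σ τ : Ty} (L : Tm 𝓕 Γ (Ty.prod σ τ)) :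
      ARule (fst L) (letIn L (letIn (fst v0) v0))
  | snd {Γ : List Ty} {σ τ : Ty} (L : Tm 𝓕 Γ (Ty.prod σ τ)) :
      ARule (snd L) (letIn L (letIn (snd v0) v0))
  | pair {Γ : List Ty} {σ τ : Ty} (L₁ : Tm 𝓕 Γ σ) (L₂ : Tm 𝓕 Γ τ) :
      ARule (pair L₁ L₂) (letIn L₁ (letIn (wk σ L₂) (letIn (pair v1 v0) v0)))
  | const {Γ : List Ty} (r : ℝ) : ARule (const r : Tm 𝓕 Γ Ty.real) (letIn (const r) v0)
  | fn {Γ : List Ty} {n m : ℕ} (f : 𝓕.Sym n m) (L : Tm 𝓕 Γ (Ty.pow n)) :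
      ARule (fn f L) (letIn L (letIn (fn f v0) v0))
  | jac {Γ : List Ty} {n m : ℕ} (f : 𝓕.Sym n m) (L : Tm 𝓕 Γ (Ty.pow n)) :
      ARule (jac f L) (letIn L (letIn (jac f v0) v0))
  | dualMap {Γ : List Ty} {σ τ : Ty} (L₁ : Tm 𝓕 (σ :: Γ) τ) (L₂ : Tm 𝓕 Γ (Ty.dual τ)) :
      ARule (dualMap L₁ L₂) (letIn L₂ (letIn (dualMap (wk₁ _ L₁) v0) v0))
  | pb {Γ : List Ty} {σ τ : Ty} (L₁ : Tm 𝓕 (σ :: Γ) τ) (L₂ : Tm 𝓕 Γ (Ty.form τ)) :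
      ARule (pb L₁ L₂) (letIn L₂ (letIn (pb (wk₁ _ L₁) v0) v0))
  | dconst {Γ : List Ty} {n : ℕ} (r : Fin (n + 1) → ℝ) :
      ARule (dconst r : Tm 𝓕 Γ (Ty.dual (Ty.pow n))) (letIn (dconst r) v0)

/-- One-step administrative reduction `P ⟶_A P'`, in arbitrary contexts and up to `≡`. -/
inductive ARed : ∀ {Γ : List Ty} {σ : Ty}, Tm 𝓕 Γ σ → Tm 𝓕 Γ σ → Prop
  | step {Γ : List Ty} {σ : Ty} {p q r : Tm 𝓕 Γ σ} : ARule p q → LetFlat q r → ARed p r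
  | frame {Δ Γ : List Ty} {τ σ : Ty} (K : Frame 𝓕 Δ τ Γ σ) {p q : Tm 𝓕 Δ τ} :
      ARed p q → ARed (K.plug p) (K.plug q)
  | eqv {Γ : List Ty} {σ : Ty} {p p' q' q : Tm 𝓕 Γ σ} : Eqv p p' → ARed p' q' → Eqv q' q → ARed p q

/-! ### Call-by-value and pullback reductions -/

/-- Iterated projections: `Path σ τ` selects a component of type `τ` of a tuple of type `σ`;
the empty path is the projection of a 1-tuple. -/
inductive Path : Ty → Ty → Type
  | nil {σ : Ty} : Path σ σ
  | fst {σ τ₁ τ₂ : Ty} : Path σ (Ty.prod τ₁ τ₂) → Path σ τ₁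
  | snd {σ τ₁ τ₂ : Ty} : Path σ (Ty.prod τ₁ τ₂) → Path σ τ₂

/-- The term `π_i(s)`. -/
def Path.ap : ∀ {σ τ : Ty}, Path σ τ → ∀ {Γ : List Ty}, Tm 𝓕 Γ σ → Tm 𝓕 Γ τ
  | _, _, Path.nil, _, s => s
  | _, _, Path.fst π, _, s => Tm.fst (π.ap s)
  | _, _, Path.snd π, _, s => Tm.snd (π.ap s)

/-- `Comp i V U`: the `i`-th component of the tuple `V` is `U`. -/
inductive Comp {Γ : List Ty} {σ : Ty} : ∀ {τ : Ty}, Path σ τ → Tm 𝓕 Γ σ → Tm 𝓕 Γ τ → Prop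
  | nil (V : Tm 𝓕 Γ σ) : Comp Path.nil V V
  | fst {τ₁ τ₂ : Ty} {π : Path σ (Ty.prod τ₁ τ₂)} {V : Tm 𝓕 Γ σ} {A : Tm 𝓕 Γ τ₁} {B : Tm 𝓕 Γ τ₂} :
      Comp π V (pair A B) → Comp (Path.fst π) V A
  | snd {τ₁ τ₂ : Ty} {π : Path σ (Ty.prod τ₁ τ₂)} {V : Tm 𝓕 Γ σ} {A : Tm 𝓕 Γ τ₁} {B : Tm 𝓕 Γ τ₂} :
      Comp π V (pair A B) → Comp (Path.snd π) V B

/-- The Jacobian `J(f)(x)(w)`. -/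
noncomputable def jacobian {n m : ℕ} (f : 𝓕.Sym n m) (x w : Fin (n + 1) → ℝ) : Fin (m + 1) → ℝ :=
  fderiv ℝ (𝓕.fn f) x w

/-- The transposed Jacobian `J(f)(x)*(w)`. -/
noncomputable def jacobianT {n m : ℕ} (f : 𝓕.Sym n m) (x : Fin (n + 1) → ℝ) (w : Fin (m + 1) → ℝ) :
    Fin (n + 1) → ℝ :=
  fun j => ∑ i, w i * jacobian f x (Pi.single j 1) i

/-- `(Ω(λy.B) · ω') V` for a fresh variable `ω'` (index `0`). -/
def probe {Γ : List Ty} {σ τ : Ty} (B : Tm 𝓕 (σ :: Γ) τ) (V : Tm 𝓕 Γ σ) :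
    Tm 𝓕 (Ty.form τ :: Γ) (Ty.dual σ) :=
  app (pb (wk₁ _ B) v0) (wk _ V)

/-- `(λv.S)* · (ω' Q)` for a fresh variable `ω'` (index `0`), which does not occur in `S`. -/
def answer {Γ : List Ty} {σ τ : Ty} (S : Tm 𝓕 (σ :: Γ) τ) (Q : Tm 𝓕 (Ty.form τ :: Γ) τ) :
    Tm 𝓕 (Ty.form τ :: Γ) (Ty.dual σ) :=
  dualMap (wk₁ _ S) (app v0 Q)

mutual

/-- One-step reduction `P ⟶ P'`.  The metavariables for simple terms, pullback terms, values,
elementary terms and let series range over all terms of the appropriate type, and the hole of a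
context may be anywhere, so that the call-by-value strategy is contained in this relation.  In
each pullback rule, `y` is the variable bound by the pullback, `W` is the 1-form `ω` and `V` is the
point at which the pullback is taken. -/
inductive Red : ∀ {Γ : List Ty} {σ : Ty}, Tm 𝓕 Γ σ → Tm 𝓕 Γ σ → Prop
  | frame {Δ Γ : List Ty} {τ σ : Ty} (K : Frame 𝓕 Δ τ Γ σ) {p q : Tm 𝓕 Δ τ} :
      Red p q → Red (K.plug p) (K.plug q)
  | eqv {Γ : List Ty} {σ : Ty} {p p' q' q : Tm 𝓕 Γ σ} : Eqv p p' → Red p' q' → Eqv q' q → Red p q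
  /-- Administrative reductions are performed in the body of a pullback. -/
  | adm {Γ : List Ty} {σ : Ty} {p q : Tm 𝓕 Γ σ} : ARed p q → Red p q
  /-- Reductions may be instantiated, `P[V/x] ⟶ P'[V/x]` if `P ⟶ P'`. -/
  | inst {Γ : List Ty} {σ τ : Ty} {p q : Tm 𝓕 (τ :: Γ) σ} (V : Tm 𝓕 Γ τ) :
      p.WellTyped → V.WellTyped → Red p q → Red (p.inst V) (q.inst V)
  | r1 {Γ : List Ty} {σ τ : Ty} (S : Tm 𝓕 (σ :: Γ) τ) (V : Tm 𝓕 Γ σ) :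
      Red (app (lam S) V) (S.inst V)
  | r2_fst {Γ : List Ty} {σ τ : Ty} (V₁ : Tm 𝓕 Γ σ) (V₂ : Tm 𝓕 Γ τ) : Red (fst (pair V₁ V₂)) V₁
  | r2_snd {Γ : List Ty} {σ τ : Ty} (V₁ : Tm 𝓕 Γ σ) (V₂ : Tm 𝓕 Γ τ) : Red (snd (pair V₁ V₂)) V₂
  | r3 {Γ : List Ty} {n m : ℕ} (f : 𝓕.Sym n m) (r : Fin (n + 1) → ℝ) :
      Red (fn f (constVec r) : Tm 𝓕 Γ _) (constVec (𝓕.fn f r))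
  | r4 {Γ : List Ty} {n m : ℕ} (f : 𝓕.Sym n m) (r r' : Fin (n + 1) → ℝ) :
      Red (app (jac f (constVec r)) (constVec r') : Tm 𝓕 Γ _) (constVec (jacobian f r' r))
  | r5 {Γ : List Ty} {n m : ℕ} (f : 𝓕.Sym n m) (r : Fin (n + 1) → ℝ) (r' : Fin (m + 1) → ℝ) :
      Red (dualMap (app (jac f v0) (constVec r)) (dconst r') : Tm 𝓕 Γ _) (dconst (jacobianT f r r'))
  | r6 {Γ : List Ty} {σ₁ σ₂ τ : Ty} (V₁ : Tm 𝓕 (σ₁ :: Γ) σ₂) (V₂ : Tm 𝓕 (σ₂ :: Γ) τ)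
      (V₃ : Tm 𝓕 Γ (Ty.dual τ)) :
      Red (dualMap V₁ (dualMap V₂ V₃)) (dualMap ((wk₁ σ₁ V₂).inst V₁) V₃)
  | r7 {Γ : List Ty} {σ τ : Ty} (E : Tm 𝓕 (σ :: Γ) τ) (W : Tm 𝓕 Γ (Ty.form τ)) :
      Red (pb (letIn E v0) W) (pb E W)
  | r8 {Γ : List Ty} {σ α τ : Ty} (E : Tm 𝓕 (σ :: Γ) α) (L : Tm 𝓕 (α :: σ :: Γ) τ)
      (W : Tm 𝓕 Γ (Ty.form τ)) :
      Red (pb (letIn E L) W) (pb (pair v0 E) (pb (unpair L) W))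
  | r9 {Γ : List Ty} {σ τ : Ty} (E : Tm 𝓕 Γ τ) (W : Tm 𝓕 Γ (Ty.form τ)) (V : Tm 𝓕 Γ σ) :
      Red (app (pb (wk σ E) W) V) zero
  | r10a {Γ : List Ty} {σ τ : Ty} (j : Path σ τ) (z : Tm 𝓕 Γ τ) (W : Tm 𝓕 Γ (Ty.form τ))
      (V : Tm 𝓕 Γ σ) :
      Red (app (pb (add (wk σ z) (j.ap v0)) W) V) (dualMap (j.ap v0) (app W (add z (j.ap V))))
  | r10b {Γ : List Ty} {σ τ : Ty} (i j : Path σ τ) (W : Tm 𝓕 Γ (Ty.form τ)) (V : Tm 𝓕 Γ σ) :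
      Red (app (pb (add (i.ap v0) (j.ap v0)) W) V)
        (dualMap (add (i.ap v0) (j.ap v0)) (app W (add (i.ap V) (j.ap V))))
  | r11 {Γ : List Ty} {σ : Ty} (W : Tm 𝓕 Γ (Ty.form σ)) (V : Tm 𝓕 Γ σ) :
      Red (app (pb v0 W) V) (dualMap v0 (app W V))
  | r12 {Γ : List Ty} {σ τ : Ty} (i : Path σ τ) (W : Tm 𝓕 Γ (Ty.form τ)) (V : Tm 𝓕 Γ σ) :
      Red (app (pb (i.ap v0) W) V) (dualMap (i.ap v0) (app W (i.ap V)))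
  | r13a {Γ : List Ty} {σ τ₁ τ₂ : Ty} (i : Path σ τ₁) (z : Tm 𝓕 Γ τ₂)
      (W : Tm 𝓕 Γ (Ty.form (Ty.prod τ₁ τ₂))) (V : Tm 𝓕 Γ σ) :
      Red (app (pb (pair (i.ap v0) (wk σ z)) W) V)
        (dualMap (pair (i.ap v0) zero) (app W (pair (i.ap V) z)))
  | r13b {Γ : List Ty} {σ τ₁ τ₂ : Ty} (j : Path σ τ₂) (z : Tm 𝓕 Γ τ₁)
      (W : Tm 𝓕 Γ (Ty.form (Ty.prod τ₁ τ₂))) (V : Tm 𝓕 Γ σ) :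
      Red (app (pb (pair (wk σ z) (j.ap v0)) W) V)
        (dualMap (pair zero (j.ap v0)) (app W (pair z (j.ap V))))
  | r13c {Γ : List Ty} {σ τ₁ τ₂ : Ty} (i : Path σ τ₁) (j : Path σ τ₂)
      (W : Tm 𝓕 Γ (Ty.form (Ty.prod τ₁ τ₂))) (V : Tm 𝓕 Γ σ) :
      Red (app (pb (pair (i.ap v0) (j.ap v0)) W) V)
        (dualMap (pair (i.ap v0) (j.ap v0)) (app W (pair (i.ap V) (j.ap V))))
  | r14 {Γ : List Ty} {σ : Ty} {n m : ℕ} (f : 𝓕.Sym n m) (i : Path σ (Ty.pow n))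
      (W : Tm 𝓕 Γ (Ty.form (Ty.arrow (Ty.pow n) (Ty.pow m)))) (V : Tm 𝓕 Γ σ) :
      Red (app (pb (jac f (i.ap v0)) W) V) (dualMap (jac f (i.ap v0)) (app W (jac f (i.ap V))))
  | r15 {Γ : List Ty} {σ : Ty} {n m : ℕ} (f : 𝓕.Sym n m) (i : Path σ (Ty.pow n))
      (W : Tm 𝓕 Γ (Ty.form (Ty.pow m))) (V : Tm 𝓕 Γ σ) :
      Red (app (pb (fn f (i.ap v0)) W) V)
        (dualMap (app (jac f (i.ap v0)) (wk σ (i.ap V))) (app W (fn f (i.ap V))))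
  | r16a {Γ : List Ty} {σ α τ : Ty} (L : Tm 𝓕 (α :: Γ) τ) (i : Path σ (Ty.dual τ))
      (W : Tm 𝓕 Γ (Ty.form (Ty.dual α))) (V : Tm 𝓕 Γ σ) :
      Red (app (pb (dualMap (wk₁ σ L) (i.ap v0)) W) V)
        (dualMap (dualMap (wk₁ σ L) (i.ap v0)) (app W (dualMap L (i.ap V))))
  | r16b {Γ : List Ty} {σ α τ : Ty} (L : Tm 𝓕 (α :: σ :: Γ) τ) (z : Tm 𝓕 Γ (Ty.dual τ))
      (W : Tm 𝓕 Γ (Ty.form (Ty.dual α))) (V : Tm 𝓕 Γ σ)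
      (S : Tm 𝓕 (σ :: α :: Γ) τ) (V' : Tm 𝓕 (Ty.form τ :: α :: Γ) τ) :
      RedStar (probe (swap L) (wk α V)) (answer S V') →
      Red (app (pb (dualMap L (wk σ z)) W) V)
        (dualMap (dualMap (swap S) (wk σ z)) (app W (dualMap (inst₁ L V) z)))
  | r16c {Γ : List Ty} {σ α τ : Ty} (L : Tm 𝓕 (α :: σ :: Γ) τ) (i : Path σ (Ty.dual τ))
      (W : Tm 𝓕 Γ (Ty.form (Ty.dual α))) (V : Tm 𝓕 Γ σ)
      (S : Tm 𝓕 (σ :: α :: Γ) τ) (V' : Tm 𝓕 (Ty.form τ :: α :: Γ) τ) :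
      RedStar (probe (swap L) (wk α V)) (answer S V') →
      Red (app (pb (dualMap L (i.ap v0)) W) V)
        (dualMap
          (add (dualMap (wk₁ σ (inst₁ L V)) (i.ap v0)) (dualMap (swap S) (wk σ (i.ap V))))
          (app W (dualMap (inst₁ L V) (i.ap V))))
  /-- Here `a` is the most recent variable of `L`, of `wk σx z` and of the right-hand side. -/
  | r17 {Γ : List Ty} {σ σx τ : Ty} (L : Tm 𝓕 (σx :: σ :: Γ) τ) (z : Tm 𝓕 (σ :: Γ) (Ty.form τ))
      (W : Tm 𝓕 Γ (Ty.form (Ty.form σx))) (V : Tm 𝓕 Γ σ) (S : Tm 𝓕 (σx :: σx :: σ :: Γ) τ) :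
      RedStar (app (pb (wk₁ σx L) (wk σx z)) v0) (dualMap S (app (wk σx z) L)) →
      Red (app (pb (pb L z) W) V) (app (pb (lam (dualMap S (app (wk σx z) L))) W) V)
  | r18 {Γ : List Ty} {σ α τ : Ty} (L : Tm 𝓕 (α :: σ :: Γ) τ)
      (W : Tm 𝓕 Γ (Ty.form (Ty.arrow α τ))) (V : Tm 𝓕 Γ σ) (S : Tm 𝓕 (σ :: α :: Γ) τ) :
      RedStar (probe (swap L) (wk α V)) (answer S (wk _ (inst₁ L V))) →
      Red (app (pb (lam L) W) V) (dualMap (lam (swap S)) (app W (lam (inst₁ L V))))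
  | r19a {Γ : List Ty} {σ α τ : Ty} (i : Path σ (Ty.arrow α τ)) (z : Tm 𝓕 Γ α)
      (W : Tm 𝓕 Γ (Ty.form τ)) (V : Tm 𝓕 Γ σ) :
      Red (app (pb (app (i.ap v0) (wk σ z)) W) V)
        (dualMap (app (i.ap v0) (wk σ z)) (app W (app (i.ap V) z)))
  | r19b {Γ : List Ty} {σ α τ : Ty} (i : Path σ (Ty.arrow α τ)) (j : Path σ α)
      (W : Tm 𝓕 Γ (Ty.form τ)) (V : Tm 𝓕 Γ σ) (P' S' : Tm 𝓕 (α :: Γ) τ) :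
      Comp i V (lam P') →
      RedStar (probe P' (j.ap V)) (answer S' (wk _ (P'.inst (j.ap V)))) →
      Red (app (pb (app (i.ap v0) (j.ap v0)) W) V)
        (dualMap (add (app (i.ap v0) (wk σ (j.ap V))) ((wk₁ σ S').inst (j.ap v0)))
          (app W (app (i.ap V) (j.ap V))))
  | r19c {Γ : List Ty} {σ α τ : Ty} (i : Path σ (Ty.arrow α τ)) (j : Path σ α)
      (W : Tm 𝓕 Γ (Ty.form τ)) (V : Tm 𝓕 Γ σ) (V' : Tm 𝓕 (α :: Γ) τ) :
      Comp i V (lam V') →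
      RedStar (probe V' (j.ap V)) zero →
      Red (app (pb (app (i.ap v0) (j.ap v0)) W) V)
        (dualMap (app (i.ap v0) (wk σ (j.ap V))) (app W (app (i.ap V) (j.ap V))))
  | r20a {Γ : List Ty} {σ τ : Ty} (E : Tm 𝓕 (σ :: Γ) τ) (W : Tm 𝓕 Γ (Ty.form (Ty.prod σ τ)))
      (V : Tm 𝓕 Γ σ) (S : Tm 𝓕 (σ :: Γ) τ) :
      RedStar (probe E V) (answer S (wk _ (E.inst V))) → Free 0 E →
      Red (app (pb (pair v0 E) W) V) (dualMap (pair v0 S) (app W (pair V (E.inst V))))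
  | r20b {Γ : List Ty} {σ τ : Ty} (E : Tm 𝓕 Γ τ) (W : Tm 𝓕 Γ (Ty.form (Ty.prod σ τ)))
      (V : Tm 𝓕 Γ σ) :
      Red (app (pb (pair v0 (wk σ E)) W) V) (dualMap (pair v0 zero) (app W (pair V E)))

/-- Many-step reduction `P ⟶* P'`, up to `≡`. -/
inductive RedStar : ∀ {Γ : List Ty} {σ : Ty}, Tm 𝓕 Γ σ → Tm 𝓕 Γ σ → Prop
  | eqv {Γ : List Ty} {σ : Ty} {p q : Tm 𝓕 Γ σ} : Eqv p q → RedStar p q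
  | tail {Γ : List Ty} {σ : Ty} {p q r : Tm 𝓕 Γ σ} : RedStar p q → Red q r → RedStar p r

end

end Tm

/-! ## Models and interpretation -/

section Model

variable {C : Type u} [Category.{v} C] [CartesianMonoidalCategory C] [MonoidalClosed C]

/-- The interpretation of types, where `R` interprets `real` and `L A` the dual of `A`. -/
def Ty.obj (R : C) (L : C → C) : Ty → C
  | Ty.real => R
  | Ty.prod σ τ => Ty.obj R L σ ⊗ Ty.obj R L τ
  | Ty.arrow σ τ => (ihom (Ty.obj R L σ)).obj (Ty.obj R L τ)
  | Ty.dual σ => L (Ty.obj R L σ)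

/-- The element of `R^(n+1)` given by a real vector. -/
def tuplePt (R : C) (L : C → C) (pt : ℝ → (𝟙_ C ⟶ R)) :
    ∀ {n : ℕ}, (Fin (n + 1) → ℝ) → (𝟙_ C ⟶ Ty.obj R L (Ty.pow n))
  | 0, x => pt (x 0)
  | n + 1, x => lift (tuplePt R L pt (n := n) (Fin.init x)) (pt (x (Fin.last (n + 1))))

variable [DifferentialLambdaCategory C]

/-- What is needed in order to interpret the language in a differential lambda-category `C`: the
reals `ℝ` are an object of `C`, and so are the spaces `L(A, ℝ)` of linear morphisms.

* The elements of `R` are the real numbers, with their addition; a morphism from a power of `R` to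
  `R` is determined by its values on real vectors; multiplication by a real number is a linear
  morphism; each `f` in `𝓕` is a morphism, and its derivative is its Jacobian.
* `dual A` is the subspace of `A ⇒ R` of the linear morphisms: it carries an evaluation that is
  linear in the argument, every family of linear morphisms `A ⟶ R` factors uniquely through it, and
  its inclusion into `A ⇒ R` is linear. -/
structure LangModel (𝓕 : FunSig) (C : Type u) [Category.{v} C] [CartesianMonoidalCategory C]
    [MonoidalClosed C] [DifferentialLambdaCategory C] where
  R : C
  dual : C → C
  dualEv : ∀ A : C, dual A ⊗ A ⟶ R
  dualEv_linear : ∀ A : C, IsLinear₂ (dualEv A)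
  dual_incl_linear : ∀ A : C, IsLinear (lam (dualEv A))
  dual_existsUnique : ∀ {X A : C} (h : X ⊗ A ⟶ R), IsLinear₂ h →
    ∃! g : X ⟶ dual A, (g ⊗ₘ 𝟙 A) ≫ dualEv A = h
  pt : ℝ ≃+ (𝟙_ C ⟶ R)
  ext : ∀ {n : ℕ} (g h : Ty.obj R dual (Ty.pow n) ⟶ R),
    (∀ x : Fin (n + 1) → ℝ, tuplePt R dual pt x ≫ g = tuplePt R dual pt x ≫ h) → g = h
  smul : ℝ → (R ⟶ R)
  smul_linear : ∀ r : ℝ, IsLinear (smul r)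
  pt_smul : ∀ r a : ℝ, pt a ≫ smul r = pt (r * a)
  fn : ∀ {n m : ℕ}, 𝓕.Sym n m → (Ty.obj R dual (Ty.pow n) ⟶ Ty.obj R dual (Ty.pow m))
  pt_fn : ∀ {n m : ℕ} (f : 𝓕.Sym n m) (x : Fin (n + 1) → ℝ),
    tuplePt R dual pt x ≫ fn f = tuplePt R dual pt (𝓕.fn f x)
  pt_D_fn : ∀ {n m : ℕ} (f : 𝓕.Sym n m) (w x : Fin (n + 1) → ℝ),
    lift (tuplePt R dual pt w) (tuplePt R dual pt x) ≫ D (fn f) =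
      tuplePt R dual pt (fderiv ℝ (𝓕.fn f) x w)

namespace LangModel

variable {𝓕 : FunSig} (M : LangModel 𝓕 C)

/-- The Hahn-Banach separation property: distinct (generalised) elements `x`, `y` of an object are
separated by a linear morphism to `ℝ`. -/
def HahnBanach : Prop :=
  ∀ {X A : C} (x y : X ⟶ A), x ≠ y → ∃ l : A ⟶ M.R, IsLinear l ∧ x ≫ l ≠ y ≫ l

/-- If morphisms are determined by their values on elements, then it is enough to separate
elements in the narrow sense. -/
theorem hahnBanach_of_points
    (hpt : ∀ {X A : C} (x y : X ⟶ A), (∀ e : 𝟙_ C ⟶ X, e ≫ x = e ≫ y) → x = y)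
    (hsep : ∀ {A : C} (x y : 𝟙_ C ⟶ A), x ≠ y → ∃ l : A ⟶ M.R, IsLinear l ∧ x ≫ l ≠ y ≫ l) :
    M.HahnBanach := by
  intro X A x y hxy
  by_contra hcon
  refine hxy (hpt x y fun e => ?_)
  by_contra he
  obtain ⟨l, hl, hne⟩ := hsep _ _ he
  exact hcon ⟨l, hl, fun h => hne (by rw [Category.assoc, Category.assoc, h])⟩

/-- The object `⟦σ⟧`. -/
abbrev ty (σ : Ty) : C := Ty.obj M.R M.dual σ

/-- The object `⟦Γ⟧`. -/
def ctx : List Ty → C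
  | [] => 𝟙_ C
  | σ :: Γ => ctx Γ ⊗ M.ty σ

/-- Variables are interpreted as projections. -/
def proj : ∀ {Γ : List Ty} {σ : Ty}, Var Γ σ → (M.ctx Γ ⟶ M.ty σ)
  | σ :: Γ, _, Var.vz => snd (M.ctx Γ) (M.ty σ)
  | τ :: Γ, _, Var.vs x => fst (M.ctx Γ) (M.ty τ) ≫ proj x

/-- The constant element `r` of `ℝ`, in any context. -/
def constHom (X : C) (r : ℝ) : X ⟶ M.R := toUnit X ≫ M.pt r

/-- The linear functional `w ↦ ∑ i, r i * w i` on `R^(n+1)`. -/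
def dot : ∀ {n : ℕ}, (Fin (n + 1) → ℝ) → (M.ty (Ty.pow n) ⟶ M.R)
  | 0, r => M.smul (r 0)
  | n + 1, r =>
    fst (M.ty (Ty.pow n)) M.R ≫ dot (n := n) (Fin.init r) +
      snd (M.ty (Ty.pow n)) M.R ≫ M.smul (r (Fin.last (n + 1)))

/-- Application `⟨a, b⟩ ↦ a b`. -/
noncomputable def apply {X A B : C} (a : X ⟶ (ihom A).obj B) (b : X ⟶ A) : X ⟶ B :=
  lift a b ≫ ev A B

/-- Application of a linear functional. -/
def dualApply {X A : C} (a : X ⟶ M.dual A) (b : X ⟶ A) : X ⟶ M.R := lift a b ≫ M.dualEv A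

/-- `M.Den P f`: the denotation `⟦P⟧ : ⟦Γ⟧ ⟶ ⟦σ⟧` is defined and equal to `f`.  It is defined by
recursion on `P`; the only partiality is that `⟦(λx.S₁)* · S₂⟧` is defined only if
`⟦S₁⟧⟨γ, -⟩` is linear. -/
def Den : ∀ {Γ : List Ty} {σ : Ty}, Tm 𝓕 Γ σ → (M.ctx Γ ⟶ M.ty σ) → Prop
  | _, _, .var x, f => f = M.proj x
  | _, _, .zero, f => f = 0
  | _, _, .add s p, f => ∃ a b, Den s a ∧ Den p b ∧ f = a + b
  | _, _, .lam s, f => ∃ a, Den s a ∧ f = lam a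
  | _, _, .app s p, f => ∃ a b, Den s a ∧ Den p b ∧ f = apply a b
  | _, _, .fst s, f => ∃ a, Den s a ∧ f = a ≫ fst _ _
  | _, _, .snd s, f => ∃ a, Den s a ∧ f = a ≫ snd _ _
  | _, _, .pair s t, f => ∃ a b, Den s a ∧ Den t b ∧ f = lift a b
  | _, _, .const r, f => f = M.constHom _ r
  | _, _, .fn h p, f => ∃ a, Den p a ∧ f = a ≫ M.fn h
  | _, _, .jac h s, f => ∃ a, Den s a ∧ f = a ≫ lam (D (M.fn h))
  | Γ, _, .dualMap (σ := σ) s t, f => ∃ a b, Den s a ∧ Den t b ∧ IsLinear₂ a ∧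
      -- for all elements `γ` and `w`: `f γ w = b γ (a ⟨γ, w⟩)`
      M.dualApply (fst (M.ctx Γ) (M.ty σ) ≫ f) (snd _ _) = M.dualApply (fst _ _ ≫ b) a
  | Γ, _, .pb (σ := σ) p s, f => ∃ a b, Den p a ∧ Den s b ∧
      -- for all elements `γ`, `x`, `w`: `f γ x w = b γ (a ⟨γ, x⟩) (D[a ⟨γ, -⟩] ⟨w, x⟩)`
      M.dualApply (apply (fst (M.ctx Γ ⊗ M.ty σ) (M.ty σ) ≫ fst _ _ ≫ f) (fst _ _ ≫ snd _ _))
          (snd _ _) =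
        M.dualApply (apply (fst (M.ctx Γ ⊗ M.ty σ) (M.ty σ) ≫ fst _ _ ≫ b) (fst _ _ ≫ a)) (D₂ a)
  | Γ, _, .dconst r, f =>
      M.dualApply (fst (M.ctx Γ) _ ≫ f) (snd _ _) = snd _ _ ≫ M.dot r

end LangModel

end Model

-- The equations that specify a dual map and a pullback each have exactly one solution, because
-- `L(A, ℝ)` classifies families of linear morphisms. Hence the partial relation `Den` splits into a
-- total function `den` and a domain of definition `Defd` (`den_iff`), and correctness becomes the
-- statement `Sound`. It is directed, since a β-step may discard an undefined subterm. It passes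
-- through every frame, because `den` is compositional and the linearity condition on a dual map
-- depends only on the denotation of its body.
--
-- Substitution is precomposition with an environment morphism (`den_subst`). A syntactically linear
-- variable is semantically linear (`dd_den_of_lin`); therefore well-typed terms are defined, and
-- sums may be distributed over linear positions.
--
-- For pullbacks the key formula is `apply_pbHom`: `(Ω(λy.B)·ω)V` is the dual map of `ω(B[V/y])`
-- along the partial derivative of `B` at `V`. A rule with result `(λv.S)*·(ω V')` is thus sound as
-- soon as `S` denotes this partial derivative and `V'` denotes `B[V/y]` (`sound_pb`). For each
-- shape of `B` what remains is a differentiation, by the chain rule, D-curry, linearity of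
-- evaluation in the function, and the Leibniz rule for dual maps.
--
-- In most conditional rules the derivative of a subterm is known only through a premise that
-- mentions a fresh 1-form `ω'`. Inductively, both sides of the premise agree for every `ω'`. The
-- constant form with value a linear functional `l` turns this into `l ∘ ⟦S⟧ = l ∘ (derivative)`,
-- and Hahn-Banach separation yields that `⟦S⟧` is the derivative (`HahnBanach.eq_of_pbHom`).
-- Separation is needed nowhere else. The proof is then a mutual induction over one-step and
-- many-step reduction.

/- Contexts and types are unfolded during rewriting, so that `⟦σ :: Γ⟧` matches `⟦Γ⟧ ⊗ ⟦σ⟧`. -/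
attribute [reducible] LangModel.ctx Ty.obj Ty.pow Tm.Ren Tm.Sub

/-! ## Calculus in differential lambda-categories -/

namespace CartesianDifferentialCategory

variable {C : Type u} [Category.{v} C] [CartesianMonoidalCategory C]

-- Directional derivatives at generalised elements; linear morphisms.

section Cartesian

variable [CartesianDifferentialCategory C]

/-- The derivative of `f` in the direction `w` at the point `x`, for generalised elements. -/
def dd {X A B : C} (f : A ⟶ B) (w x : X ⟶ A) : X ⟶ B := lift w x ≫ D f

theorem lift_add_lift {X A B : C} (a c : X ⟶ A) (b d : X ⟶ B) :
    lift a b + lift c d = lift (a + c) (b + d) := by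
  ext
  · simp [fst_additive.1]
  · simp [snd_additive.1]

theorem lift_zero_zero {X A B : C} : lift (0 : X ⟶ A) (0 : X ⟶ B) = 0 := by
  ext
  · simp [fst_additive.2]
  · simp [snd_additive.2]

theorem lift_eq_add {X A B : C} (a : X ⟶ A) (b : X ⟶ B) : lift a b = lift a 0 + lift 0 b := by
  simp [lift_add_lift]

theorem comp_dd {X Y A B : C} (z : Y ⟶ X) (f : A ⟶ B) (w x : X ⟶ A) :
    z ≫ dd f w x = dd f (z ≫ w) (z ≫ x) := by
  simp [dd, comp_lift_assoc]

theorem dd_comp {X A B E : C} (f : A ⟶ B) (g : B ⟶ E) (w x : X ⟶ A) :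
    dd (f ≫ g) w x = dd g (dd f w x) (x ≫ f) := by
  simp [dd, cd5, comp_lift_assoc]

theorem dd_id {X A : C} (w x : X ⟶ A) : dd (𝟙 A) w x = w := by
  simp [dd, cd3_id]

theorem dd_fst {X A B : C} (w x : X ⟶ A ⊗ B) : dd (fst A B) w x = w ≫ fst A B := by
  simp [dd, cd3_fst]

theorem dd_snd {X A B : C} (w x : X ⟶ A ⊗ B) : dd (snd A B) w x = w ≫ snd A B := by
  simp [dd, cd3_snd]

theorem dd_lift {X A B₁ B₂ : C} (f : A ⟶ B₁) (g : A ⟶ B₂) (w x : X ⟶ A) :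
    dd (lift f g) w x = lift (dd f w x) (dd g w x) := by
  simp [dd, cd4]

theorem dd_add {X A B : C} (f g : A ⟶ B) (w x : X ⟶ A) :
    dd (f + g) w x = dd f w x + dd g w x := by
  simp [dd, cd1_add, comp_add]

theorem dd_zero {X A B : C} (w x : X ⟶ A) : dd (0 : A ⟶ B) w x = 0 := by
  simp [dd, cd1_zero, comp_zero]

theorem dd_dir_zero {X A B : C} (f : A ⟶ B) (x : X ⟶ A) : dd f 0 x = 0 := cd2_zero f x

theorem dd_dir_lift_zero {X A A' B : C} (f : A ⊗ A' ⟶ B) (x : X ⟶ A ⊗ A') :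
    dd f (lift 0 0) x = 0 := by
  rw [lift_zero_zero, dd_dir_zero]

theorem dd_dir_add {X A B : C} (f : A ⟶ B) (w w' x : X ⟶ A) :
    dd f (w + w') x = dd f w x + dd f w' x := cd2_add f w w' x

theorem dd_dir_lift {X A A' B : C} (f : A ⊗ A' ⟶ B) (w : X ⟶ A) (w' : X ⟶ A') (x : X ⟶ A ⊗ A') :
    dd f (lift w w') x = dd f (lift w 0) x + dd f (lift 0 w') x := by
  rw [lift_eq_add, dd_dir_add]

theorem D_eq_dd {A B : C} (f : A ⟶ B) : D f = dd f (fst A A) (snd A A) := by simp [dd]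

theorem lift_comp_D {X A B : C} (f : A ⟶ B) (w x : X ⟶ A) : lift w x ≫ D f = dd f w x := rfl

/-- The derivative of `dd f a b`, by CD6 and CD7. -/
theorem dd_dd {X Y A B : C} (f : A ⟶ B) (a b : Y ⟶ A) (w x : X ⟶ Y) :
    dd (dd f a b) w x = dd f (dd a w x) (x ≫ b) +
      dd (D f) (lift 0 (dd b w x)) (lift (x ≫ a) (x ≫ b)) := by
  rw [dd, dd, cd5, cd4]
  simp only [← Category.assoc, comp_lift, lift_snd]
  -- The direction for `D f` splits into a move of its direction slot and a move of its base point;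
  -- by CD6 the former contributes only a first derivative.
  rw [← dd, ← dd, lift_comp_D, dd_dir_lift]
  congr 1
  exact cd6 _ _ _ _

/-- Symmetry of second derivatives. It is what `IsLinear₂.dd_left` rests on. -/
theorem dd_D_swap {X A B : C} (f : A ⟶ B) (w w' x : X ⟶ A) :
    dd (D f) (lift 0 w) (lift w' x) = dd (D f) (lift 0 w') (lift w x) := cd7 f w' w x

theorem IsLinear.dd {A B : C} {f : A ⟶ B} (hf : IsLinear f) {X : C} (w x : X ⟶ A) :
    dd f w x = w ≫ f := by
  rw [CartesianDifferentialCategory.dd, hf, lift_fst_assoc]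

theorem isLinear_iff {A B : C} {f : A ⟶ B} :
    IsLinear f ↔ ∀ (X : C) (w x : X ⟶ A), dd f w x = w ≫ f :=
  ⟨fun h _ w x => h.dd w x, fun h => by rw [IsLinear, D_eq_dd, h]⟩

/-- Linearity gives additivity because a derivative is additive in its direction (CD2). The base
point plays no role, so `0` serves. -/
theorem IsLinear.add_comp {A B : C} {f : A ⟶ B} (hf : IsLinear f) {X : C} (a b : X ⟶ A) :
    (a + b) ≫ f = a ≫ f + b ≫ f := by
  rw [← hf.dd _ 0, dd_dir_add, hf.dd, hf.dd]

theorem IsLinear.zero_comp {A B : C} {f : A ⟶ B} (hf : IsLinear f) {X : C} :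
    (0 : X ⟶ A) ≫ f = 0 := by
  rw [← hf.dd _ 0, dd_dir_zero]

/-- Yoneda: the defining equation is the case of the universal triple of projections. In the
elementwise form linearity can be checked by rewriting with the rules for `dd`. -/
theorem isLinear₂_iff {X A B : C} {f : X ⊗ A ⟶ B} :
    IsLinear₂ f ↔ ∀ (Z : C) (x : Z ⟶ X) (a w : Z ⟶ A),
      dd f (lift 0 w) (lift x a) = lift x w ≫ f := by
  constructor
  · intro h Z x a w
    have := congrArg (fun g => lift (lift x a) w ≫ g) h
    simpa [D₂, comp_lift_assoc, lift_comp_D, comp_dd, comp_zero] using this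
  · intro h
    -- The base point does not occur in the right-hand side and has to be supplied; it is the one
    -- that appears in `D₂`.
    rw [IsLinear₂, D₂, lift_comp_D, ← h _ _ (fst _ _ ≫ snd _ _)]
    simp

theorem IsLinear₂.dd {X A B : C} {f : X ⊗ A ⟶ B} (hf : IsLinear₂ f) {Z : C} (x : Z ⟶ X)
    (a w : Z ⟶ A) : dd f (lift 0 w) (lift x a) = lift x w ≫ f := isLinear₂_iff.1 hf Z x a w

theorem IsLinear₂.lift_add {X A B : C} {f : X ⊗ A ⟶ B} (hf : IsLinear₂ f) {Z : C} (x : Z ⟶ X)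
    (a b : Z ⟶ A) : lift x (a + b) ≫ f = lift x a ≫ f + lift x b ≫ f := by
  rw [← hf.dd x 0, ← hf.dd x 0, ← hf.dd x 0, ← dd_dir_add, lift_add_lift, add_zero]

theorem IsLinear₂.lift_zero {X A B : C} {f : X ⊗ A ⟶ B} (hf : IsLinear₂ f) {Z : C} (x : Z ⟶ X) :
    lift x 0 ≫ f = 0 := by
  rw [← hf.dd x 0, dd_dir_lift_zero]

theorem IsLinear₂.zero {X A B : C} : IsLinear₂ (0 : X ⊗ A ⟶ B) := by
  rw [isLinear₂_iff]; intros; rw [dd_zero, comp_zero]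

theorem IsLinear₂.add {X A B : C} {f g : X ⊗ A ⟶ B} (hf : IsLinear₂ f) (hg : IsLinear₂ g) :
    IsLinear₂ (f + g) := by
  rw [isLinear₂_iff]; intros; rw [dd_add, comp_add, hf.dd, hg.dd]

/-- A partial derivative is linear in the direction. -/
theorem isLinear₂_dd {X Y A B : C} (f : X ⊗ A ⟶ B) (x : Y ⟶ X) (a : Y ⟶ A) :
    IsLinear₂ (CartesianDifferentialCategory.dd f (lift 0 (snd Y A))
      (lift (fst Y A ≫ x) (fst Y A ≫ a))) := by
  rw [isLinear₂_iff]
  intro Z y b w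
  simp only [dd_dd, dd_lift, dd_zero, dd_snd, dd_comp, dd_fst, comp_dd, comp_lift, comp_zero,
    lift_fst, lift_snd, lift_fst_assoc, dd_dir_zero, lift_zero_zero, add_zero]

end Cartesian

-- Currying and evaluation: β, η and derivatives.

section Closed

open LangModel

variable [MonoidalClosed C]

/-- The β-law. The underlying transpose keeps the abstracted variable on the left, hence the swapped
pairs. -/
theorem lift_comp_lam_ev {Z X A B : C} (g : X ⊗ A ⟶ B) (z : Z ⟶ X) (x : Z ⟶ A) :
    lift (z ≫ lam g) x ≫ ev A B = lift z x ≫ g := by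
  have h : lift x (z ≫ lam g) = lift x z ≫ (A ◁ lam g) := by simp
  simp only [ev, comp_lift_assoc, lift_snd, lift_fst]
  rw [h, Category.assoc, lam, MonoidalClosed.whiskerLeft_curry_ihom_ev_app,
    comp_lift_assoc, lift_snd, lift_fst]

/-- The η-law, the source of extensionality for arrows. -/
theorem lam_lift_comp_ev {X A B : C} (a : X ⟶ (ihom A).obj B) :
    lam (lift (fst X A ≫ a) (snd X A) ≫ ev A B) = a := by
  have h : lift (fst A X) (snd A X ≫ a) = A ◁ a := by ext <;> simp
  rw [lam, ev]
  simp only [comp_lift_assoc, lift_snd, lift_fst, lift_fst_assoc]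
  rw [h, ← MonoidalClosed.uncurry_eq, MonoidalClosed.curry_uncurry]

theorem comp_applyHom {X Y A B : C} (z : Y ⟶ X) (a : X ⟶ (ihom A).obj B) (b : X ⟶ A) :
    z ≫ apply a b = apply (z ≫ a) (z ≫ b) := by
  simp [apply, comp_lift_assoc]

theorem apply_comp_lam {Z X A B : C} (g : X ⊗ A ⟶ B) (z : Z ⟶ X) (x : Z ⟶ A) :
    apply (z ≫ lam g) x = lift z x ≫ g := lift_comp_lam_ev g z x

theorem apply_lam {X A B : C} (g : X ⊗ A ⟶ B) (x : X ⟶ A) : apply (lam g) x = lift (𝟙 X) x ≫ g := by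
  rw [← apply_comp_lam, Category.id_comp]

theorem lam_apply {X A B : C} (a : X ⟶ (ihom A).obj B) :
    lam (apply (fst X A ≫ a) (snd X A)) = a := lam_lift_comp_ev a

theorem arrow_ext {X A B : C} {a b : X ⟶ (ihom A).obj B}
    (h : apply (fst X A ≫ a) (snd X A) = apply (fst X A ≫ b) (snd X A)) : a = b := by
  rw [← lam_apply a, h, lam_apply]

theorem comp_lam {X Y A B : C} (z : Y ⟶ X) (g : X ⊗ A ⟶ B) :
    z ≫ lam g = lam (lift (fst Y A ≫ z) (snd Y A) ≫ g) := by
  apply arrow_ext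
  rw [← Category.assoc, apply_comp_lam, apply_comp_lam]
  simp

variable [DifferentialLambdaCategory C]

/-- By η both functions are abstractions, and abstraction is additive. -/
theorem apply_add {X A B : C} (a b : X ⟶ (ihom A).obj B) (x : X ⟶ A) :
    apply (a + b) x = apply a x + apply b x := by
  rw [← lam_apply a, ← lam_apply b, ← DifferentialLambdaCategory.lam_add]
  simp only [apply_lam, comp_add]

theorem apply_zero {X A B : C} (x : X ⟶ A) : apply (0 : X ⟶ (ihom A).obj B) x = 0 := by
  rw [← DifferentialLambdaCategory.lam_zero, apply_lam, comp_zero]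

/-- D-curry. -/
theorem dd_lam {X Y A B : C} (g : Y ⊗ A ⟶ B) (w x : X ⟶ Y) :
    dd (lam g) w x =
      lam (dd g (lift (fst X A ≫ w) 0) (lift (fst X A ≫ x) (snd X A))) := by
  rw [dd, DifferentialLambdaCategory.d_curry, comp_lam]
  congr 1
  rw [dd, ← Category.assoc]
  congr 1
  ext <;> simp [comp_zero]

/-- Evaluation is linear in the function but not in the argument, so the second summand remains a
derivative of `ev`. -/
theorem dd_apply {X Y A B : C} (a : Y ⟶ (ihom A).obj B) (b : Y ⟶ A) (w x : X ⟶ Y) :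
    dd (apply a b) w x = apply (dd a w x) (x ≫ b) +
      dd (ev A B) (lift 0 (dd b w x)) (lift (x ≫ a) (x ≫ b)) := by
  rw [apply, dd_comp, dd_lift, dd_dir_lift, comp_lift]
  congr 1
  -- By η it suffices to treat `a = lam g`. Differentiating the β-law in the direction `(w, 0)` and
  -- comparing with D-curry gives linearity in the function slot.
  have h : ∀ g : (Y ⊗ A) ⟶ B, a = lam g →
      dd (ev A B) (lift (dd a w x) 0) (lift (x ≫ a) (x ≫ b)) = apply (dd a w x) (x ≫ b) := by
    rintro g rfl
    have h1 := congrArg (fun k => dd k (lift w 0) (lift x (x ≫ b)))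
      (lift_comp_lam_ev g (fst Y A) (snd Y A))
    simp only [dd_comp, dd_lift, dd_fst, dd_snd, lift_fst, lift_snd, comp_lift, lift_fst_snd, dd_id,
      lift_fst_assoc] at h1
    rw [h1, dd_lam, apply_lam, comp_dd]
    simp [comp_zero]
  exact h _ (lam_apply a).symm

/-- The β-law differentiated in the direction `(0, w)`: the derivative of evaluation in its argument
is that of the body of the function. -/
theorem dd_ev_lam {X Y A B : C} (g : Y ⊗ A ⟶ B) (z : X ⟶ Y) (w x : X ⟶ A) :
    dd (ev A B) (lift 0 w) (lift (z ≫ lam g) x) = dd g (lift 0 w) (lift z x) := by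
  have h1 := congrArg (fun k => dd k (lift 0 w) (lift z x))
    (lift_comp_lam_ev g (fst Y A) (snd Y A))
  simpa only [dd_comp, dd_lift, dd_fst, dd_snd, lift_fst, lift_snd, comp_lift, lift_fst_snd, dd_id,
      lift_fst_assoc, dd_dir_zero, Category.comp_id] using h1

end Closed

end CartesianDifferentialCategory

-- Linear functionals, dual maps and pullbacks in a model.

namespace LangModel

variable {C : Type u} [Category.{v} C] [CartesianMonoidalCategory C] [MonoidalClosed C]
  [DifferentialLambdaCategory C] {𝓕 : FunSig} (M : LangModel 𝓕 C)

theorem comp_dualApply {X Y A : C} (z : Y ⟶ X) (a : X ⟶ M.dual A) (b : X ⟶ A) :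
    z ≫ M.dualApply a b = M.dualApply (z ≫ a) (z ≫ b) := by
  simp [dualApply, comp_lift_assoc]

/-- Pairing is evaluation after the inclusion of `L(A, ℝ)` into `A ⇒ ℝ`. As the inclusion is linear,
additivity and derivative rules carry over from functions to functionals. -/
theorem dualApply_eq_apply {X A : C} (a : X ⟶ M.dual A) (b : X ⟶ A) :
    M.dualApply a b = apply (a ≫ lam (M.dualEv A)) b := (apply_comp_lam _ _ _).symm

theorem isLinear₂_dualApply {X A : C} (a : X ⟶ M.dual A) :
    IsLinear₂ (M.dualApply (fst X A ≫ a) (snd X A)) := by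
  rw [isLinear₂_iff]
  intro Z x b w
  simp only [dualApply, dd_comp, dd_lift, dd_fst, dd_snd, lift_fst, lift_snd, comp_lift,
    lift_fst_assoc, dd_dir_zero, comp_lift_assoc]
  exact (M.dualEv_linear A).dd _ _ _

theorem existsUnique_dualApply {X A : C} {h : X ⊗ A ⟶ M.R} (hh : IsLinear₂ h) :
    ∃! g : X ⟶ M.dual A, M.dualApply (fst X A ≫ g) (snd X A) = h := by
  have e : ∀ g : X ⟶ M.dual A,
      (g ⊗ₘ 𝟙 A) ≫ M.dualEv A = M.dualApply (fst X A ≫ g) (snd X A) := by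
    intro g
    have : (g ⊗ₘ 𝟙 A) = lift (fst X A ≫ g) (snd X A) := by ext <;> simp
    rw [this]; rfl
  simpa only [e] using M.dual_existsUnique h hh

theorem dual_ext {X A : C} {a b : X ⟶ M.dual A}
    (h : M.dualApply (fst X A ≫ a) (snd X A) = M.dualApply (fst X A ≫ b) (snd X A)) : a = b :=
  (M.existsUnique_dualApply (M.isLinear₂_dualApply b)).unique h rfl

theorem dualApply_add_left {X A : C} (a b : X ⟶ M.dual A) (x : X ⟶ A) :
    M.dualApply (a + b) x = M.dualApply a x + M.dualApply b x := by
  simp only [dualApply_eq_apply, (M.dual_incl_linear A).add_comp, apply_add]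

theorem dualApply_zero_left {X A : C} (x : X ⟶ A) : M.dualApply 0 x = 0 := by
  simp only [dualApply_eq_apply, (M.dual_incl_linear A).zero_comp, apply_zero]

theorem dualApply_add {X A : C} (a : X ⟶ M.dual A) (x y : X ⟶ A) :
    M.dualApply a (x + y) = M.dualApply a x + M.dualApply a y :=
  (M.dualEv_linear A).lift_add a x y

theorem dualApply_zero {X A : C} (a : X ⟶ M.dual A) : M.dualApply a 0 = 0 :=
  (M.dualEv_linear A).lift_zero a

/-- Leibniz rule: the pairing is linear in the functional through the linear inclusion, and in the
vector by `dualEv_linear`. -/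
theorem dd_dualApply {X Y A : C} (a : Y ⟶ M.dual A) (b : Y ⟶ A) (w x : X ⟶ Y) :
    dd (M.dualApply a b) w x =
      M.dualApply (dd a w x) (x ≫ b) + M.dualApply (x ≫ a) (dd b w x) := by
  rw [dualApply_eq_apply, dd_apply, dd_comp, (M.dual_incl_linear A).dd, dualApply_eq_apply,
    ← Category.assoc, dd_ev_lam, (M.dualEv_linear A).dd]
  rfl

/-- Functionals are determined by their pairings, so this reduces derivatives of functional-valued
maps to scalar ones, the vector being held fixed by the direction `0`. -/
theorem dualApply_dd {X Y A : C} (a : Y ⟶ M.dual A) (w x : X ⟶ Y) (b : X ⟶ A) :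
    M.dualApply (dd a w x) b =
      dd (M.dualApply (fst Y A ≫ a) (snd Y A)) (lift w 0) (lift x b) := by
  simp only [dd_dualApply, dd_comp, dd_fst, dd_snd, lift_fst, lift_snd, lift_fst_assoc,
    dualApply_zero, add_zero]

open Classical in
/-- The transpose of a family of linear functionals, and `0` for other families. -/
noncomputable def dualLam {X A : C} (h : X ⊗ A ⟶ M.R) : X ⟶ M.dual A :=
  if hh : IsLinear₂ h then (M.existsUnique_dualApply hh).choose else 0

theorem dualApply_dualLam {X Y A : C} {h : X ⊗ A ⟶ M.R} (hh : IsLinear₂ h) (z : Y ⟶ X)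
    (x : Y ⟶ A) : M.dualApply (z ≫ M.dualLam h) x = lift z x ≫ h := by
  have e : M.dualApply (fst X A ≫ M.dualLam h) (snd X A) = h := by
    rw [dualLam, dif_pos hh]; exact (M.existsUnique_dualApply hh).choose_spec.1
  have := congrArg (fun k => lift z x ≫ k) e
  simpa [comp_dualApply] using this

theorem dualLam_eq_iff {X A : C} {h : X ⊗ A ⟶ M.R} (hh : IsLinear₂ h) (f : X ⟶ M.dual A) :
    M.dualApply (fst X A ≫ f) (snd X A) = h ↔ f = M.dualLam h := by
  have e : M.dualApply (fst X A ≫ M.dualLam h) (snd X A) = h := by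
    rw [dualApply_dualLam M hh]; simp
  constructor
  · intro hf; exact M.dual_ext (hf.trans e.symm)
  · rintro rfl; exact e

/-- The dual map `γ ↦ (w ↦ b γ (a ⟨γ, w⟩))`. -/
noncomputable def dualMapHom {X A B : C} (a : X ⊗ A ⟶ B) (b : X ⟶ M.dual B) : X ⟶ M.dual A :=
  M.dualLam (M.dualApply (fst X A ≫ b) a)

theorem isLinear₂_dualApply_comp {X A B : C} {a : X ⊗ A ⟶ B} (ha : IsLinear₂ a)
    (b : X ⟶ M.dual B) : IsLinear₂ (M.dualApply (fst X A ≫ b) a) := by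
  rw [isLinear₂_iff]
  intro Z x c w
  simp only [dd_dualApply, dd_comp, dd_fst, comp_dualApply, lift_fst, lift_fst_assoc, dd_dir_zero,
    ha.dd, dualApply_zero_left, zero_add]

theorem dualApply_dualMapHom {X Y A B : C} {a : X ⊗ A ⟶ B} (ha : IsLinear₂ a) (b : X ⟶ M.dual B)
    (z : Y ⟶ X) (w : Y ⟶ A) :
    M.dualApply (z ≫ M.dualMapHom a b) w = M.dualApply (z ≫ b) (lift z w ≫ a) := by
  rw [dualMapHom, dualApply_dualLam M (M.isLinear₂_dualApply_comp ha b), comp_dualApply]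
  simp

/-- The left-hand side is the clause of `Den` for dual maps; it has a unique solution once `a` is
linear in its second variable. `eq_pbHom_iff` does the same for pullbacks, where the partial
derivative is always linear. -/
theorem eq_dualMapHom_iff {X A B : C} {a : X ⊗ A ⟶ B} (ha : IsLinear₂ a) (b : X ⟶ M.dual B)
    (f : X ⟶ M.dual A) : M.dualApply (fst X A ≫ f) (snd X A) = M.dualApply (fst X A ≫ b) a ↔
      f = M.dualMapHom a b :=
  M.dualLam_eq_iff (M.isLinear₂_dualApply_comp ha b) f

/-- The derivative of a dual map, in all variables. -/
theorem dualApply_dd_dualMapHom {X Y A B : C} {a : X ⊗ A ⟶ B} (ha : IsLinear₂ a)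
    (b : X ⟶ M.dual B) (w x : Y ⟶ X) (c : Y ⟶ A) :
    M.dualApply (dd (M.dualMapHom a b) w x) c = M.dualApply (dd b w x) (lift x c ≫ a) +
      M.dualApply (x ≫ b) (dd a (lift w 0) (lift x c)) := by
  rw [dualApply_dd, (M.eq_dualMapHom_iff ha b _).2 rfl]
  simp only [dd_dualApply, dd_comp, dd_fst, lift_fst, lift_fst_assoc]

theorem comp_dualMapHom {X Y A B : C} {a : X ⊗ A ⟶ B} (ha : IsLinear₂ a) (b : X ⟶ M.dual B)
    (z : Y ⟶ X) :
    z ≫ M.dualMapHom a b = M.dualMapHom (lift (fst Y A ≫ z) (snd Y A) ≫ a) (z ≫ b) := by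
  rw [← eq_dualMapHom_iff, ← Category.assoc, dualApply_dualMapHom M ha, Category.assoc]
  rw [isLinear₂_iff]
  intro W y c w
  simp only [dd_comp, dd_lift, dd_fst, dd_snd, comp_lift, lift_fst, lift_snd, lift_fst_assoc,
    dd_dir_zero, ha.dd, comp_lift_assoc]

/-- The pullback `γ ↦ (x, w ↦ b γ (a ⟨γ, x⟩) (D[a ⟨γ, -⟩] ⟨w, x⟩))`. -/
noncomputable def pbHom {X A B : C} (a : X ⊗ A ⟶ B) (b : X ⟶ (ihom B).obj (M.dual B)) :
    X ⟶ (ihom A).obj (M.dual A) :=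
  lam (M.dualMapHom (dd a (lift 0 (snd (X ⊗ A) A)) (fst (X ⊗ A) A)) (apply (fst X A ≫ b) a))

theorem isLinear₂_D₂ {X A B : C} (a : X ⊗ A ⟶ B) :
    IsLinear₂ (dd a (lift 0 (snd (X ⊗ A) A)) (fst (X ⊗ A) A)) := by
  have := isLinear₂_dd a (fst X A) (snd X A)
  rwa [lift_comp_fst_snd] at this

theorem dualApply_pbHom {X Y A B : C} (a : X ⊗ A ⟶ B) (b : X ⟶ (ihom B).obj (M.dual B))
    (z : Y ⟶ X) (x w : Y ⟶ A) :
    M.dualApply (apply (z ≫ M.pbHom a b) x) w =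
      M.dualApply (apply (z ≫ b) (lift z x ≫ a)) (dd a (lift 0 w) (lift z x)) := by
  rw [pbHom, apply_comp_lam, dualApply_dualMapHom M (isLinear₂_D₂ a), comp_applyHom, comp_dd]
  simp [comp_zero]

theorem form_ext {X A B : C} {a b : X ⟶ (ihom B).obj (M.dual A)}
    (h : M.dualApply (apply (fst (X ⊗ B) A ≫ fst X B ≫ a) (fst (X ⊗ B) A ≫ snd X B)) (snd _ _) =
      M.dualApply (apply (fst (X ⊗ B) A ≫ fst X B ≫ b) (fst (X ⊗ B) A ≫ snd X B)) (snd _ _)) :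
    a = b := by
  apply arrow_ext
  apply M.dual_ext
  simpa only [comp_applyHom, Category.assoc] using h

theorem eq_pbHom_iff {X A B : C} (a : X ⊗ A ⟶ B) (b : X ⟶ (ihom B).obj (M.dual B))
    (f : X ⟶ (ihom A).obj (M.dual A)) :
    M.dualApply (apply (fst (X ⊗ A) A ≫ fst X A ≫ f) (fst (X ⊗ A) A ≫ snd X A)) (snd _ _) =
      M.dualApply (apply (fst (X ⊗ A) A ≫ fst X A ≫ b) (fst (X ⊗ A) A ≫ a)) (D₂ a) ↔
    f = M.pbHom a b := by
  have e : M.dualApply (apply (fst (X ⊗ A) A ≫ fst X A ≫ M.pbHom a b)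
      (fst (X ⊗ A) A ≫ snd X A)) (snd _ _) =
      M.dualApply (apply (fst (X ⊗ A) A ≫ fst X A ≫ b) (fst (X ⊗ A) A ≫ a)) (D₂ a) := by
    rw [← Category.assoc, dualApply_pbHom]
    simp [D₂, dd]
  constructor
  · intro h; exact M.form_ext (h.trans e.symm)
  · rintro rfl; exact e

theorem comp_pbHom {X Y A B : C} (a : X ⊗ A ⟶ B) (b : X ⟶ (ihom B).obj (M.dual B)) (z : Y ⟶ X) :
    z ≫ M.pbHom a b = M.pbHom (lift (fst Y A ≫ z) (snd Y A) ≫ a) (z ≫ b) := by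
  apply M.form_ext
  have := M.dualApply_pbHom (lift (fst Y A ≫ z) (snd Y A) ≫ a) (z ≫ b) (fst (Y ⊗ A) A ≫ fst Y A)
    (fst (Y ⊗ A) A ≫ snd Y A) (snd _ _)
  rw [Category.assoc] at this
  rw [this]
  have := M.dualApply_pbHom a b (fst (Y ⊗ A) A ≫ fst Y A ≫ z)
    (fst (Y ⊗ A) A ≫ snd Y A) (snd _ _)
  simp only [Category.assoc] at this
  rw [this]
  simp only [Category.assoc, comp_lift_assoc, lift_fst_assoc, lift_snd, lift_fst, dd_comp, dd_lift,
    dd_fst, dd_snd, comp_lift, dd_dir_zero]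

end LangModel

/-! ## Denotations as a total function with a domain of definition -/

namespace LangModel

variable {C : Type u} [Category.{v} C] [CartesianMonoidalCategory C] [MonoidalClosed C]
  [DifferentialLambdaCategory C] {𝓕 : FunSig} (M : LangModel 𝓕 C)

/-- The denotation of a term, with an arbitrary value where it is undefined. -/
noncomputable def den : ∀ {Γ : List Ty} {σ : Ty}, Tm 𝓕 Γ σ → (M.ctx Γ ⟶ M.ty σ)
  | _, _, .var x => M.proj x
  | _, _, .zero => 0
  | _, _, .add s p => den s + den p
  | _, _, .lam s => lam (den s)
  | _, _, .app s p => apply (den s) (den p)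
  | _, _, .fst s => den s ≫ fst _ _
  | _, _, .snd s => den s ≫ snd _ _
  | _, _, .pair s t => lift (den s) (den t)
  | _, _, .const r => M.constHom _ r
  | _, _, .fn h p => den p ≫ M.fn h
  | _, _, .jac h s => den s ≫ lam (D (M.fn h))
  | _, _, .dualMap s t => M.dualMapHom (den s) (den t)
  | _, _, .pb p s => M.pbHom (den p) (den s)
  | Γ, _, .dconst r => M.dualLam (snd (M.ctx Γ) _ ≫ M.dot r)

/-- The denotation of a term is defined. -/
def Defd : ∀ {Γ : List Ty} {σ : Ty}, Tm 𝓕 Γ σ → Prop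
  | _, _, .var _ => True
  | _, _, .zero => True
  | _, _, .add s p => Defd s ∧ Defd p
  | _, _, .lam s => Defd s
  | _, _, .app s p => Defd s ∧ Defd p
  | _, _, .fst s => Defd s
  | _, _, .snd s => Defd s
  | _, _, .pair s t => Defd s ∧ Defd t
  | _, _, .const _ => True
  | _, _, .fn _ p => Defd p
  | _, _, .jac _ s => Defd s
  | _, _, .dualMap s t => Defd s ∧ Defd t ∧ IsLinear₂ (M.den s)
  | _, _, .pb p s => Defd p ∧ Defd s
  | _, _, .dconst _ => True

theorem isLinear_dot : ∀ {n : ℕ} (r : Fin (n + 1) → ℝ), IsLinear (M.dot r)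
  | 0, r => M.smul_linear (r 0)
  | n + 1, r => by
    rw [isLinear_iff]
    intro X w x
    simp only [dot, dd_add, dd_comp, dd_fst, dd_snd, comp_add, (isLinear_dot _).dd,
      (M.smul_linear _).dd, Category.assoc]

theorem isLinear₂_snd_dot (X : C) {n : ℕ} (r : Fin (n + 1) → ℝ) :
    IsLinear₂ (snd X (M.ty (Ty.pow n)) ≫ M.dot r) := by
  rw [isLinear₂_iff]
  intro Z x a w
  simp only [dd_comp, dd_snd, (M.isLinear_dot r).dd, lift_snd, lift_snd_assoc]

/-- Only the clauses given by an equation need an argument: dual maps, pullbacks and dual constants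
are transposes, and unique solvability identifies the solution with `den`. -/
theorem den_iff {Γ : List Ty} {σ : Ty} (P : Tm 𝓕 Γ σ) (f : M.ctx Γ ⟶ M.ty σ) :
    M.Den P f ↔ M.Defd P ∧ f = M.den P := by
  induction P with
  | dualMap s t ihs iht =>
    simp only [Den, Defd, den, ihs, iht]
    constructor
    · rintro ⟨a, b, ⟨hs, rfl⟩, ⟨ht, rfl⟩, hl, h⟩
      exact ⟨⟨hs, ht, hl⟩, (M.eq_dualMapHom_iff hl _ _).1 h⟩
    · rintro ⟨⟨hs, ht, hl⟩, h⟩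
      exact ⟨_, _, ⟨hs, rfl⟩, ⟨ht, rfl⟩, hl, (M.eq_dualMapHom_iff hl _ _).2 h⟩
  | pb p s ihp ihs =>
    simp only [Den, Defd, den, ihs, ihp]
    constructor
    · rintro ⟨a, b, ⟨hs, rfl⟩, ⟨ht, rfl⟩, h⟩
      exact ⟨⟨hs, ht⟩, (M.eq_pbHom_iff _ _ _).1 h⟩
    · rintro ⟨⟨hs, ht⟩, h⟩
      exact ⟨_, _, ⟨hs, rfl⟩, ⟨ht, rfl⟩, (M.eq_pbHom_iff _ _ _).2 h⟩
  | dconst r =>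
    simp only [Den, Defd, den, true_and]
    exact M.dualLam_eq_iff (M.isLinear₂_snd_dot _ r) f
  | _ => simp_all [Den, Defd, den, and_assoc]

/-- `q` is defined and has the denotation of `p` whenever `p` is defined. -/
def Sound {Γ : List Ty} {σ : Ty} (p q : Tm 𝓕 Γ σ) : Prop :=
  M.Defd p → M.Defd q ∧ M.den q = M.den p

theorem Sound.refl {Γ : List Ty} {σ : Ty} (p : Tm 𝓕 Γ σ) : M.Sound p p := fun h => ⟨h, rfl⟩

variable {M} in
theorem Sound.trans {Γ : List Ty} {σ : Ty} {p q r : Tm 𝓕 Γ σ} (h : M.Sound p q)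
    (h' : M.Sound q r) : M.Sound p r :=
  fun hp => ⟨(h' (h hp).1).1, (h' (h hp).1).2.trans (h hp).2⟩

variable {M} in
theorem Sound.frame {Δ Γ : List Ty} {τ σ : Ty} (K : Tm.Frame 𝓕 Δ τ Γ σ) {p q : Tm 𝓕 Δ τ}
    (h : M.Sound p q) : M.Sound (K.plug p) (K.plug q) := by
  cases K <;> simp only [Sound, Tm.Frame.plug, Defd, den] <;> intro hp
  -- The linearity condition sees the body only through its denotation, which the reduction
  -- preserves.
  case dualMapL t => obtain ⟨h1, h2⟩ := h hp.1; exact ⟨⟨h1, hp.2.1, h2 ▸ hp.2.2⟩, by rw [h2]⟩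
  case dualMapR s => obtain ⟨h1, h2⟩ := h hp.2.1; exact ⟨⟨hp.1, h1, hp.2.2⟩, by rw [h2]⟩
  all_goals
    first
    | (obtain ⟨h1, h2⟩ := h hp; exact ⟨h1, by rw [h2]⟩)
    | (obtain ⟨h1, h2⟩ := h hp.1; exact ⟨⟨h1, hp.2⟩, by rw [h2]⟩)
    | (obtain ⟨h1, h2⟩ := h hp.2; exact ⟨⟨hp.1, h1⟩, by rw [h2]⟩)

/-! ### Renaming and substitution -/

theorem ctx_ext : ∀ {Γ : List Ty} {X : C} {f g : X ⟶ M.ctx Γ},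
    (∀ (σ : Ty) (x : Var Γ σ), f ≫ M.proj x = g ≫ M.proj x) → f = g
  | [], _, f, g, _ => toUnit_unique (C := C) f g
  | σ :: Γ, X, f, g, h => by
    refine CartesianMonoidalCategory.hom_ext (C := C) (X := M.ctx Γ) (Y := M.ty σ) f g
      (ctx_ext fun τ x => ?_) (h σ Var.vz)
    simpa [proj] using h τ (Var.vs x)

/-- Linearity survives a change of parameters; this keeps dual maps defined under renaming and
substitution. -/
theorem isLinear₂_reindex {X Y A B : C} {a : X ⊗ A ⟶ B} (ha : IsLinear₂ a) (z : Y ⟶ X) :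
    IsLinear₂ (lift (fst Y A ≫ z) (snd Y A) ≫ a) := by
  rw [isLinear₂_iff]
  intro W y c w
  simp only [dd_comp, dd_lift, dd_fst, dd_snd, comp_lift, lift_fst, lift_snd, lift_fst_assoc,
    dd_dir_zero, ha.dd, comp_lift_assoc]

theorem comp_constHom {X Y : C} (z : Y ⟶ X) (r : ℝ) : z ≫ M.constHom X r = M.constHom Y r := by
  rw [constHom, constHom, ← Category.assoc, comp_toUnit]

theorem comp_dualLam_dot {X Y : C} (z : Y ⟶ X) {n : ℕ} (r : Fin (n + 1) → ℝ) :
    z ≫ M.dualLam (snd X _ ≫ M.dot r) = M.dualLam (snd Y _ ≫ M.dot r) := by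
  rw [← M.dualLam_eq_iff (M.isLinear₂_snd_dot _ r), ← Category.assoc,
    M.dualApply_dualLam (M.isLinear₂_snd_dot _ r), lift_snd_assoc]

/-- The compatibility of `z` with `ρ` is required only at free variables. This generality is used in
`kill_comp_den`, where `ρ` is the identity and `z` is not. -/
theorem den_rename {Γ Δ : List Ty} {σ : Ty} (s : Tm 𝓕 Γ σ) (ρ : Tm.Ren Γ Δ)
    (z : M.ctx Δ ⟶ M.ctx Γ)
    (hz : ∀ (τ : Ty) (x : Var Γ τ), s.Free x.idx → z ≫ M.proj x = M.proj (ρ τ x))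
    (hs : M.Defd s) : M.Defd (s.rename ρ) ∧ M.den (s.rename ρ) = z ≫ M.den s := by
  have up : ∀ {Γ Δ : List Ty} {σ τ : Ty} (s : Tm 𝓕 (σ :: Γ) τ) (ρ : Tm.Ren Γ Δ)
      (z : M.ctx Δ ⟶ M.ctx Γ),
      (∀ (τ : Ty) (x : Var Γ τ), s.Free (x.idx + 1) → z ≫ M.proj x = M.proj (ρ τ x)) →
      ∀ (τ : Ty) (x : Var (σ :: Γ) τ), s.Free x.idx →
        lift (fst (M.ctx Δ) (M.ty σ) ≫ z) (snd (M.ctx Δ) (M.ty σ)) ≫ M.proj x =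
          M.proj (ρ.up σ τ x) := by
    intro Γ Δ σ τ s ρ z h τ' x hx
    cases x with
    | vz => simp [proj, Tm.Ren.up]
    | vs x => simp [proj, Tm.Ren.up, ← h _ _ hx]
  induction s generalizing Δ with
  | var x => exact ⟨trivial, (hz _ x rfl).symm⟩
  | zero => exact ⟨trivial, (comp_zero _).symm⟩
  | const r => exact ⟨trivial, (M.comp_constHom _ _).symm⟩
  | dconst r => exact ⟨trivial, (M.comp_dualLam_dot _ _).symm⟩
  | add s p ihs ihp =>
    obtain ⟨h1, h2⟩ := ihs ρ z (fun τ x h => hz τ x (Or.inl h)) hs.1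
    obtain ⟨h3, h4⟩ := ihp ρ z (fun τ x h => hz τ x (Or.inr h)) hs.2
    exact ⟨⟨h1, h3⟩, by simp only [Tm.rename, den, h2, h4, comp_add]⟩
  | app s p ihs ihp =>
    obtain ⟨h1, h2⟩ := ihs ρ z (fun τ x h => hz τ x (Or.inl h)) hs.1
    obtain ⟨h3, h4⟩ := ihp ρ z (fun τ x h => hz τ x (Or.inr h)) hs.2
    exact ⟨⟨h1, h3⟩, by simp only [Tm.rename, den, h2, h4, comp_applyHom]⟩
  | pair s p ihs ihp =>
    obtain ⟨h1, h2⟩ := ihs ρ z (fun τ x h => hz τ x (Or.inl h)) hs.1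
    obtain ⟨h3, h4⟩ := ihp ρ z (fun τ x h => hz τ x (Or.inr h)) hs.2
    exact ⟨⟨h1, h3⟩, by simp only [Tm.rename, den, h2, h4, comp_lift]⟩
  | lam s ih =>
    obtain ⟨h1, h2⟩ := ih (ρ.up _) _ (up s ρ z hz) hs
    exact ⟨h1, by simp only [Tm.rename, den, h2, comp_lam]⟩
  | fst s ih =>
    obtain ⟨h1, h2⟩ := ih ρ z hz hs
    exact ⟨h1, by simp only [Tm.rename, den, h2, Category.assoc]⟩
  | snd s ih =>
    obtain ⟨h1, h2⟩ := ih ρ z hz hs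
    exact ⟨h1, by simp only [Tm.rename, den, h2, Category.assoc]⟩
  | fn f s ih =>
    obtain ⟨h1, h2⟩ := ih ρ z hz hs
    exact ⟨h1, by simp only [Tm.rename, den, h2, Category.assoc]⟩
  | jac f s ih =>
    obtain ⟨h1, h2⟩ := ih ρ z hz hs
    exact ⟨h1, by simp only [Tm.rename, den, h2, Category.assoc]⟩
  | dualMap s t ihs iht =>
    obtain ⟨h1, h2⟩ := ihs (ρ.up _) _ (up s ρ z fun τ x h => hz τ x (Or.inl h)) hs.1
    obtain ⟨h3, h4⟩ := iht ρ z (fun τ x h => hz τ x (Or.inr h)) hs.2.1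
    refine ⟨⟨h1, h3, h2 ▸ isLinear₂_reindex hs.2.2 z⟩, ?_⟩
    simp only [Tm.rename, den, h2, h4, M.comp_dualMapHom hs.2.2]
  | pb p s ihp ihs =>
    obtain ⟨h1, h2⟩ := ihp (ρ.up _) _ (up p ρ z fun τ x h => hz τ x (Or.inl h)) hs.1
    obtain ⟨h3, h4⟩ := ihs ρ z (fun τ x h => hz τ x (Or.inr h)) hs.2
    exact ⟨⟨h1, h3⟩, by simp only [Tm.rename, den, h2, h4, comp_pbHom]⟩

variable {M} in
theorem Defd.wk {Γ : List Ty} {σ : Ty} {s : Tm 𝓕 Γ σ} (hs : M.Defd s) (τ : Ty) :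
    M.Defd (s.wk τ) := (M.den_rename s (fun _ x => Var.vs x) (fst _ (M.ty τ)) (fun _ _ _ => rfl) hs).1

theorem den_wk {Γ : List Ty} {σ : Ty} {s : Tm 𝓕 Γ σ} (hs : M.Defd s) (τ : Ty) :
    M.den (s.wk τ) = fst (M.ctx Γ) (M.ty τ) ≫ M.den s :=
  (M.den_rename s (fun _ x => Var.vs x) (fst _ (M.ty τ)) (fun _ _ _ => rfl) hs).2

/-- Below a binder the substituted terms are weakened, so the induction relies on the result for
renamings. -/
theorem den_subst {Γ Δ : List Ty} {σ : Ty} (s : Tm 𝓕 Γ σ) (θ : Tm.Sub 𝓕 Γ Δ)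
    (z : M.ctx Δ ⟶ M.ctx Γ)
    (hz : ∀ (τ : Ty) (x : Var Γ τ), M.Defd (θ τ x) ∧ M.den (θ τ x) = z ≫ M.proj x)
    (hs : M.Defd s) : M.Defd (s.subst θ) ∧ M.den (s.subst θ) = z ≫ M.den s := by
  have up : ∀ {Γ Δ : List Ty} (σ : Ty) (θ : Tm.Sub 𝓕 Γ Δ) (z : M.ctx Δ ⟶ M.ctx Γ),
      (∀ (τ : Ty) (x : Var Γ τ), M.Defd (θ τ x) ∧ M.den (θ τ x) = z ≫ M.proj x) →
      ∀ (τ : Ty) (x : Var (σ :: Γ) τ), M.Defd (θ.up σ τ x) ∧ M.den (θ.up σ τ x) =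
        lift (fst (M.ctx Δ) (M.ty σ) ≫ z) (snd (M.ctx Δ) (M.ty σ)) ≫ M.proj x := by
    intro Γ Δ σ θ z h τ' x
    cases x with
    | vz => exact ⟨trivial, by simp [proj, den, Tm.Sub.up]⟩
    | vs x =>
      refine ⟨(h _ x).1.wk σ, (M.den_wk (h _ x).1 σ).trans ?_⟩
      simp [proj, (h _ x).2]
  induction s generalizing Δ with
  | var x => exact hz _ x
  | zero => exact ⟨trivial, (comp_zero _).symm⟩
  | const r => exact ⟨trivial, (M.comp_constHom _ _).symm⟩
  | dconst r => exact ⟨trivial, (M.comp_dualLam_dot _ _).symm⟩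
  | add s p ihs ihp =>
    obtain ⟨h1, h2⟩ := ihs θ z hz hs.1
    obtain ⟨h3, h4⟩ := ihp θ z hz hs.2
    exact ⟨⟨h1, h3⟩, by simp only [Tm.subst, den, h2, h4, comp_add]⟩
  | app s p ihs ihp =>
    obtain ⟨h1, h2⟩ := ihs θ z hz hs.1
    obtain ⟨h3, h4⟩ := ihp θ z hz hs.2
    exact ⟨⟨h1, h3⟩, by simp only [Tm.subst, den, h2, h4, comp_applyHom]⟩
  | pair s p ihs ihp =>
    obtain ⟨h1, h2⟩ := ihs θ z hz hs.1
    obtain ⟨h3, h4⟩ := ihp θ z hz hs.2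
    exact ⟨⟨h1, h3⟩, by simp only [Tm.subst, den, h2, h4, comp_lift]⟩
  | lam s ih =>
    obtain ⟨h1, h2⟩ := ih (θ.up _) _ (up _ θ z hz) hs
    exact ⟨h1, by simp only [Tm.subst, den, h2, comp_lam]⟩
  | fst s ih =>
    obtain ⟨h1, h2⟩ := ih θ z hz hs
    exact ⟨h1, by simp only [Tm.subst, den, h2, Category.assoc]⟩
  | snd s ih =>
    obtain ⟨h1, h2⟩ := ih θ z hz hs
    exact ⟨h1, by simp only [Tm.subst, den, h2, Category.assoc]⟩
  | fn f s ih =>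
    obtain ⟨h1, h2⟩ := ih θ z hz hs
    exact ⟨h1, by simp only [Tm.subst, den, h2, Category.assoc]⟩
  | jac f s ih =>
    obtain ⟨h1, h2⟩ := ih θ z hz hs
    exact ⟨h1, by simp only [Tm.subst, den, h2, Category.assoc]⟩
  | dualMap s t ihs iht =>
    obtain ⟨h1, h2⟩ := ihs (θ.up _) _ (up _ θ z hz) hs.1
    obtain ⟨h3, h4⟩ := iht θ z hz hs.2.1
    refine ⟨⟨h1, h3, h2 ▸ isLinear₂_reindex hs.2.2 z⟩, ?_⟩
    simp only [Tm.subst, den, h2, h4, M.comp_dualMapHom hs.2.2]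
  | pb p s ihp ihs =>
    obtain ⟨h1, h2⟩ := ihp (θ.up _) _ (up _ θ z hz) hs.1
    obtain ⟨h3, h4⟩ := ihs θ z hz hs.2
    exact ⟨⟨h1, h3⟩, by simp only [Tm.subst, den, h2, h4, comp_pbHom]⟩

end LangModel

-- Syntactic cancellation of renamings.

/-- Serves to undo a weakening: putting `0` for the fresh variable shows that a term is defined
whenever its weakening is. -/
theorem Tm.subst_rename_eq {𝓕 : FunSig} {Γ Δ : List Ty} {σ : Ty} (s : Tm 𝓕 Γ σ) (ρ : Tm.Ren Γ Δ)
    (θ : Tm.Sub 𝓕 Δ Γ) (h : ∀ (τ : Ty) (x : Var Γ τ), θ τ (ρ τ x) = Tm.var x) :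
    (s.rename ρ).subst θ = s := by
  have up : ∀ {Γ Δ : List Ty} (σ : Ty) (ρ : Tm.Ren Γ Δ) (θ : Tm.Sub 𝓕 Δ Γ),
      (∀ (τ : Ty) (x : Var Γ τ), θ τ (ρ τ x) = Tm.var x) →
      ∀ (τ : Ty) (x : Var (σ :: Γ) τ), θ.up σ τ (ρ.up σ τ x) = Tm.var x := by
    intro Γ Δ σ ρ θ h τ x
    cases x with
    | vz => rfl
    | vs x => simp [Tm.Ren.up, Tm.Sub.up, h, Tm.wk, Tm.rename]
  induction s generalizing Δ with
  | var x => exact h _ x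
  | zero => rfl
  | const r => rfl
  | dconst r => rfl
  | add s p ihs ihp => simp only [Tm.rename, Tm.subst, ihs ρ θ h, ihp ρ θ h]
  | app s p ihs ihp => simp only [Tm.rename, Tm.subst, ihs ρ θ h, ihp ρ θ h]
  | pair s p ihs ihp => simp only [Tm.rename, Tm.subst, ihs ρ θ h, ihp ρ θ h]
  | lam s ih => simp only [Tm.rename, Tm.subst, ih _ _ (up _ ρ θ h)]
  | fst s ih => simp only [Tm.rename, Tm.subst, ih ρ θ h]
  | snd s ih => simp only [Tm.rename, Tm.subst, ih ρ θ h]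
  | fn f s ih => simp only [Tm.rename, Tm.subst, ih ρ θ h]
  | jac f s ih => simp only [Tm.rename, Tm.subst, ih ρ θ h]
  | dualMap s t ihs iht => simp only [Tm.rename, Tm.subst, ihs _ _ (up _ ρ θ h), iht ρ θ h]
  | pb p s ihp ihs => simp only [Tm.rename, Tm.subst, ihp _ _ (up _ ρ θ h), ihs ρ θ h]

/-- Allows `den_rename` to be read for the identity renaming with a nontrivial environment morphism.
-/
theorem Tm.rename_id {𝓕 : FunSig} {Γ : List Ty} {σ : Ty} (s : Tm 𝓕 Γ σ) (ρ : Tm.Ren Γ Γ)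
    (h : ∀ (τ : Ty) (x : Var Γ τ), ρ τ x = x) : s.rename ρ = s := by
  have up : ∀ {Γ : List Ty} (σ : Ty) (ρ : Tm.Ren Γ Γ), (∀ (τ : Ty) (x : Var Γ τ), ρ τ x = x) →
      ∀ (τ : Ty) (x : Var (σ :: Γ) τ), ρ.up σ τ x = x := by
    intro Γ σ ρ h τ x
    cases x with
    | vz => rfl
    | vs x => simp [Tm.Ren.up, h]
  induction s with
  | var x => simp [Tm.rename, h]
  | zero => rfl
  | const r => rfl
  | dconst r => rfl
  | add s p ihs ihp => simp only [Tm.rename, ihs ρ h, ihp ρ h]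
  | app s p ihs ihp => simp only [Tm.rename, ihs ρ h, ihp ρ h]
  | pair s p ihs ihp => simp only [Tm.rename, ihs ρ h, ihp ρ h]
  | lam s ih => simp only [Tm.rename, ih _ (up _ ρ h)]
  | fst s ih => simp only [Tm.rename, ih ρ h]
  | snd s ih => simp only [Tm.rename, ih ρ h]
  | fn f s ih => simp only [Tm.rename, ih ρ h]
  | jac f s ih => simp only [Tm.rename, ih ρ h]
  | dualMap s t ihs iht => simp only [Tm.rename, ihs _ (up _ ρ h), iht ρ h]
  | pb p s ihp ihs => simp only [Tm.rename, ihp _ (up _ ρ h), ihs ρ h]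

-- Denotations of instances, weakenings and exchanges.

namespace LangModel

variable {C : Type u} [Category.{v} C] [CartesianMonoidalCategory C] [MonoidalClosed C]
  [DifferentialLambdaCategory C] {𝓕 : FunSig} (M : LangModel 𝓕 C)

theorem defd_inst_and {Γ : List Ty} {σ τ : Ty} {s : Tm 𝓕 (τ :: Γ) σ} {a : Tm 𝓕 Γ τ}
    (hs : M.Defd s) (ha : M.Defd a) :
    M.Defd (s.inst a) ∧ M.den (s.inst a) = lift (𝟙 (M.ctx Γ)) (M.den a) ≫ M.den s := by
  refine M.den_subst s _ _ (fun τ x => ?_) hs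
  cases x with
  | vz => exact ⟨ha, (lift_snd _ _).symm⟩
  | vs x => exact ⟨trivial, by simp [proj, den, Tm.single]⟩

theorem defd_inst₁_and {Γ : List Ty} {σ τ ρ : Ty} {s : Tm 𝓕 (ρ :: τ :: Γ) σ} {a : Tm 𝓕 Γ τ}
    (hs : M.Defd s) (ha : M.Defd a) :
    M.Defd (s.inst₁ a) ∧ M.den (s.inst₁ a) =
      lift (lift (fst (M.ctx Γ) (M.ty ρ)) (fst _ _ ≫ M.den a)) (snd _ _) ≫ M.den s := by
  refine M.den_subst s _ _ (fun τ x => ?_) hs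
  match τ, x with
  | _, Var.vz => exact ⟨trivial, (lift_snd _ _).symm⟩
  | _, Var.vs Var.vz =>
    refine ⟨ha.wk ρ, (M.den_wk ha ρ).trans ?_⟩
    simp [proj]
  | _, Var.vs (Var.vs x) => exact ⟨trivial, by simp [proj, den, Tm.single, Tm.Sub.up, Tm.wk, Tm.rename]⟩

theorem defd_unpair_and {Γ : List Ty} {α β σ : Ty} {s : Tm 𝓕 (α :: β :: Γ) σ} (hs : M.Defd s) :
    M.Defd s.unpair ∧ M.den s.unpair =
      lift (lift (fst (M.ctx Γ) (M.ty (Ty.prod β α))) (snd _ (M.ty β ⊗ M.ty α) ≫ fst _ _))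
        (snd _ (M.ty β ⊗ M.ty α) ≫ snd _ _) ≫ M.den s := by
  refine M.den_subst s _ _ (fun τ x => ?_) hs
  match τ, x with
  | _, Var.vz => exact ⟨trivial, (lift_snd _ _).symm⟩
  | _, Var.vs Var.vz => exact ⟨trivial, by simp [proj, den, Tm.unpairSub]⟩
  | _, Var.vs (Var.vs x) => exact ⟨trivial, by simp [proj, den, Tm.unpairSub]⟩

theorem defd_wk {Γ : List Ty} {σ τ : Ty} {s : Tm 𝓕 Γ σ} : M.Defd (s.wk τ) ↔ M.Defd s := by
  refine ⟨fun h => ?_, fun h => h.wk τ⟩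
  have := (M.defd_inst_and (a := Tm.zero) h trivial).1
  rwa [Tm.inst, Tm.wk, Tm.subst_rename_eq s (fun _ x => Var.vs x) _ fun _ _ => rfl] at this

theorem defd_wk₁_and {Γ : List Ty} {σ ρ τ : Ty} {s : Tm 𝓕 (ρ :: Γ) σ} (hs : M.Defd s) :
    M.Defd (s.wk₁ τ) ∧ M.den (s.wk₁ τ) =
      lift (fst (M.ctx Γ ⊗ M.ty τ) (M.ty ρ) ≫ fst _ _) (snd _ _) ≫ M.den s := by
  refine M.den_rename s _ _ (fun τ x _ => ?_) hs
  cases x with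
  | vz => exact lift_snd _ _
  | vs x => simp [proj, Tm.Ren.up]

theorem defd_wk₁ {Γ : List Ty} {σ ρ τ : Ty} {s : Tm 𝓕 (ρ :: Γ) σ} :
    M.Defd (s.wk₁ τ) ↔ M.Defd s := by
  refine ⟨fun h => ?_, fun h => (M.defd_wk₁_and h).1⟩
  have := (M.defd_inst₁_and (a := Tm.zero) h trivial).1
  rwa [Tm.inst₁, Tm.wk₁, Tm.subst_rename_eq] at this
  intro τ x
  cases x <;> rfl

theorem den_wk₁ {Γ : List Ty} {σ ρ τ : Ty} {s : Tm 𝓕 (ρ :: Γ) σ} (hs : M.Defd s) :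
    M.den (s.wk₁ τ) = lift (fst (M.ctx Γ ⊗ M.ty τ) (M.ty ρ) ≫ fst _ _) (snd _ _) ≫ M.den s :=
  (M.defd_wk₁_and hs).2

theorem defd_swap_and {Γ : List Ty} {α β σ : Ty} {s : Tm 𝓕 (α :: β :: Γ) σ} (hs : M.Defd s) :
    M.Defd s.swap ∧ M.den s.swap =
      lift (lift (fst (M.ctx Γ ⊗ M.ty α) (M.ty β) ≫ fst _ _) (snd _ _)) (fst _ _ ≫ snd _ _) ≫
        M.den s := by
  refine M.den_rename s _ _ (fun τ x _ => ?_) hs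
  match τ, x with
  | _, Var.vz => exact lift_snd _ _
  | _, Var.vs Var.vz => simp [proj, Tm.swapRen]
  | _, Var.vs (Var.vs x) => simp [proj, Tm.swapRen]

end LangModel

namespace LangModel

variable {C : Type u} [Category.{v} C] [CartesianMonoidalCategory C] [MonoidalClosed C]
  [DifferentialLambdaCategory C] {𝓕 : FunSig} (M : LangModel 𝓕 C)

/-! ### Linear variables -/

/-- The environment with the entry of index `k` replaced by `0`. -/
def kill : ∀ (Γ : List Ty) (_ : ℕ), M.ctx Γ ⟶ M.ctx Γ
  | [], _ => 𝟙 _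
  | σ :: Γ, 0 => lift (fst (M.ctx Γ) (M.ty σ)) 0
  | σ :: Γ, k + 1 => lift (fst (M.ctx Γ) (M.ty σ) ≫ kill Γ k) (snd _ _)

theorem kill_proj : ∀ {Γ : List Ty} {σ : Ty} (k : ℕ) (x : Var Γ σ),
    (x.idx = k → M.kill Γ k ≫ M.proj x = 0) ∧ (x.idx ≠ k → M.kill Γ k ≫ M.proj x = M.proj x)
  | _, _, 0, Var.vz => by simp [kill, proj, Var.idx]
  | _, _, 0, Var.vs x => by simp [kill, proj, Var.idx]
  | _, _, k + 1, Var.vz => by simp [kill, proj, Var.idx]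
  | _, _, k + 1, Var.vs x => by
    refine ⟨fun h => ?_, fun h => ?_⟩
    · simp [kill, proj, (kill_proj k x).1 (by simpa [Var.idx] using h), comp_zero]
    · simp [kill, proj, (kill_proj k x).2 (by simpa [Var.idx] using h)]

/-- A variable that is not free may be overwritten by `0`, because `den_rename` tests the
environment at free variables only. -/
theorem kill_comp_den {Γ : List Ty} {σ : Ty} {s : Tm 𝓕 Γ σ} {k : ℕ} (hk : ¬ s.Free k)
    (hs : M.Defd s) : M.kill Γ k ≫ M.den s = M.den s := by
  have := (M.den_rename s (fun _ x => x) (M.kill Γ k)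
    (fun τ x hx => (M.kill_proj k x).2 fun h => hk (h ▸ hx)) hs).2
  rwa [Tm.rename_id s (fun _ x => x) fun _ _ => rfl, eq_comm] at this

/-- The environment `y` arises from `x` by replacing the entry with index `k` by that of `w`, and
the other entries of `w` vanish. -/
structure Replace (k : ℕ) {Γ : List Ty} {Z : C} (w x y : Z ⟶ M.ctx Γ) : Prop where
  same : ∀ (σ : Ty) (v : Var Γ σ), v.idx = k → w ≫ M.proj v = y ≫ M.proj v
  dir : ∀ (σ : Ty) (v : Var Γ σ), v.idx ≠ k → w ≫ M.proj v = 0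
  base : ∀ (σ : Ty) (v : Var Γ σ), v.idx ≠ k → x ≫ M.proj v = y ≫ M.proj v

variable {M} in
-- A newly bound variable is not moved: its direction is `0`, and both environments receive the same
-- generic entry.
theorem Replace.succ {k : ℕ} {Γ : List Ty} {Z : C} {w x y : Z ⟶ M.ctx Γ} (h : M.Replace k w x y)
    (σ : Ty) : M.Replace (Γ := σ :: Γ) (k + 1) (lift (fst Z (M.ty σ) ≫ w) 0)
      (lift (fst Z (M.ty σ) ≫ x) (snd _ _)) (lift (fst Z (M.ty σ) ≫ y) (snd _ _)) where
  same τ v hv := by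
    cases v with
    | vz => simp [Var.idx] at hv
    | vs v => simp [proj, h.same τ v (by simpa [Var.idx] using hv)]
  dir τ v hv := by
    cases v with
    | vz => simp [proj]
    | vs v => simp [proj, h.dir τ v (by simpa [Var.idx] using hv), comp_zero]
  base τ v hv := by
    cases v with
    | vz => simp [proj]
    | vs v => simp [proj, h.base τ v (by simpa [Var.idx] using hv)]

variable {M} in
theorem Replace.comp {k : ℕ} {Γ : List Ty} {Z Z' : C} {w x y : Z ⟶ M.ctx Γ}
    (h : M.Replace k w x y) (z : Z' ⟶ Z) : M.Replace k (z ≫ w) (z ≫ x) (z ≫ y) where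
  same τ v hv := by simp only [Category.assoc, h.same τ v hv]
  dir τ v hv := by simp only [Category.assoc, h.dir τ v hv, comp_zero]
  base τ v hv := by simp only [Category.assoc, h.base τ v hv]

theorem dd_proj : ∀ {Γ : List Ty} {σ : Ty} {Z : C} (v : Var Γ σ) (w x : Z ⟶ M.ctx Γ),
    dd (M.proj v) w x = w ≫ M.proj v
  | _, _, _, Var.vz, w, x => dd_snd w x
  | _, _, _, Var.vs v, w, x => by simp [proj, dd_comp, dd_fst, dd_proj v]

theorem zero_comp_proj : ∀ {Γ : List Ty} {σ : Ty} {Z : C} (v : Var Γ σ),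
    (0 : Z ⟶ M.ctx Γ) ≫ M.proj v = 0 := by
  intro Γ σ Z v
  rw [← M.dd_proj v 0 0, dd_dir_zero]

variable {M} in
-- The denotation factors through `kill`, which identifies `x` with `y` and has derivative `0` in
-- the direction `w`.
theorem Replace.comp_den {k : ℕ} {Γ : List Ty} {Z : C} {w x y : Z ⟶ M.ctx Γ}
    (h : M.Replace k w x y) {σ : Ty} {s : Tm 𝓕 Γ σ} (hk : ¬ s.Free k) (hs : M.Defd s) :
    x ≫ M.den s = y ≫ M.den s ∧ dd (M.den s) w x = 0 := by
  have e := M.kill_comp_den hk hs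
  have h1 : x ≫ M.kill Γ k = y ≫ M.kill Γ k := by
    refine M.ctx_ext fun τ v => ?_
    simp only [Category.assoc]
    by_cases hv : v.idx = k
    · rw [(M.kill_proj k v).1 hv, comp_zero, comp_zero]
    · rw [(M.kill_proj k v).2 hv, h.base τ v hv]
  have h2 : dd (M.kill Γ k) w x = 0 := by
    refine M.ctx_ext fun τ v => ?_
    -- Projections are linear, so the derivative can be computed entry by entry.
    rw [M.zero_comp_proj, ← M.dd_proj v _ (x ≫ M.kill Γ k), ← dd_comp]
    by_cases hv : v.idx = k
    · rw [(M.kill_proj k v).1 hv, dd_zero]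
    · rw [(M.kill_proj k v).2 hv, dd_proj, h.dir τ v hv]
  constructor
  · rw [← e, ← Category.assoc, h1, Category.assoc]
  · rw [← e, dd_comp, h2, dd_dir_zero]

/-- By CD6 a derivative is linear in its direction, so the Jacobian term is linear in its argument.
-/
theorem dd_lam_D {X A B : C} (f : A ⟶ B) (w x : X ⟶ A) : dd (lam (D f)) w x = w ≫ lam (D f) := by
  rw [dd_lam, comp_lam]
  congr 1
  exact cd6 f _ _ _

/-- A term is linear in its linear variables. -/
theorem dd_den_of_lin {Γ : List Ty} {σ : Ty} {s : Tm 𝓕 Γ σ} {k : ℕ} (hk : s.Lin k)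
    (hs : M.Defd s) {Z : C} {w x y : Z ⟶ M.ctx Γ} (h : M.Replace k w x y) :
    dd (M.den s) w x = y ≫ M.den s := by
  -- Binders shift the index and enlarge the environments.
  induction s generalizing k Z with
  | var v => simp only [den, dd_proj, h.same _ v hk]
  | zero => simp only [den, dd_zero, comp_zero]
  | const r => exact hk.elim
  | fn f p => exact hk.elim
  | pb p s => exact hk.elim
  | dconst r => exact hk.elim
  | add s p ihs ihp => simp only [den, dd_add, comp_add, ihs hk.1 hs.1 h, ihp hk.2 hs.2 h]
  | pair s p ihs ihp => simp only [den, dd_lift, comp_lift, ihs hk.1 hs.1 h, ihp hk.2 hs.2 h]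
  | lam s ih => simp only [den, dd_lam, comp_lam, ih hk hs (h.succ _)]
  | fst s ih => simp only [den, dd_comp, dd_fst, ih hk hs h, Category.assoc]
  | snd s ih => simp only [den, dd_comp, dd_snd, ih hk hs h, Category.assoc]
  | jac f s ih => simp only [den, dd_comp, dd_lam_D, ih hk hs h, Category.assoc]
  | app s p ihs ihp =>
    -- Evaluation is linear only in the function; the summand from the argument vanishes because the
    -- variable does not occur there.
    obtain ⟨h1, h2⟩ := h.comp_den hk.2 hs.2
    simp only [den, dd_apply, comp_applyHom, ihs hk.1 hs.1 h, h1, h2, dd_dir_lift_zero, add_zero]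
  | @dualMap _ α _ s t ihs iht =>
    refine M.dual_ext ?_
    have h' := h.succ α
    have h₁ := h.comp (fst Z (M.ty α))
    simp only [den, comp_dd, M.dualApply_dd_dualMapHom hs.2.2]
    rw [← Category.assoc _ y, M.dualApply_dualMapHom hs.2.2]
    -- The Leibniz rule gives one summand for the functional and one for the body. The variable is
    -- linear in one of the two and absent from the other, whose summand vanishes.
    rcases hk with ⟨hk, hf⟩ | ⟨hk, hf⟩
    · obtain ⟨h1, h2⟩ := h₁.comp_den hf hs.2.1
      rw [h2, h1, ihs hk hs.1 h', dualApply_zero_left, zero_add]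
    · obtain ⟨h1, h2⟩ := h'.comp_den hf hs.1
      rw [h2, h1, iht hk hs.2.1 h₁, dualApply_zero, add_zero]

theorem isLinear₂_den {Γ : List Ty} {σ τ : Ty} {s : Tm 𝓕 (τ :: Γ) σ} (hk : s.Lin 0)
    (hs : M.Defd s) : IsLinear₂ (X := M.ctx Γ) (A := M.ty τ) (M.den s) := by
  rw [isLinear₂_iff]
  intro Z x a w
  -- Here the direction is `(0, w)`, the base point `(x, a)` and the replaced environment `(x, w)`.
  refine M.dd_den_of_lin hk hs ⟨fun ρ v hv => ?_, fun ρ v hv => ?_, fun ρ v hv => ?_⟩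
  all_goals
    cases v with
    | vz => simp [proj, Var.idx] at hv ⊢
    | vs v => simp [proj, Var.idx, M.zero_comp_proj] at hv ⊢

/-- The linearity side condition of typing supplies the only condition for definedness. -/
theorem defd_of_wellTyped {Γ : List Ty} {σ : Ty} {s : Tm 𝓕 Γ σ} (h : s.WellTyped) :
    M.Defd s := by
  induction s with
  | @dualMap _ α _ s t ihs iht =>
    exact ⟨ihs h.1, iht h.2.1, M.isLinear₂_den h.2.2 (ihs h.1)⟩
  | _ => simp_all [Tm.WellTyped, Defd]

/-! ### Soundness of the identification of terms -/

theorem dualMapHom_add {X A B : C} {a a' : X ⊗ A ⟶ B} (ha : IsLinear₂ a) (ha' : IsLinear₂ a')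
    (b : X ⟶ M.dual B) :
    M.dualMapHom (a + a') b = M.dualMapHom a b + M.dualMapHom a' b := by
  refine M.dual_ext ?_
  rw [comp_add, dualApply_add_left, dualApply_dualMapHom M (ha.add ha'),
    dualApply_dualMapHom M ha, dualApply_dualMapHom M ha', comp_add, dualApply_add]

theorem dualMapHom_zero {X A B : C} (b : X ⟶ M.dual B) :
    M.dualMapHom (0 : X ⊗ A ⟶ B) b = 0 := by
  refine M.dual_ext ?_
  rw [dualApply_dualMapHom M IsLinear₂.zero, comp_zero, dualApply_zero, comp_zero,
    dualApply_zero_left]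

theorem dualMapHom_zero_right {X A B : C} {a : X ⊗ A ⟶ B} (ha : IsLinear₂ a) :
    M.dualMapHom a 0 = 0 := by
  refine M.dual_ext ?_
  rw [M.dualApply_dualMapHom ha, comp_zero, comp_zero, dualApply_zero_left, dualApply_zero_left]

/-- Both directions are carried through the induction, because the congruence is symmetric and
`Sound` is not. -/
theorem sound_of_eqv {Γ : List Ty} {σ : Ty} {p q : Tm 𝓕 Γ σ} (h : Tm.Eqv p q) :
    M.Sound p q ∧ M.Sound q p := by
  have of_eq : ∀ {Γ : List Ty} {σ : Ty} {p q : Tm 𝓕 Γ σ}, (M.Defd p ↔ M.Defd q) →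
      (M.Defd p → M.den p = M.den q) → M.Sound p q ∧ M.Sound q p := fun h h' =>
    ⟨fun hp => ⟨h.1 hp, (h' hp).symm⟩, fun hq => ⟨h.2 hq, h' (h.2 hq)⟩⟩
  induction h with
  | refl p => exact ⟨Sound.refl M p, Sound.refl M p⟩
  | symm _ ih => exact ih.symm
  | trans _ _ ih ih' => exact ⟨ih.1.trans ih'.1, ih'.2.trans ih.2⟩
  | frame K _ ih => exact ⟨ih.1.frame K, ih.2.frame K⟩
  | add_zero p => exact of_eq (by simp [Defd]) fun _ => by simp [den]
  | add_comm p q => exact of_eq (by simp [Defd, and_comm]) fun _ => by simp [den, add_comm]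
  | add_assoc p q r => exact of_eq (by simp [Defd, and_assoc]) fun _ => by simp [den, add_assoc]
  | lin_add S A B hS hA hB hl =>
    -- Well-typedness makes both sides defined, so only additivity in the linear variable remains.
    replace hS := M.defd_of_wellTyped hS
    replace hA := M.defd_of_wellTyped hA
    replace hB := M.defd_of_wellTyped hB
    obtain ⟨h1, e1⟩ := M.defd_inst_and (a := A.add B) hS ⟨hA, hB⟩
    obtain ⟨h2, e2⟩ := M.defd_inst_and hS hA
    obtain ⟨h3, e3⟩ := M.defd_inst_and hS hB
    refine of_eq (iff_of_true h1 ⟨h2, h3⟩) fun _ => ?_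
    simp only [e1, den, e2, e3, (M.isLinear₂_den hl hS).lift_add]
  | lin_zero S hS hl =>
    replace hS := M.defd_of_wellTyped hS
    obtain ⟨h1, e1⟩ := M.defd_inst_and (a := Tm.zero) hS trivial
    refine of_eq (iff_of_true h1 trivial) fun _ => ?_
    simp only [e1, den, (M.isLinear₂_den hl hS).lift_zero]
  | lam_add s p => exact of_eq Iff.rfl fun _ => DifferentialLambdaCategory.lam_add _ _
  | lam_zero => exact of_eq Iff.rfl fun _ => DifferentialLambdaCategory.lam_zero
  | dualMap_add s p t hs hp =>
    refine of_eq ⟨fun h => ?_, fun h => ?_⟩ fun h => ?_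
    -- Linearity of a sum does not give linearity of its summands; it comes from the syntactic
    -- hypotheses `hs` and `hp`.
    · exact ⟨⟨h.1.1, h.2.1, M.isLinear₂_den hs h.1.1⟩, h.1.2, h.2.1, M.isLinear₂_den hp h.1.2⟩
    · exact ⟨⟨h.1.1, h.2.1⟩, h.1.2.1, h.1.2.2.add h.2.2.2⟩
    · exact M.dualMapHom_add (M.isLinear₂_den hs h.1.1) (M.isLinear₂_den hp h.1.2) _
  | dualMap_zero t ht =>
    exact of_eq (iff_of_true ⟨trivial, M.defd_of_wellTyped ht, IsLinear₂.zero⟩ trivial)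
      fun _ => M.dualMapHom_zero _

/-! ### Soundness of administrative reduction -/

theorem defd_letIn {Γ : List Ty} {σ τ : Ty} {e : Tm 𝓕 Γ σ} {s : Tm 𝓕 (σ :: Γ) τ} :
    M.Defd (Tm.letIn e s) ↔ M.Defd s ∧ M.Defd e := Iff.rfl

theorem den_letIn {Γ : List Ty} {σ τ : Ty} (e : Tm 𝓕 Γ σ) (s : Tm 𝓕 (σ :: Γ) τ) :
    M.den (Tm.letIn e s) = lift (𝟙 (M.ctx Γ)) (M.den e) ≫ M.den s := apply_lam _ _

theorem sound_of_letFlat {Γ : List Ty} {σ : Ty} {p q : Tm 𝓕 Γ σ} (h : Tm.LetFlat p q) :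
    M.Sound p q := by
  induction h with
  | refl p => exact Sound.refl M p
  | trans _ _ ih ih' => exact ih.trans ih'
  | frame K _ ih => exact ih.frame K
  | assoc E L N =>
    rintro ⟨hN, hL, hE⟩
    refine ⟨⟨⟨M.defd_wk₁.2 hN, hL⟩, hE⟩, ?_⟩
    simp [den_letIn, M.den_wk₁ (show M.Defd N from hN), comp_lift_assoc]
  | last E N =>
    rintro ⟨hN, -, hE⟩
    refine ⟨⟨hN, hE⟩, ?_⟩
    simp [den_letIn, den, proj]

theorem sound_of_aRule {Γ : List Ty} {σ : Ty} {p q : Tm 𝓕 Γ σ} (h : Tm.ARule p q) :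
    M.Sound p q := by
  intro hp
  cases h <;> simp only [Defd] at hp <;>
    simp [den_letIn, defd_letIn, Defd, den, proj, defd_wk, defd_wk₁, comp_lift_assoc,
      comp_add, comp_applyHom, den_wk, den_wk₁, comp_pbHom, *]
  -- Only the dual map is left: its body, weakened by the let-bound variable, must still be linear.
  refine ⟨isLinear₂_reindex hp.2.2 _, ?_⟩
  rw [M.comp_dualMapHom (isLinear₂_reindex hp.2.2 _)]
  simp [comp_lift_assoc]

theorem sound_of_aRed {Γ : List Ty} {σ : Ty} {p q : Tm 𝓕 Γ σ} (h : Tm.ARed p q) :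
    M.Sound p q := by
  induction h with
  | step h h' => exact (M.sound_of_aRule h).trans (M.sound_of_letFlat h')
  | frame K _ ih => exact ih.frame K
  | eqv h _ h' ih => exact ((M.sound_of_eqv h).1.trans ih).trans (M.sound_of_eqv h').1

end LangModel

/-! ## Soundness of reduction -/

namespace CartesianDifferentialCategory

variable {C : Type u} [Category.{v} C] [CartesianMonoidalCategory C]
  [CartesianDifferentialCategory C]

/-- The partial derivative `(γ, w) ↦ D[a ⟨γ, -⟩] ⟨w, v γ⟩` at the point `v`. -/
def pd {X A B : C} (a : X ⊗ A ⟶ B) (v : X ⟶ A) : X ⊗ A ⟶ B :=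
  dd a (lift 0 (snd X A)) (lift (fst X A) (fst X A ≫ v))

theorem isLinear₂_pd {X A B : C} (a : X ⊗ A ⟶ B) (v : X ⟶ A) : IsLinear₂ (pd a v) := by
  have := isLinear₂_dd a (𝟙 X) v
  rwa [Category.comp_id] at this

/-- Differentiating the identity that expresses linearity of `f` along the parameters yields a mixed
second derivative, whose two directions are exchanged by CD7. Differentiated dual maps are well
defined for this reason. -/
theorem IsLinear₂.dd_left {X Y A B : C} {f : X ⊗ A ⟶ B} (hf : IsLinear₂ f) (w x : Y ⟶ X) :
    IsLinear₂ (CartesianDifferentialCategory.dd f (lift (fst Y A ≫ w) 0)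
      (lift (fst Y A ≫ x) (snd Y A))) := by
  rw [isLinear₂_iff]
  intro Z y a c
  have h1 := congrArg (fun k => CartesianDifferentialCategory.dd k (lift 0 (y ≫ w))
    (lift (𝟙 Z) (y ≫ x))) (hf.dd (snd Z X) (fst Z X ≫ a) (fst Z X ≫ c))
  simp only [dd_dd, dd_lift, dd_zero, dd_snd, dd_comp, dd_fst, comp_dd, comp_lift, comp_zero,
    lift_fst, lift_snd, lift_fst_assoc, dd_dir_zero, lift_zero_zero,
    zero_add, Category.id_comp] at h1 ⊢
  rw [dd_D_swap, h1]

end CartesianDifferentialCategory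

namespace LangModel

variable {C : Type u} [Category.{v} C] [CartesianMonoidalCategory C] [MonoidalClosed C]
  [DifferentialLambdaCategory C] {𝓕 : FunSig} (M : LangModel 𝓕 C)

/-- At a fixed point a pullback is a dual map along a partial derivative, which is the shape of the
right-hand sides of the pullback rules. -/
theorem apply_pbHom {X A B : C} (a : X ⊗ A ⟶ B) (b : X ⟶ (ihom B).obj (M.dual B)) (v : X ⟶ A) :
    apply (M.pbHom a b) v = M.dualMapHom (pd a v) (apply b (lift (𝟙 X) v ≫ a)) := by
  refine M.dual_ext ?_
  rw [M.dualApply_dualMapHom (isLinear₂_pd a v), comp_applyHom, dualApply_pbHom, comp_applyHom]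
  simp [pd, comp_lift_assoc]

/-- Leibniz rule in the functional and the body; the second dual map is legitimate by
`IsLinear₂.dd_left`. -/
theorem dd_dualMapHom {X Y A B : C} {a : X ⊗ A ⟶ B} (ha : IsLinear₂ a) (b : X ⟶ M.dual B)
    (w x : Y ⟶ X) :
    dd (M.dualMapHom a b) w x =
      M.dualMapHom (lift (fst Y A ≫ x) (snd Y A) ≫ a) (dd b w x) +
      M.dualMapHom (dd a (lift (fst Y A ≫ w) 0) (lift (fst Y A ≫ x) (snd Y A))) (x ≫ b) := by
  refine M.dual_ext ?_
  rw [comp_dd, M.dualApply_dd_dualMapHom ha, comp_add, dualApply_add_left,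
    M.dualApply_dualMapHom (ha.dd_left w x), M.dualApply_dualMapHom (isLinear₂_reindex ha x)]
  simp [comp_dd]

/-- The chain rule for pullbacks. -/
theorem pbHom_comp {X A B E : C} (e : X ⊗ A ⟶ B) (l : (X ⊗ A) ⊗ B ⟶ E)
    (b : X ⟶ (ihom E).obj (M.dual E)) :
    M.pbHom (lift (snd X A) e)
      (M.pbHom (lift (lift (fst X (A ⊗ B)) (snd X (A ⊗ B) ≫ fst A B)) (snd X (A ⊗ B) ≫ snd A B) ≫ l)
        b) = M.pbHom (lift (𝟙 (X ⊗ A)) e ≫ l) b := by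
  refine M.form_ext ?_
  simp only [← Category.assoc, dualApply_pbHom]
  simp only [comp_lift, Category.assoc, lift_fst, lift_snd, dd_comp, dd_lift,
    dd_fst, dd_snd, lift_snd_assoc, dd_id, Category.comp_id]

/-! ### Projections and constants -/

/-- The denotation of an iterated projection. -/
def path : ∀ {σ τ : Ty}, Tm.Path σ τ → (M.ty σ ⟶ M.ty τ)
  | _, _, .nil => 𝟙 _
  | _, _, .fst π => path π ≫ fst _ _
  | _, _, .snd π => path π ≫ snd _ _

theorem isLinear_path {σ τ : Ty} (i : Tm.Path σ τ) : IsLinear (M.path i) := by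
  rw [isLinear_iff]
  intro X w x
  induction i with
  | nil => simp [path, dd_id]
  | fst π ih => simp [path, dd_comp, ih, dd_fst]
  | snd π ih => simp [path, dd_comp, ih, dd_snd]

theorem dd_path {σ τ : Ty} (i : Tm.Path σ τ) {X : C} (w x : X ⟶ M.ty σ) :
    dd (M.path i) w x = w ≫ M.path i := (M.isLinear_path i).dd w x

theorem defd_ap {σ τ : Ty} (i : Tm.Path σ τ) {Γ : List Ty} (s : Tm 𝓕 Γ σ) :
    M.Defd (i.ap s) ↔ M.Defd s := by
  induction i with
  | nil => simp only [Tm.Path.ap]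
  | fst π ih => simpa only [Tm.Path.ap, Defd] using ih
  | snd π ih => simpa only [Tm.Path.ap, Defd] using ih

theorem den_ap {σ τ : Ty} (i : Tm.Path σ τ) {Γ : List Ty} (s : Tm 𝓕 Γ σ) :
    M.den (i.ap s) = M.den s ≫ M.path i := by
  induction i with
  | nil => simp [Tm.Path.ap, path]
  | fst π ih => simp [Tm.Path.ap, path, den, ih]
  | snd π ih => simp [Tm.Path.ap, path, den, ih]

theorem den_of_comp {Γ : List Ty} {σ τ : Ty} {i : Tm.Path σ τ} {V : Tm 𝓕 Γ σ} {U : Tm 𝓕 Γ τ}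
    (h : Tm.Comp i V U) (hV : M.Defd V) : M.Defd U ∧ M.den U = M.den V ≫ M.path i := by
  induction h with
  | nil V => exact ⟨hV, by simp [path]⟩
  | fst _ ih =>
    obtain ⟨h1, h2⟩ := ih hV
    exact ⟨h1.1, by simp [path, ← Category.assoc, ← h2, den]⟩
  | snd _ ih =>
    obtain ⟨h1, h2⟩ := ih hV
    exact ⟨h1.2, by simp [path, ← Category.assoc, ← h2, den]⟩

theorem den_constVec {Γ : List Ty} : ∀ {n : ℕ} (r : Fin (n + 1) → ℝ),
    M.Defd (Tm.constVec r : Tm 𝓕 Γ _) ∧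
      M.den (Tm.constVec r : Tm 𝓕 Γ _) = toUnit (M.ctx Γ) ≫ tuplePt M.R M.dual M.pt r
  | 0, r => ⟨trivial, rfl⟩
  | n + 1, r => by
    obtain ⟨h1, h2⟩ := den_constVec (Γ := Γ) (Fin.init r)
    exact ⟨⟨h1, trivial⟩, by simp [Tm.constVec, den, h2, tuplePt, constHom]⟩

theorem tuplePt_dot : ∀ {n : ℕ} (r x : Fin (n + 1) → ℝ),
    tuplePt M.R M.dual M.pt x ≫ M.dot r = M.pt (∑ i, r i * x i)
  | 0, r, x => by simp [tuplePt, dot, M.pt_smul]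
  | n + 1, r, x => by
    simp [tuplePt, dot, comp_add, M.pt_smul, tuplePt_dot (Fin.init r) (Fin.init x),
      Fin.sum_univ_castSucc, Fin.init]

/-- The transposed matrix represents the adjoint, by expansion of `x` in the standard basis. -/
theorem sum_jacobianT {n m : ℕ} (f : 𝓕.Sym n m) (r x : Fin (n + 1) → ℝ) (r' : Fin (m + 1) → ℝ) :
    ∑ j, Tm.jacobianT f r r' j * x j = ∑ i, r' i * fderiv ℝ (𝓕.fn f) r x i := by
  have h : fderiv ℝ (𝓕.fn f) r x = ∑ j, x j • fderiv ℝ (𝓕.fn f) r (Pi.single j 1) := by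
    conv_lhs => rw [pi_eq_sum_univ' x]
    simp [map_sum, Pi.single]
  simp only [h, Tm.jacobianT, Tm.jacobian, Finset.sum_apply, Pi.smul_apply, smul_eq_mul,
    Finset.sum_mul, Finset.mul_sum]
  rw [Finset.sum_comm]
  exact Finset.sum_congr rfl fun i _ => Finset.sum_congr rfl fun j _ => by ring

/-- Morphisms from a power of `ℝ` to `ℝ` are determined by real vectors, where the claim is the
adjointness of the Jacobian and its transpose. -/
theorem D_fn_comp_dot {n m : ℕ} (f : 𝓕.Sym n m) (r : Fin (n + 1) → ℝ) (r' : Fin (m + 1) → ℝ) :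
    lift (𝟙 _) (toUnit _ ≫ tuplePt M.R M.dual M.pt r) ≫ D (M.fn f) ≫ M.dot r' =
      M.dot (Tm.jacobianT f r r') := by
  refine M.ext _ _ fun x => ?_
  have h : tuplePt M.R M.dual M.pt x ≫ lift (𝟙 _) (toUnit _ ≫ tuplePt M.R M.dual M.pt r) =
      lift (tuplePt M.R M.dual M.pt x) (tuplePt M.R M.dual M.pt r) := by
    simp
  rw [← Category.assoc, h, ← Category.assoc, M.pt_D_fn, tuplePt_dot, tuplePt_dot, sum_jacobianT]

/-! ### Pullback reductions -/

/-- Reduces a pullback rule to two equations independent of the form `W`. The outer dual map is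
automatically defined, as partial derivatives are linear in the direction. -/
theorem sound_pb {Γ : List Ty} {σ τ : Ty} {B : Tm 𝓕 (σ :: Γ) τ} {W : Tm 𝓕 Γ (Ty.form τ)}
    {V : Tm 𝓕 Γ σ} {S : Tm 𝓕 (σ :: Γ) τ} {V' : Tm 𝓕 Γ τ}
    (h : M.Defd B → M.Defd V → (M.Defd S ∧ M.den S = pd (M.den B) (M.den V)) ∧
      M.Defd V' ∧ M.den V' = lift (𝟙 (M.ctx Γ)) (M.den V) ≫ M.den B) :
    M.Sound (.app (.pb B W) V) (.dualMap S (.app W V')) := by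
  rintro ⟨⟨hB, hW⟩, hV⟩
  obtain ⟨⟨h1, h2⟩, h3, h4⟩ := h hB hV
  refine ⟨⟨h1, ⟨hW, h3⟩, h2 ▸ isLinear₂_pd _ _⟩, ?_⟩
  simp only [den, h2, h4]
  exact (M.apply_pbHom _ _ _).symm

/-- The constant 1-form given by a linear functional. -/
theorem exists_constForm {X A : C} {l : A ⟶ M.R} (hl : IsLinear l) :
    ∃ o : X ⟶ (ihom A).obj (M.dual A), ∀ (Z : C) (z : Z ⟶ X) (a w : Z ⟶ A),
      M.dualApply (apply (z ≫ o) a) w = w ≫ l := by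
  have h : IsLinear₂ (snd (X ⊗ A) A ≫ l) := by
    rw [isLinear₂_iff]
    intro Z x a w
    simp only [dd_comp, dd_snd, hl.dd, lift_snd, lift_snd_assoc]
  refine ⟨lam (M.dualLam (snd (X ⊗ A) A ≫ l)), fun Z z a w => ?_⟩
  rw [apply_comp_lam, M.dualApply_dualLam h, lift_snd_assoc]

variable {M} in
/-- Pulling back constant 1-forms determines a derivative, by Hahn-Banach separation. -/
theorem HahnBanach.eq_of_pbHom (hHB : M.HahnBanach) {X A B : C} {b : X ⊗ A ⟶ B} {v : X ⟶ A}
    {s : X ⊗ A ⟶ B}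
    (h : ∀ l : B ⟶ M.R, IsLinear l → ∀ o : X ⊗ A ⟶ (ihom B).obj (M.dual B),
      (∀ (Z : C) (z : Z ⟶ X ⊗ A) (a w : Z ⟶ B), M.dualApply (apply (z ≫ o) a) w = w ≫ l) →
      M.dualApply (lift (fst X A) o ≫ apply (M.pbHom (lift (fst (X ⊗ (ihom B).obj (M.dual B)) A ≫
        fst X _) (snd _ A) ≫ b) (snd X _)) (fst X _ ≫ v)) (snd X A) = s ≫ l) :
    s = pd b v := by
  by_contra hne
  obtain ⟨l, hl, hne⟩ := hHB _ _ hne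
  obtain ⟨o, ho⟩ := M.exists_constForm (X := X ⊗ A) hl
  apply hne
  have ho' := fun a w => ho _ (𝟙 _) a w
  simp only [Category.id_comp] at ho'
  -- The constant form stands for the 1-form variable. It ignores the base point, so pulling it back
  -- and pairing with the generic vector leaves `l` composed with the partial derivative.
  rw [← h l hl o ho, comp_applyHom, dualApply_pbHom]
  simp only [lift_snd, ho', dd_comp, dd_lift, dd_fst, dd_snd, lift_fst, lift_fst_assoc, comp_lift,
    dd_dir_zero]
  rfl

/-- Recovers the derivative from the premise of a conditional rule. The point `Q` is arbitrary
because constant forms do not depend on it. -/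
theorem den_of_probe_answer (hHB : M.HahnBanach) {Γ : List Ty} {σ τ : Ty} {B : Tm 𝓕 (σ :: Γ) τ}
    {V : Tm 𝓕 Γ σ} {S : Tm 𝓕 (σ :: Γ) τ} {Q : Tm 𝓕 (Ty.form τ :: Γ) τ}
    (h : M.Sound (Tm.probe B V) (Tm.answer S Q)) (hB : M.Defd B) (hV : M.Defd V) :
    M.Defd S ∧ M.den S = pd (M.den B) (M.den V) := by
  obtain ⟨⟨h1, ⟨-, h2⟩, h3⟩, h4⟩ := h ⟨⟨M.defd_wk₁.2 hB, trivial⟩, hV.wk _⟩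
  rw [defd_wk₁] at h1
  refine ⟨h1, hHB.eq_of_pbHom fun l hl o ho => ?_⟩
  have ho' := fun a w => ho _ (𝟙 _) a w
  simp only [Category.id_comp] at ho'
  simp only [Tm.probe, Tm.answer, den, M.den_wk₁ hB, M.den_wk hV, proj] at h4
  rw [← h4, M.dualApply_dualMapHom h3, comp_applyHom, lift_snd, ho', M.den_wk₁ h1]
  simp [comp_lift_assoc]

theorem pd_eq_zero_of_probe (hHB : M.HahnBanach) {Γ : List Ty} {σ τ : Ty} {B : Tm 𝓕 (σ :: Γ) τ}
    {V : Tm 𝓕 Γ σ} (h : M.Sound (Tm.probe B V) .zero) (hB : M.Defd B) (hV : M.Defd V) :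
    pd (M.den B) (M.den V) = 0 := by
  obtain ⟨-, h4⟩ := h ⟨⟨M.defd_wk₁.2 hB, trivial⟩, hV.wk _⟩
  refine (hHB.eq_of_pbHom fun l hl o ho => ?_).symm
  simp only [Tm.probe, den, M.den_wk₁ hB, M.den_wk hV, proj] at h4
  rw [← h4, comp_zero, dualApply_zero_left, hl.zero_comp]

/-- For a body below a further binder, the exchange makes `y` the variable of differentiation and
keeps the bound variable as a parameter. The result has the form produced by `dd_lam` and
`dd_dualMapHom`. -/
theorem den_swap_of_probe_answer (hHB : M.HahnBanach) {Γ : List Ty} {σ α τ : Ty}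
    {L : Tm 𝓕 (α :: σ :: Γ) τ} {V : Tm 𝓕 Γ σ} {S : Tm 𝓕 (σ :: α :: Γ) τ}
    {Q : Tm 𝓕 (Ty.form τ :: α :: Γ) τ}
    (h : M.Sound (Tm.probe (Tm.swap L) (Tm.wk α V)) (Tm.answer S Q)) (hL : M.Defd L)
    (hV : M.Defd V) :
    M.Defd (Tm.swap S) ∧ M.den (Tm.swap S) =
      dd (M.den L) (lift (fst _ (M.ty α) ≫ lift 0 (snd (M.ctx Γ) (M.ty σ))) 0)
        (lift (fst _ (M.ty α) ≫ lift (fst _ _) (fst _ _ ≫ M.den V)) (snd _ _)) := by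
  obtain ⟨h1, h2⟩ := M.defd_swap_and hL
  obtain ⟨h3, h4⟩ := M.den_of_probe_answer hHB h h1 (hV.wk α)
  obtain ⟨h5, h6⟩ := M.defd_swap_and h3
  refine ⟨h5, ?_⟩
  rw [h6, h4, h2, M.den_wk hV]
  simp only [pd, comp_dd, dd_comp, dd_lift, dd_fst, dd_snd, lift_fst, lift_snd, lift_fst_assoc,
    comp_lift, Category.assoc, comp_zero, dd_dir_zero]

end LangModel

-- Soundness of the individual rules.

namespace LangModel

variable {C : Type u} [Category.{v} C] [CartesianMonoidalCategory C] [MonoidalClosed C]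
  [DifferentialLambdaCategory C] {𝓕 : FunSig} (M : LangModel 𝓕 C)

theorem sound_beta {Γ : List Ty} {σ τ : Ty} (S : Tm 𝓕 (σ :: Γ) τ) (V : Tm 𝓕 Γ σ) :
    M.Sound (.app (.lam S) V) (S.inst V) := by
  rintro ⟨hS, hV⟩
  obtain ⟨h1, h2⟩ := M.defd_inst_and hS hV
  exact ⟨h1, h2.trans (M.den_letIn V S).symm⟩

theorem sound_fn_constVec {Γ : List Ty} {n m : ℕ} (f : 𝓕.Sym n m) (r : Fin (n + 1) → ℝ) :
    M.Sound (.fn f (.constVec r) : Tm 𝓕 Γ _) (.constVec (𝓕.fn f r)) := by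
  refine fun _ => ⟨(M.den_constVec _).1, ?_⟩
  rw [(M.den_constVec _).2, den, (M.den_constVec _).2, Category.assoc, M.pt_fn]

theorem sound_jac_constVec {Γ : List Ty} {n m : ℕ} (f : 𝓕.Sym n m) (r r' : Fin (n + 1) → ℝ) :
    M.Sound (.app (.jac f (.constVec r)) (.constVec r') : Tm 𝓕 Γ _)
      (.constVec (Tm.jacobian f r' r)) := by
  refine fun _ => ⟨(M.den_constVec _).1, ?_⟩
  rw [(M.den_constVec _).2, den, den, (M.den_constVec _).2, (M.den_constVec _).2, apply_comp_lam,
    ← comp_lift_assoc, M.pt_D_fn]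
  rfl

theorem sound_dualMap_jac_dconst {Γ : List Ty} {n m : ℕ} (f : 𝓕.Sym n m) (r : Fin (n + 1) → ℝ)
    (r' : Fin (m + 1) → ℝ) :
    M.Sound (.dualMap (.app (.jac f .v0) (.constVec r)) (.dconst r') : Tm 𝓕 Γ _)
      (.dconst (Tm.jacobianT f r r')) := by
  rintro ⟨-, -, hl⟩
  refine ⟨trivial, ?_⟩
  simp only [den, (M.den_constVec _).2, proj, apply_comp_lam] at hl ⊢
  symm
  rw [← M.dualLam_eq_iff (M.isLinear₂_snd_dot _ _), M.dualApply_dualMapHom hl,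
    M.dualApply_dualLam (M.isLinear₂_snd_dot _ _), ← D_fn_comp_dot]
  simp [comp_lift_assoc]

/-- Contravariant functoriality of dual maps; a composite of linear families is linear. -/
theorem sound_dualMap_dualMap {Γ : List Ty} {σ₁ σ₂ τ : Ty} (V₁ : Tm 𝓕 (σ₁ :: Γ) σ₂) (V₂ : Tm 𝓕 (σ₂ :: Γ) τ)
    (V₃ : Tm 𝓕 Γ (Ty.dual τ)) :
    M.Sound (.dualMap V₁ (.dualMap V₂ V₃)) (.dualMap ((Tm.wk₁ σ₁ V₂).inst V₁) V₃) := by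
  rintro ⟨h1, ⟨h2, h3, l2⟩, l1⟩
  obtain ⟨h4, e4⟩ := M.defd_inst_and (M.defd_wk₁.2 h2) h1
  rw [M.den_wk₁ h2, comp_lift_assoc] at e4
  simp only [lift_fst_assoc, lift_snd, Category.id_comp] at e4
  have l4 : IsLinear₂ (M.den ((Tm.wk₁ σ₁ V₂).inst V₁)) := by
    rw [e4, isLinear₂_iff]
    intro Z x a w
    simp only [dd_comp, dd_lift, dd_fst, lift_fst, comp_lift_assoc, comp_lift, l1.dd, l2.dd]
  refine ⟨⟨h4, h3, l4⟩, M.dual_ext ?_⟩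
  simp only [den, M.dualApply_dualMapHom l1, M.dualApply_dualMapHom l2, M.dualApply_dualMapHom l4]
  rw [e4]
  simp

theorem sound_pb_letIn_v0 {Γ : List Ty} {σ τ : Ty} (E : Tm 𝓕 (σ :: Γ) τ) (W : Tm 𝓕 Γ (Ty.form τ)) :
    M.Sound (.pb (.letIn E .v0) W) (.pb E W) := by
  rintro ⟨⟨-, hE⟩, hW⟩
  refine ⟨⟨hE, hW⟩, ?_⟩
  simp [den, den_letIn, proj]

theorem sound_pb_letIn {Γ : List Ty} {σ α τ : Ty} (E : Tm 𝓕 (σ :: Γ) α) (L : Tm 𝓕 (α :: σ :: Γ) τ)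
    (W : Tm 𝓕 Γ (Ty.form τ)) :
    M.Sound (.pb (.letIn E L) W) (.pb (.pair .v0 E) (.pb (.unpair L) W)) := by
  rintro ⟨⟨hL, hE⟩, hW⟩
  obtain ⟨h1, h2⟩ := M.defd_unpair_and hL
  refine ⟨⟨⟨trivial, hE⟩, h1, hW⟩, ?_⟩
  simp only [den, den_letIn, h2]
  exact M.pbHom_comp _ _ _

theorem sound_pb_wk {Γ : List Ty} {σ τ : Ty} (E : Tm 𝓕 Γ τ) (W : Tm 𝓕 Γ (Ty.form τ)) (V : Tm 𝓕 Γ σ) :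
    M.Sound (.app (.pb (.wk σ E) W) V) .zero := by
  rintro ⟨⟨hE, hW⟩, hV⟩
  rw [defd_wk] at hE
  refine ⟨trivial, ?_⟩
  simp only [den, M.den_wk hE, apply_pbHom, pd, dd_comp, dd_fst, lift_fst, dd_dir_zero,
    dualMapHom_zero]

theorem sound_pb_jac {Γ : List Ty} {σ : Ty} {n m : ℕ} (f : 𝓕.Sym n m) (i : Tm.Path σ (Ty.pow n))
    (W : Tm 𝓕 Γ (Ty.form (Ty.arrow (Ty.pow n) (Ty.pow m)))) (V : Tm 𝓕 Γ σ) :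
    M.Sound (.app (.pb (.jac f (i.ap .v0)) W) V)
      (.dualMap (.jac f (i.ap .v0)) (.app W (.jac f (i.ap V)))) := by
  refine M.sound_pb fun hB hV => ⟨⟨hB, ?_⟩, (M.defd_ap i V).2 hV, ?_⟩
  · simp only [den, den_ap, proj, pd, dd_comp, dd_snd, dd_path, dd_lam_D, lift_snd,
      Category.assoc]
  · simp only [den, den_ap, proj, lift_snd_assoc, Category.assoc]

theorem sound_pb_fn {Γ : List Ty} {σ : Ty} {n m : ℕ} (f : 𝓕.Sym n m) (i : Tm.Path σ (Ty.pow n))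
    (W : Tm 𝓕 Γ (Ty.form (Ty.pow m))) (V : Tm 𝓕 Γ σ) :
    M.Sound (.app (.pb (.fn f (i.ap .v0)) W) V)
      (.dualMap (.app (.jac f (i.ap .v0)) (.wk σ (i.ap V))) (.app W (.fn f (i.ap V)))) := by
  refine M.sound_pb fun hB hV => ?_
  have hi := (M.defd_ap i V).2 hV
  refine ⟨⟨⟨hB, hi.wk _⟩, ?_⟩, hi, ?_⟩
  · simp only [den, M.den_wk hi, den_ap, proj, pd, dd_comp, dd_snd, dd_path, lift_snd,
      Category.assoc]
    rw [← Category.assoc (snd _ _), apply_comp_lam]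
    rfl
  · simp only [den, den_ap, proj, lift_snd_assoc, Category.assoc]

theorem sound_pb_dualMap_wk₁ {Γ : List Ty} {σ α τ : Ty} (L : Tm 𝓕 (α :: Γ) τ) (i : Tm.Path σ (Ty.dual τ))
    (W : Tm 𝓕 Γ (Ty.form (Ty.dual α))) (V : Tm 𝓕 Γ σ) :
    M.Sound (.app (.pb (.dualMap (.wk₁ σ L) (i.ap .v0)) W) V)
      (.dualMap (.dualMap (.wk₁ σ L) (i.ap .v0)) (.app W (.dualMap L (i.ap V)))) := by
  refine M.sound_pb fun hB hV => ?_
  obtain ⟨h1, h2, hl⟩ := hB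
  have hi := (M.defd_ap i V).2 hV
  have hL := M.defd_wk₁.1 h1
  -- Putting `0` for the fresh variable recovers linearity of `L` from that of its weakening.
  have hl' : IsLinear₂ (M.den L) := by
    have := isLinear₂_reindex hl (lift (𝟙 _) 0)
    rw [M.den_wk₁ hL] at this
    simpa [comp_lift_assoc] using this
  refine ⟨⟨⟨h1, h2, hl⟩, ?_⟩, ⟨hL, hi, hl'⟩, ?_⟩
  -- The body does not depend on `y`, so only the functional contributes to the Leibniz rule.
  · have h0 : dd (M.den (Tm.wk₁ σ L)) (lift (fst _ (M.ty α) ≫ lift 0 (snd (M.ctx Γ) (M.ty σ))) 0)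
        (lift (fst _ (M.ty α) ≫ lift (fst _ _) (fst _ _ ≫ M.den V)) (snd _ _)) = 0 := by
      simp only [M.den_wk₁ hL, dd_comp, dd_lift, dd_fst, dd_snd, lift_fst, lift_snd,
        Category.assoc, comp_zero, dd_dir_lift_zero]
    simp only [den, pd]
    rw [M.dd_dualMapHom hl, h0, dualMapHom_zero, add_zero]
    simp only [den, den_ap, proj, dd_comp, dd_path, dd_snd, lift_snd, M.den_wk₁ hL]
    simp [comp_lift_assoc]
  · simp only [den, den_ap, proj]
    rw [M.comp_dualMapHom hl, M.den_wk₁ hL]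
    simp [comp_lift_assoc]

/-- Here the functional is constant in `y` and only the derivative of the body contributes; in
`sound_pb_dualMap_path` both summands survive. -/
theorem sound_pb_dualMap_wk (hHB : M.HahnBanach) {Γ : List Ty} {σ α τ : Ty} (L : Tm 𝓕 (α :: σ :: Γ) τ)
    (z : Tm 𝓕 Γ (Ty.dual τ)) (W : Tm 𝓕 Γ (Ty.form (Ty.dual α))) (V : Tm 𝓕 Γ σ)
    (S : Tm 𝓕 (σ :: α :: Γ) τ) (V' : Tm 𝓕 (Ty.form τ :: α :: Γ) τ)
    (h : M.Sound (.probe (.swap L) (.wk α V)) (.answer S V')) :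
    M.Sound (.app (.pb (.dualMap L (.wk σ z)) W) V)
      (.dualMap (.dualMap (.swap S) (.wk σ z)) (.app W (.dualMap (.inst₁ L V) z))) := by
  refine M.sound_pb fun hB hV => ?_
  obtain ⟨h1, h2, hl⟩ := hB
  have hz := M.defd_wk.1 h2
  obtain ⟨h3, h4⟩ := M.den_swap_of_probe_answer hHB h h1 hV
  obtain ⟨h5, h6⟩ := M.defd_inst₁_and h1 hV
  have e : (lift (lift (fst (M.ctx Γ) (M.ty α)) (fst _ _ ≫ M.den V)) (snd _ _)) =
    lift (fst (M.ctx Γ) (M.ty α) ≫ lift (𝟙 _) (M.den V)) (snd _ _) := by simp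
  rw [e] at h6
  refine ⟨⟨⟨h3, h2, h4 ▸ hl.dd_left _ _⟩, ?_⟩, ⟨h5, hz, h6 ▸ isLinear₂_reindex hl _⟩, ?_⟩
  · simp only [den, pd]
    rw [M.dd_dualMapHom hl, h4, M.den_wk hz]
    simp only [dd_comp, dd_fst, lift_fst, dd_dir_zero, lift_fst_assoc]
    rw [M.dualMapHom_zero_right (isLinear₂_reindex hl _), zero_add]
  · simp only [den]
    rw [M.comp_dualMapHom hl, h6, M.den_wk hz, lift_fst_assoc, Category.id_comp]

theorem sound_pb_dualMap_path (hHB : M.HahnBanach) {Γ : List Ty} {σ α τ : Ty} (L : Tm 𝓕 (α :: σ :: Γ) τ)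
    (i : Tm.Path σ (Ty.dual τ)) (W : Tm 𝓕 Γ (Ty.form (Ty.dual α))) (V : Tm 𝓕 Γ σ)
    (S : Tm 𝓕 (σ :: α :: Γ) τ) (V' : Tm 𝓕 (Ty.form τ :: α :: Γ) τ)
    (h : M.Sound (.probe (.swap L) (.wk α V)) (.answer S V')) :
    M.Sound (.app (.pb (.dualMap L (i.ap .v0)) W) V)
      (.dualMap (.add (.dualMap (.wk₁ σ (.inst₁ L V)) (i.ap .v0))
          (.dualMap (.swap S) (.wk σ (i.ap V))))
        (.app W (.dualMap (.inst₁ L V) (i.ap V)))) := by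
  refine M.sound_pb fun hB hV => ?_
  obtain ⟨h1, h2, hl⟩ := hB
  have hi := (M.defd_ap i V).2 hV
  obtain ⟨h3, h4⟩ := M.den_swap_of_probe_answer hHB h h1 hV
  obtain ⟨h5, h6⟩ := M.defd_inst₁_and h1 hV
  have e : (lift (lift (fst (M.ctx Γ) (M.ty α)) (fst _ _ ≫ M.den V)) (snd _ _)) =
    lift (fst (M.ctx Γ) (M.ty α) ≫ lift (𝟙 _) (M.den V)) (snd _ _) := by simp
  rw [e] at h6
  have hl6 : IsLinear₂ (M.den (.inst₁ L V)) := h6 ▸ isLinear₂_reindex hl _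
  have h7 := M.den_wk₁ (τ := σ) h5
  refine ⟨⟨⟨⟨M.defd_wk₁.2 h5, h2, h7 ▸ isLinear₂_reindex hl6 _⟩, h3, hi.wk _,
    h4 ▸ hl.dd_left _ _⟩, ?_⟩, ⟨h5, hi, hl6⟩, ?_⟩
  · simp only [den, pd]
    rw [M.dd_dualMapHom hl, h4, M.den_wk hi, h7, h6]
    simp only [den, den_ap, proj, dd_comp, dd_path, dd_snd, lift_snd, lift_snd_assoc]
    simp [comp_lift_assoc]
  · simp only [den]
    rw [M.comp_dualMapHom hl, h6]
    simp only [den, den_ap, proj, lift_snd_assoc]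

/-- No differentiation is needed: by η the inner pullback is an abstraction over its point, and the
premise is applied inside that abstraction. -/
theorem sound_pb_pb {Γ : List Ty} {σ σx τ : Ty} (L : Tm 𝓕 (σx :: σ :: Γ) τ)
    (z : Tm 𝓕 (σ :: Γ) (Ty.form τ)) (W : Tm 𝓕 Γ (Ty.form (Ty.form σx))) (V : Tm 𝓕 Γ σ)
    (S : Tm 𝓕 (σx :: σx :: σ :: Γ) τ)
    (h : M.Sound (.app (.pb (.wk₁ σx L) (.wk σx z)) .v0) (.dualMap S (.app (.wk σx z) L))) :
    M.Sound (.app (.pb (.pb L z) W) V)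
      (.app (.pb (.lam (.dualMap S (.app (.wk σx z) L))) W) V) := by
  have h1 : M.Sound (.pb L z) (.lam (.app (.pb (.wk₁ σx L) (.wk σx z)) .v0)) := by
    rintro ⟨hL, hz⟩
    refine ⟨⟨⟨M.defd_wk₁.2 hL, hz.wk _⟩, trivial⟩, ?_⟩
    simp only [den, M.den_wk₁ hL, M.den_wk hz, proj]
    rw [← comp_pbHom, lam_apply]
  exact ((h1.trans (h.frame .lam)).frame (.pbL W)).frame (.appL V)

theorem sound_pb_lam (hHB : M.HahnBanach) {Γ : List Ty} {σ α τ : Ty} (L : Tm 𝓕 (α :: σ :: Γ) τ)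
    (W : Tm 𝓕 Γ (Ty.form (Ty.arrow α τ))) (V : Tm 𝓕 Γ σ) (S : Tm 𝓕 (σ :: α :: Γ) τ)
    (Q : Tm 𝓕 (Ty.form τ :: α :: Γ) τ)
    (h : M.Sound (.probe (.swap L) (.wk α V)) (.answer S Q)) :
    M.Sound (.app (.pb (.lam L) W) V)
      (.dualMap (.lam (.swap S)) (.app W (.lam (.inst₁ L V)))) := by
  refine M.sound_pb fun hB hV => ?_
  obtain ⟨h3, h4⟩ := M.den_swap_of_probe_answer hHB h hB hV
  obtain ⟨h5, h6⟩ := M.defd_inst₁_and hB hV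
  refine ⟨⟨h3, ?_⟩, h5, ?_⟩
  · simp only [den, pd]
    rw [dd_lam, h4]
  · simp only [den]
    rw [comp_lam, h6]
    simp

theorem sound_pb_app_wk {Γ : List Ty} {σ α τ : Ty} (i : Tm.Path σ (Ty.arrow α τ)) (z : Tm 𝓕 Γ α)
    (W : Tm 𝓕 Γ (Ty.form τ)) (V : Tm 𝓕 Γ σ) :
    M.Sound (.app (.pb (.app (i.ap .v0) (.wk σ z)) W) V)
      (.dualMap (.app (i.ap .v0) (.wk σ z)) (.app W (.app (i.ap V) z))) := by
  refine M.sound_pb fun hB hV => ?_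
  have hz := M.defd_wk.1 hB.2
  refine ⟨⟨hB, ?_⟩, ⟨(M.defd_ap i V).2 hV, hz⟩, ?_⟩
  · simp only [den, M.den_wk hz, den_ap, proj, pd, dd_apply, dd_comp, dd_snd, dd_fst, dd_path,
      lift_snd, lift_snd_assoc, lift_fst, lift_fst_assoc, dd_dir_zero, dd_dir_lift_zero, add_zero]
  · simp only [den, M.den_wk hz, den_ap, proj, comp_applyHom, lift_snd_assoc, lift_fst_assoc,
      Category.id_comp]

/-- Evaluation is linear in the function, and its derivative in the argument is that of the body
`P`, since the selected component of `V` is the abstraction of `P`. -/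
theorem pd_apply_path {Γ : List Ty} {σ α τ : Ty} (i : Tm.Path σ (Ty.arrow α τ))
    (j : Tm.Path σ α) {V : Tm 𝓕 Γ σ} {P : Tm 𝓕 (α :: Γ) τ}
    (hP : lam (M.den P) = M.den V ≫ M.path i) :
    pd (M.den (.app (i.ap .v0) (j.ap .v0) : Tm 𝓕 (σ :: Γ) τ)) (M.den V) =
      apply (snd (M.ctx Γ) (M.ty σ) ≫ M.path i) (fst _ _ ≫ M.den V ≫ M.path j) +
      lift (fst _ _) (snd _ _ ≫ M.path j) ≫ pd (M.den P) (M.den V ≫ M.path j) := by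
  simp only [den, den_ap, proj, pd, dd_apply, dd_comp, dd_snd, dd_path, lift_snd, lift_snd_assoc,
    Category.assoc]
  rw [← hP, dd_ev_lam, comp_dd]
  simp [comp_zero]

theorem sound_pb_app_path (hHB : M.HahnBanach) {Γ : List Ty} {σ α τ : Ty}
    (i : Tm.Path σ (Ty.arrow α τ)) (j : Tm.Path σ α)
    (W : Tm 𝓕 Γ (Ty.form τ)) (V : Tm 𝓕 Γ σ) (P' S' : Tm 𝓕 (α :: Γ) τ)
    (Q : Tm 𝓕 (Ty.form τ :: Γ) τ) (hc : Tm.Comp i V (.lam P'))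
    (h : M.Sound (.probe P' (j.ap V)) (.answer S' Q)) :
    M.Sound (.app (.pb (.app (i.ap .v0) (j.ap .v0)) W) V)
      (.dualMap (.add (.app (i.ap .v0) (.wk σ (j.ap V))) ((Tm.wk₁ σ S').inst (j.ap .v0)))
        (.app W (.app (i.ap V) (j.ap V)))) := by
  refine M.sound_pb fun hB hV => ?_
  have hj := (M.defd_ap j V).2 hV
  obtain ⟨h1, h2⟩ := M.den_of_comp hc hV
  obtain ⟨h3, h4⟩ := M.den_of_probe_answer hHB h h1 hj
  obtain ⟨h5, h6⟩ := M.defd_inst_and (M.defd_wk₁.2 h3) hB.2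
  refine ⟨⟨⟨⟨hB.1, hj.wk _⟩, h5⟩, ?_⟩, ⟨(M.defd_ap i V).2 hV, hj⟩, ?_⟩
  · rw [M.pd_apply_path i j h2]
    simp only [den, h6, M.den_wk₁ h3, M.den_wk hj, h4, den_ap, proj]
    simp [comp_lift_assoc]
  · simp only [den, den_ap, proj, comp_applyHom, lift_snd_assoc]

theorem sound_pb_app_path_of_zero (hHB : M.HahnBanach) {Γ : List Ty} {σ α τ : Ty}
    (i : Tm.Path σ (Ty.arrow α τ)) (j : Tm.Path σ α)
    (W : Tm 𝓕 Γ (Ty.form τ)) (V : Tm 𝓕 Γ σ) (V' : Tm 𝓕 (α :: Γ) τ)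
    (hc : Tm.Comp i V (.lam V')) (h : M.Sound (.probe V' (j.ap V)) .zero) :
    M.Sound (.app (.pb (.app (i.ap .v0) (j.ap .v0)) W) V)
      (.dualMap (.app (i.ap .v0) (.wk σ (j.ap V))) (.app W (.app (i.ap V) (j.ap V)))) := by
  refine M.sound_pb fun hB hV => ?_
  have hj := (M.defd_ap j V).2 hV
  obtain ⟨h1, h2⟩ := M.den_of_comp hc hV
  have h4 := M.pd_eq_zero_of_probe hHB h h1 hj
  refine ⟨⟨⟨hB.1, hj.wk _⟩, ?_⟩, ⟨(M.defd_ap i V).2 hV, hj⟩, ?_⟩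
  · rw [M.pd_apply_path i j h2, ← den_ap, h4, comp_zero, add_zero]
    simp only [den, M.den_wk hj, den_ap, proj]
  · simp only [den, den_ap, proj, comp_applyHom, lift_snd_assoc]

theorem sound_pb_pair_v0 (hHB : M.HahnBanach) {Γ : List Ty} {σ τ : Ty} (E : Tm 𝓕 (σ :: Γ) τ)
    (W : Tm 𝓕 Γ (Ty.form (Ty.prod σ τ))) (V : Tm 𝓕 Γ σ) (S : Tm 𝓕 (σ :: Γ) τ)
    (Q : Tm 𝓕 (Ty.form τ :: Γ) τ) (h : M.Sound (.probe E V) (.answer S Q)) :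
    M.Sound (.app (.pb (.pair .v0 E) W) V)
      (.dualMap (.pair .v0 S) (.app W (.pair V (E.inst V)))) := by
  refine M.sound_pb fun hB hV => ?_
  obtain ⟨h3, h4⟩ := M.den_of_probe_answer hHB h hB.2 hV
  obtain ⟨h5, h6⟩ := M.defd_inst_and hB.2 hV
  refine ⟨⟨⟨trivial, h3⟩, ?_⟩, ⟨hV, h5⟩, ?_⟩
  · simp only [den, h4, proj, pd, dd_lift, dd_snd, lift_snd]
  · simp only [den, h6, proj, comp_lift, lift_snd]

-- Mutual induction over one-step and many-step reduction.

mutual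

theorem sound_of_red (hHB : M.HahnBanach) : ∀ {Γ : List Ty} {σ : Ty} {p q : Tm 𝓕 Γ σ},
    Tm.Red p q → M.Sound p q
  | _, _, _, _, .frame K h => (sound_of_red hHB h).frame K
  | _, _, _, _, .eqv h h' h'' =>
    ((M.sound_of_eqv h).1.trans (sound_of_red hHB h')).trans (M.sound_of_eqv h'').1
  | _, _, _, _, .adm h => M.sound_of_aRed h
  | _, _, _, _, .inst V hp hV h => fun _ => by
    -- Definedness of the instance need not give that of `V`, for instance when the variable does
    -- not occur; well-typedness does.
    have hp := M.defd_of_wellTyped hp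
    have hV := M.defd_of_wellTyped hV
    obtain ⟨h1, h2⟩ := sound_of_red hHB h hp
    obtain ⟨h3, h4⟩ := M.defd_inst_and h1 hV
    exact ⟨h3, by rw [h4, h2, (M.defd_inst_and hp hV).2]⟩
  | _, _, _, _, .r1 S V => M.sound_beta S V
  | _, _, _, _, .r2_fst V₁ V₂ => fun h => ⟨h.1, (lift_fst _ _).symm⟩
  | _, _, _, _, .r2_snd V₁ V₂ => fun h => ⟨h.2, (lift_snd _ _).symm⟩
  | _, _, _, _, .r3 f r => M.sound_fn_constVec f r
  | _, _, _, _, .r4 f r r' => M.sound_jac_constVec f r r'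
  | _, _, _, _, .r5 f r r' => M.sound_dualMap_jac_dconst f r r'
  | _, _, _, _, .r6 V₁ V₂ V₃ => M.sound_dualMap_dualMap V₁ V₂ V₃
  | _, _, _, _, .r7 E W => M.sound_pb_letIn_v0 E W
  | _, _, _, _, .r8 E L W => M.sound_pb_letIn E L W
  | _, _, _, _, .r9 E W V => M.sound_pb_wk E W V
  | _, _, _, _, .r10a j z W V => M.sound_pb fun hB hV => by
    have hz := M.defd_wk.1 hB.1
    refine ⟨⟨hB.2, ?_⟩, ⟨hz, (M.defd_ap j V).2 hV⟩, ?_⟩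
    · simp only [den, M.den_wk hz, den_ap, proj, pd, dd_add, dd_comp, dd_snd, dd_fst, dd_path,
        lift_snd, lift_fst, dd_dir_zero, zero_add]
    · simp only [den, M.den_wk hz, den_ap, proj, comp_add, lift_snd_assoc, lift_fst_assoc,
        Category.id_comp]
  | _, _, _, _, .r10b i j W V => M.sound_pb fun hB hV => by
    refine ⟨⟨hB, ?_⟩, ⟨(M.defd_ap i V).2 hV, (M.defd_ap j V).2 hV⟩, ?_⟩
    · simp only [den, den_ap, proj, pd, dd_add, dd_comp, dd_snd, dd_path, lift_snd]
    · simp only [den, den_ap, proj, comp_add, lift_snd_assoc]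
  | _, _, _, _, .r11 W V => M.sound_pb fun hB hV => by
    refine ⟨⟨hB, ?_⟩, hV, ?_⟩
    · simp only [den, proj, pd, dd_snd, lift_snd]
    · simp only [den, proj, lift_snd]
  | _, _, _, _, .r12 i W V => M.sound_pb fun hB hV => by
    refine ⟨⟨hB, ?_⟩, (M.defd_ap i V).2 hV, ?_⟩
    · simp only [den, den_ap, proj, pd, dd_comp, dd_snd, dd_path, lift_snd]
    · simp only [den, den_ap, proj, lift_snd_assoc]
  | _, _, _, _, .r13a i z W V => M.sound_pb fun hB hV => by
    have hz := M.defd_wk.1 hB.2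
    refine ⟨⟨⟨hB.1, trivial⟩, ?_⟩, ⟨(M.defd_ap i V).2 hV, hz⟩, ?_⟩
    · simp only [den, M.den_wk hz, den_ap, proj, pd, dd_lift, dd_comp, dd_snd, dd_fst, dd_path,
        lift_snd, lift_fst, dd_dir_zero]
    · simp only [den, M.den_wk hz, den_ap, proj, comp_lift, lift_snd_assoc, lift_fst_assoc,
        Category.id_comp]
  | _, _, _, _, .r13b j z W V => M.sound_pb fun hB hV => by
    have hz := M.defd_wk.1 hB.1
    refine ⟨⟨⟨trivial, hB.2⟩, ?_⟩, ⟨hz, (M.defd_ap j V).2 hV⟩, ?_⟩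
    · simp only [den, M.den_wk hz, den_ap, proj, pd, dd_lift, dd_comp, dd_snd, dd_fst, dd_path,
        lift_snd, lift_fst, dd_dir_zero]
    · simp only [den, M.den_wk hz, den_ap, proj, comp_lift, lift_snd_assoc, lift_fst_assoc,
        Category.id_comp]
  | _, _, _, _, .r13c i j W V => M.sound_pb fun hB hV => by
    refine ⟨⟨hB, ?_⟩, ⟨(M.defd_ap i V).2 hV, (M.defd_ap j V).2 hV⟩, ?_⟩
    · simp only [den, den_ap, proj, pd, dd_lift, dd_comp, dd_snd, dd_path, lift_snd]
    · simp only [den, den_ap, proj, comp_lift, lift_snd_assoc]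
  | _, _, _, _, .r14 f i W V => M.sound_pb_jac f i W V
  | _, _, _, _, .r15 f i W V => M.sound_pb_fn f i W V
  | _, _, _, _, .r16a L i W V => M.sound_pb_dualMap_wk₁ L i W V
  | _, _, _, _, .r16b L z W V S V' h =>
    M.sound_pb_dualMap_wk hHB L z W V S V' (sound_of_redStar hHB h)
  | _, _, _, _, .r16c L i W V S V' h =>
    M.sound_pb_dualMap_path hHB L i W V S V' (sound_of_redStar hHB h)
  | _, _, _, _, .r17 L z W V S h => M.sound_pb_pb L z W V S (sound_of_redStar hHB h)
  | _, _, _, _, .r18 L W V S h => M.sound_pb_lam hHB L W V S _ (sound_of_redStar hHB h)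
  | _, _, _, _, .r19a i z W V => M.sound_pb_app_wk i z W V
  | _, _, _, _, .r19b i j W V P' S' hc h =>
    M.sound_pb_app_path hHB i j W V P' S' _ hc (sound_of_redStar hHB h)
  | _, _, _, _, .r19c i j W V V' hc h =>
    M.sound_pb_app_path_of_zero hHB i j W V V' hc (sound_of_redStar hHB h)
  | _, _, _, _, .r20a E W V S h _ => M.sound_pb_pair_v0 hHB E W V S _ (sound_of_redStar hHB h)
  | _, _, _, _, .r20b E W V => M.sound_pb fun hB hV => by
    have hE := M.defd_wk.1 hB.2
    refine ⟨⟨⟨trivial, trivial⟩, ?_⟩, ⟨hV, hE⟩, ?_⟩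
    · simp only [den, M.den_wk hE, proj, pd, dd_lift, dd_comp, dd_snd, dd_fst, lift_snd, lift_fst,
        dd_dir_zero]
    · simp only [den, M.den_wk hE, proj, comp_lift, lift_snd, lift_fst_assoc, Category.id_comp]

theorem sound_of_redStar (hHB : M.HahnBanach) : ∀ {Γ : List Ty} {σ : Ty} {p q : Tm 𝓕 Γ σ},
    Tm.RedStar p q → M.Sound p q
  | _, _, _, _, .eqv h => (M.sound_of_eqv h).1
  | _, _, _, _, .tail h h' => (sound_of_redStar hHB h).trans (sound_of_red hHB h')

end

end LangModel

-- The theorem, restated from `Sound` to `Den`.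

theorem mainTheorem1 {C : Type u} [Category.{v} C] [CartesianMonoidalCategory C]
    [MonoidalClosed C] [DifferentialLambdaCategory C] {𝓕 : FunSig} (M : LangModel 𝓕 C)
    (hHB : M.HahnBanach) {Γ : List Ty} {σ : Ty} (P : Tm 𝓕 Γ σ) :
    (P.WellTyped → ∃ f : M.ctx Γ ⟶ M.ty σ, M.Den P f) ∧
    (∀ f g : M.ctx Γ ⟶ M.ty σ, M.Den P f → M.Den P g → f = g) ∧
    (∀ P' : Tm 𝓕 Γ σ, Tm.ARed P P' → ∀ f : M.ctx Γ ⟶ M.ty σ, M.Den P f → M.Den P' f) ∧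
    (∀ P' : Tm 𝓕 Γ σ, Tm.Red P P' → ∀ f : M.ctx Γ ⟶ M.ty σ, M.Den P f → M.Den P' f) := by
  have den_of_sound : ∀ P' : Tm 𝓕 Γ σ, M.Sound P P' → ∀ f, M.Den P f → M.Den P' f := by
    intro P' h f hf
    rw [M.den_iff] at hf ⊢
    exact ⟨(h hf.1).1, hf.2.trans (h hf.1).2.symm⟩
  refine ⟨fun h => ⟨M.den P, (M.den_iff P _).2 ⟨M.defd_of_wellTyped h, rfl⟩⟩, ?_, ?_, ?_⟩
  · intro f g hf hg
    rw [((M.den_iff P f).1 hf).2, ((M.den_iff P g).1 hg).2]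
  · exact fun P' h => den_of_sound P' (M.sound_of_aRed h)
  · exact fun P' h => den_of_sound P' (M.sound_of_red hHB h)
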